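/- Let $L=\{L(x,y);\,x,y\ge 0\}$ be a real-valued Lévy sheet with exponent $\Psi=a+ib$ ($a,b$ real-valued) on a probability space: $L$ is a (jointly measurable) random field, continuous in probability, with $L(x,0)=L(0,y)=0$ a.s. for all $x,y\ge0$, whose rectangular increments over finitely many pairwise disjoint rectangles $(x,x']\times(y,y']\subset\mathbb{R}_+^2$ are independent, and such that for every rectangle $Q\subset\mathbb{R}_+^2$ of area $\lambda(Q)$ the increment $\Delta_Q L$ satisfies $\mathbb{E}[e^{i\xi\Delta_Q L}]=e^{-\lambda(Q)\Psi(\xi)}$, $\xi\in\mathbb{R}$. Let $\theta\in(0,2\pi)$ with $a(\theta)a(2\theta)\neq0$, let $S,T>0$, and for $\varepsilon>0$ and $(s,t)\in[0,S]\times[0,T]$ put $$X_\varepsilon(s,t)=\varepsilon K\int_0^{t/\varepsilon}\int_0^{s/\varepsilon}\sqrt{xy}\,\{\cos(\theta L(x,y))+i\sin(\theta L(x,y))\}\,dx\,dy,\qquad K=\frac{1}{\sqrt2}\,\frac{a(\theta)^2+b(\theta)^2}{a(\theta)}.$$ Let $\mathbb{P}_\varepsilon$ be the law of $X_\varepsilon$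 in the space $\mathcal{C}([0,S]\times[0,T];\mathbb{C})$ with the uniform topology, and let $\mathbb{P}$ be a probability measure on this space which is the weak limit of $\mathbb{P}_{\varepsilon_n}$ for some sequence $\varepsilon_n>0$, $\varepsilon_n\to0$. Let $X$ be the canonical process on $\mathcal{C}([0,S]\times[0,T];\mathbb{C})$, $\mathcal{F}_{s,t}=\sigma(X(u,v);\,u\le s,\ v\le t)$ its natural filtration, and $\Delta_{s,t}Y(s',t')=Y(s',t')-Y(s,t')-Y(s',t)+Y(s,t)$. Then, for all $0<s\le s'\le S$ and $0<t\le t'\le T$, the variables $(\Delta_{s,t}\mathsf{Re}(X)(s',t'))^2$ and $(\Delta_{s,t}\mathsf{Im}(X)(s',t'))^2$ are $\mathbb{P}$-integrable and, $\mathbb{P}$-almost surely, $$\mathbb{E}_{\mathbb{P}}\big[(\Delta_{s,t}\mathsf{Re}(X)(s',t'))^2\,\big|\,\mathcal{F}_{s,T}\big]=(s'-s)(t'-t),\qquad \mathbb{E}_{\mathbb{P}}\big[(\Delta_{s,t}\mathsf{Im}(X)(s',t'))^2\,\big|\,\mathcal{F}_{s,T}\big]=(s'-s)(t'-t).$$ 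-/

import Mathlib

open MeasureTheory ProbabilityTheory Filter Set
open scoped NNReal Topology

noncomputable section

/-- The rectangular increment `Δ_{s,t} Y(s',t') = Y(s',t') - Y(s,t') - Y(s',t) + Y(s,t)`. -/
def rectIncr {α β E : Type*} [AddCommGroup E] (Y : α → β → E) (s : α) (t : β) (s' : α) (t' : β) :
    E :=
  Y s' t' - Y s t' - Y s' t + Y s t

/-- `L = {L(x,y); x, y ≥ 0}` is a Lévy sheet with exponent `Ψ` under `P`: a real random field that
vanishes on the axes, is continuous in probability, has independent increments on pairwise disjoint
rectangles `(a,b] × (c,d]`, and whose increment on a rectangle `Q` has characteristic function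
`ξ ↦ exp (-λ(Q) Ψ(ξ))`. -/
structure IsLevySheet {Ω : Type*} [MeasurableSpace Ω] (P : Measure Ω)
    (L : ℝ≥0 → ℝ≥0 → Ω → ℝ) (Ψ : ℝ → ℂ) : Prop where
  measurable : ∀ x y, Measurable (L x y)
  zero_left : ∀ y, ∀ᵐ ω ∂P, L 0 y ω = 0
  zero_right : ∀ x, ∀ᵐ ω ∂P, L x 0 ω = 0
  continuous_in_probability : ∀ z : ℝ≥0 × ℝ≥0,
    TendstoInMeasure P (fun w : ℝ≥0 × ℝ≥0 => L w.1 w.2) (𝓝 z) (L z.1 z.2)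
  indep_increments : ∀ (n : ℕ) (a b c d : Fin n → ℝ≥0),
    (∀ i, a i ≤ b i) → (∀ i, c i ≤ d i) →
    (∀ i j, i ≠ j → Disjoint (Ioc (a i) (b i) ×ˢ Ioc (c i) (d i))
      (Ioc (a j) (b j) ×ˢ Ioc (c j) (d j))) →
    iIndepFun (fun i ω => rectIncr (fun x y => L x y ω) (a i) (c i) (b i) (d i)) P
  charFun_increment : ∀ a b c d : ℝ≥0, a ≤ b → c ≤ d → ∀ ξ : ℝ,
    ∫ ω, Complex.exp (Complex.I * ξ * (rectIncr (fun x y => L x y ω) a c b d : ℝ)) ∂P =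
      Complex.exp (-((((b : ℝ) - a) * ((d : ℝ) - c) : ℝ) : ℂ) * Ψ ξ)

/-- The space `C([0,S] × [0,T]; ℂ)` with its (uniform) topology. -/
abbrev SheetPath (S T : ℝ) : Type := C(Icc (0 : ℝ) S × Icc (0 : ℝ) T, ℂ)

/-- `C([0,S] × [0,T]; ℂ)` carries its Borel σ-algebra. -/
instance instMeasurableSpaceSheetPath (S T : ℝ) : MeasurableSpace (SheetPath S T) := borel _

instance instBorelSpaceSheetPath (S T : ℝ) : BorelSpace (SheetPath S T) := ⟨rfl⟩

/-- The constant `K = (1/√2) (a(θ)² + b(θ)²) / a(θ)`, where `Ψ = a + i b`. -/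
def sheetConst (Ψ : ℝ → ℂ) (θ : ℝ) : ℝ :=
  1 / √2 * (((Ψ θ).re ^ 2 + (Ψ θ).im ^ 2) / (Ψ θ).re)

/-- The integrand `√(xy) (cos (θ L(x,y)) + i sin (θ L(x,y)))`, used for `x, y ≥ 0`. -/
def sheetIntegrand {Ω : Type*} (L : ℝ≥0 → ℝ≥0 → Ω → ℝ) (θ : ℝ) (ω : Ω) (x y : ℝ) : ℂ :=
  (√(x * y) : ℝ) * ((Real.cos (θ * L x.toNNReal y.toNNReal ω) : ℝ) +
    Complex.I * (Real.sin (θ * L x.toNNReal y.toNNReal ω) : ℝ))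

/-- The random field
`X_ε(s,t) = ε K ∫_0^{t/ε} ∫_0^{s/ε} √(xy) (cos (θ L(x,y)) + i sin (θ L(x,y))) dx dy`. -/
def approxField {Ω : Type*} (L : ℝ≥0 → ℝ≥0 → Ω → ℝ) (Ψ : ℝ → ℂ) (θ ε : ℝ) (ω : Ω) (s t : ℝ) : ℂ :=
  (ε : ℂ) * (sheetConst Ψ θ : ℂ) *
    ∫ y in (0 : ℝ)..(t / ε), ∫ x in (0 : ℝ)..(s / ε), sheetIntegrand L θ ω x y

section Regularity

variable {Ω : Type*} {L : ℝ≥0 → ℝ≥0 → Ω → ℝ}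

theorem norm_sheetIntegrand_le (θ : ℝ) (ω : Ω) (x y : ℝ) {R : ℝ} (hx : |x| ≤ R) (hy : |y| ≤ R) :
    ‖sheetIntegrand L θ ω x y‖ ≤ R := by
  have hR : 0 ≤ R := (abs_nonneg x).trans hx
  have h1 : ‖((Real.cos (θ * L x.toNNReal y.toNNReal ω) : ℝ) +
    Complex.I * (Real.sin (θ * L x.toNNReal y.toNNReal ω) : ℝ) : ℂ)‖ = 1 := by
    rw [mul_comm Complex.I, Complex.ofReal_cos, Complex.ofReal_sin, ← Complex.exp_mul_I,
      Complex.norm_exp_ofReal_mul_I]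
  rw [sheetIntegrand, norm_mul, h1, mul_one, Complex.norm_real, Real.norm_of_nonneg (by positivity)]
  rw [Real.sqrt_le_left hR, sq]
  calc x * y ≤ |x * y| := le_abs_self _
    _ = |x| * |y| := abs_mul _ _
    _ ≤ R * R := by gcongr

variable [MeasurableSpace Ω]

theorem measurable_sheetIntegrand
    (hL : Measurable fun p : (ℝ≥0 × ℝ≥0) × Ω => L p.1.1 p.1.2 p.2) (θ : ℝ) :
    Measurable fun p : (Ω × ℝ) × ℝ => sheetIntegrand L θ p.1.1 p.2 p.1.2 := by
  have h : Measurable fun p : (Ω × ℝ) × ℝ =>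
      θ * L p.2.toNNReal p.1.2.toNNReal p.1.1 :=
    (hL.comp (g := fun p : (ℝ≥0 × ℝ≥0) × Ω => L p.1.1 p.1.2 p.2)
      (f := fun p : (Ω × ℝ) × ℝ => ((p.2.toNNReal, p.1.2.toNNReal), p.1.1))
      (by fun_prop)).const_mul θ
  have hc := Complex.measurable_ofReal.comp (Real.measurable_cos.comp h)
  have hs := Complex.measurable_ofReal.comp (Real.measurable_sin.comp h)
  have hq : Measurable fun p : (Ω × ℝ) × ℝ => ((√(p.2 * p.1.2) : ℝ) : ℂ) := by fun_prop
  exact hq.mul (hc.add (hs.const_mul Complex.I))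

theorem stronglyMeasurable_inner
    (hL : Measurable fun p : (ℝ≥0 × ℝ≥0) × Ω => L p.1.1 p.1.2 p.2) (θ a : ℝ) :
    StronglyMeasurable fun p : Ω × ℝ => ∫ x in (0 : ℝ)..a, sheetIntegrand L θ p.1 x p.2 := by
  have h := (measurable_sheetIntegrand hL θ).stronglyMeasurable
  unfold intervalIntegral
  exact (h.integral_prod_right' (ν := volume.restrict (Ioc 0 a))).sub
    (h.integral_prod_right' (ν := volume.restrict (Ioc a 0)))

theorem stronglyMeasurable_approxField
    (hL : Measurable fun p : (ℝ≥0 × ℝ≥0) × Ω => L p.1.1 p.1.2 p.2) (Ψ : ℝ → ℂ) (θ ε s t : ℝ) :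
    StronglyMeasurable fun ω => approxField L Ψ θ ε ω s t := by
  have h := stronglyMeasurable_inner hL θ (s / ε)
  unfold approxField
  refine StronglyMeasurable.const_mul ?_ _
  rw [show (fun ω => ∫ y in (0 : ℝ)..(t / ε), ∫ x in (0 : ℝ)..(s / ε), sheetIntegrand L θ ω x y) =
    fun ω => (∫ y in Ioc 0 (t / ε), ∫ x in (0 : ℝ)..(s / ε), sheetIntegrand L θ ω x y) -
      ∫ y in Ioc (t / ε) 0, ∫ x in (0 : ℝ)..(s / ε), sheetIntegrand L θ ω x y from rfl]
  exact (h.integral_prod_right' (ν := volume.restrict (Ioc 0 (t / ε)))).sub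
    (h.integral_prod_right' (ν := volume.restrict (Ioc (t / ε) 0)))

theorem abs_le_of_mem_uIoc {a b x R : ℝ} (ha : |a| ≤ R) (hb : |b| ≤ R) (hx : x ∈ uIoc a b) :
    |x| ≤ R := by
  rw [abs_le] at *
  rcases mem_uIoc.1 hx with h | h <;> constructor <;> linarith [h.1, h.2]

theorem norm_double_integral_sub_le
    (hL : Measurable fun p : (ℝ≥0 × ℝ≥0) × Ω => L p.1.1 p.1.2 p.2) (θ : ℝ) (ω : Ω)
    {R s t s' t' : ℝ} (hs : |s| ≤ R) (ht : |t| ≤ R) (hs' : |s'| ≤ R) (ht' : |t'| ≤ R) :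
    ‖(∫ y in (0 : ℝ)..t', ∫ x in (0 : ℝ)..s', sheetIntegrand L θ ω x y) -
      ∫ y in (0 : ℝ)..t, ∫ x in (0 : ℝ)..s, sheetIntegrand L θ ω x y‖ ≤
      R * R * (|s' - s| + |t' - t|) := by
  have hR : 0 ≤ R := (abs_nonneg s).trans hs
  have h0 : |(0 : ℝ)| ≤ R := by simpa using hR
  have hin : ∀ {a b y : ℝ}, |a| ≤ R → |b| ≤ R → |y| ≤ R →
      ‖∫ x in a..b, sheetIntegrand L θ ω x y‖ ≤ R * |b - a| := fun ha hb hy =>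
    intervalIntegral.norm_integral_le_of_norm_le_const fun x hx =>
      norm_sheetIntegrand_le θ ω x _ (abs_le_of_mem_uIoc ha hb hx) hy
  have hii : ∀ {a b y : ℝ}, |a| ≤ R → |b| ≤ R → |y| ≤ R →
      IntervalIntegrable (fun x => sheetIntegrand L θ ω x y) volume a b := by
    intro a b y ha hb hy
    rw [intervalIntegrable_iff]
    refine Measure.integrableOn_of_bounded (M := R) (by simp) ?_ ?_
    · exact ((measurable_sheetIntegrand hL θ).comp
        (measurable_prodMk_left (x := (ω, y)))).aestronglyMeasurable
    · exact (ae_restrict_iff' measurableSet_uIoc).2 (ae_of_all _ fun x hx =>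
        norm_sheetIntegrand_le θ ω x _ (abs_le_of_mem_uIoc ha hb hx) hy)
  have hoi : ∀ {c a b : ℝ}, |c| ≤ R → |a| ≤ R → |b| ≤ R →
      IntervalIntegrable (fun y => ∫ x in (0 : ℝ)..c, sheetIntegrand L θ ω x y) volume a b := by
    intro c a b hc ha hb
    rw [intervalIntegrable_iff]
    refine Measure.integrableOn_of_bounded (M := R * |c - 0|) (by simp) ?_ ?_
    · exact ((stronglyMeasurable_inner hL θ c).comp_measurable
        (measurable_prodMk_left (x := ω))).aestronglyMeasurable
    · exact (ae_restrict_iff' measurableSet_uIoc).2 (ae_of_all _ fun y hy =>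
        hin h0 hc (abs_le_of_mem_uIoc ha hb hy))
  have e1 : (∫ y in (0 : ℝ)..t', ∫ x in (0 : ℝ)..s', sheetIntegrand L θ ω x y) =
      (∫ y in (0 : ℝ)..t, ∫ x in (0 : ℝ)..s', sheetIntegrand L θ ω x y) +
        ∫ y in t..t', ∫ x in (0 : ℝ)..s', sheetIntegrand L θ ω x y :=
    (intervalIntegral.integral_add_adjacent_intervals (hoi hs' h0 ht) (hoi hs' ht ht')).symm
  rw [e1, add_sub_right_comm, ← intervalIntegral.integral_sub (hoi hs' h0 ht) (hoi hs h0 ht)]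
  have b1 : ‖∫ y in (0 : ℝ)..t, ((∫ x in (0 : ℝ)..s', sheetIntegrand L θ ω x y) -
      ∫ x in (0 : ℝ)..s, sheetIntegrand L θ ω x y)‖ ≤ R * |s' - s| * |t - 0| := by
    refine intervalIntegral.norm_integral_le_of_norm_le_const fun y hy => ?_
    have hy' := abs_le_of_mem_uIoc h0 ht hy
    rw [intervalIntegral.integral_interval_sub_left (hii h0 hs' hy') (hii h0 hs hy')]
    exact hin hs hs' hy'
  have b2 : ‖∫ y in t..t', ∫ x in (0 : ℝ)..s', sheetIntegrand L θ ω x y‖ ≤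
      R * |s' - 0| * |t' - t| :=
    intervalIntegral.norm_integral_le_of_norm_le_const fun y hy =>
      hin h0 hs' (abs_le_of_mem_uIoc ht ht' hy)
  rw [sub_zero] at b1 b2
  calc _ ≤ _ := norm_add_le _ _
    _ ≤ R * |s' - s| * |t| + R * |s'| * |t' - t| := add_le_add b1 b2
    _ ≤ R * |s' - s| * R + R * R * |t' - t| := by gcongr
    _ = _ := by ring

theorem continuous_approxField
    (hL : Measurable fun p : (ℝ≥0 × ℝ≥0) × Ω => L p.1.1 p.1.2 p.2)
    (Ψ : ℝ → ℂ) (θ ε : ℝ) (ω : Ω) :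
    Continuous fun z : ℝ × ℝ => approxField L Ψ θ ε ω z.1 z.2 := by
  unfold approxField
  refine continuous_const.mul ?_
  suffices h : Continuous fun z : ℝ × ℝ =>
      ∫ y in (0 : ℝ)..z.2, ∫ x in (0 : ℝ)..z.1, sheetIntegrand L θ ω x y from
    h.comp (g := fun z : ℝ × ℝ =>
      ∫ y in (0 : ℝ)..z.2, ∫ x in (0 : ℝ)..z.1, sheetIntegrand L θ ω x y)
      (f := fun z : ℝ × ℝ => (z.1 / ε, z.2 / ε)) (by fun_prop)
  rw [continuous_iff_continuousAt]
  intro z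
  set R : ℝ := |z.1| + |z.2| + 1 with hRdef
  rw [ContinuousAt, tendsto_iff_norm_sub_tendsto_zero]
  have hlim : Tendsto (fun w : ℝ × ℝ => R * R * (|w.1 - z.1| + |w.2 - z.2|)) (𝓝 z) (𝓝 0) := by
    have : Continuous fun w : ℝ × ℝ => R * R * (|w.1 - z.1| + |w.2 - z.2|) := by fun_prop
    simpa using this.tendsto z
  refine squeeze_zero' (Eventually.of_forall fun _ => norm_nonneg _) ?_ hlim
  have e1 : ∀ᶠ w : ℝ × ℝ in 𝓝 z, |w.1| < R :=
    (continuous_fst.abs.tendsto z).eventually_lt_const (by linarith [abs_nonneg z.1, abs_nonneg z.2])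
  have e2 : ∀ᶠ w : ℝ × ℝ in 𝓝 z, |w.2| < R :=
    (continuous_snd.abs.tendsto z).eventually_lt_const (by linarith [abs_nonneg z.1, abs_nonneg z.2])
  filter_upwards [e1, e2] with w h1 h2
  exact norm_double_integral_sub_le hL θ ω (by linarith [abs_nonneg z.2])
    (by linarith [abs_nonneg z.1]) h1.le h2.le

end Regularity

/-- `X_ε` as a map from `Ω` to `C([0,S] × [0,T]; ℂ)`. -/
def approxPath {Ω : Type*} [MeasurableSpace Ω] (L : ℝ≥0 → ℝ≥0 → Ω → ℝ)
    (hL : Measurable fun p : (ℝ≥0 × ℝ≥0) × Ω => L p.1.1 p.1.2 p.2)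
    (Ψ : ℝ → ℂ) (θ ε S T : ℝ) (ω : Ω) : SheetPath S T where
  toFun z := approxField L Ψ θ ε ω z.1 z.2
  continuous_toFun := (continuous_approxField hL Ψ θ ε ω).comp
    (f := fun z : Icc (0 : ℝ) S × Icc (0 : ℝ) T => ((z.1 : ℝ), (z.2 : ℝ))) (by fun_prop)

/-- A map into `C([0,S] × [0,T]; ℂ)` with measurable evaluations is Borel measurable. -/
theorem measurable_sheetPath {Ω : Type*} [MeasurableSpace Ω] {S T : ℝ} {X : Ω → SheetPath S T}
    (hX : ∀ z, Measurable fun ω => X ω z) : Measurable X := by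
  have hb : instMeasurableSpaceSheetPath S T = _ :=
    borel_eq_generateFrom_of_subbasis
      (ContinuousMap.compactOpen_eq (X := Icc (0 : ℝ) S × Icc (0 : ℝ) T) (Y := ℂ))
  rw [hb]
  refine measurable_generateFrom ?_
  rintro _ ⟨C, hC, U, hU, rfl⟩
  replace hU : IsOpen U := hU
  replace hC : IsCompact C := hC
  rcases C.eq_empty_or_nonempty with rfl | hne
  · simp [mapsTo_empty]
  rcases (Uᶜ).eq_empty_or_nonempty with hUe | hUne
  · rw [compl_empty_iff.1 hUe]; simp
  obtain ⟨D, hDc, hDd⟩ := TopologicalSpace.exists_countable_dense C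
  have hset : X ⁻¹' {f : SheetPath S T | MapsTo f C U} =
      ⋃ n : ℕ, ⋂ d ∈ D, {ω | 1 / ((n : ℝ) + 1) ≤ Metric.infDist (X ω d) Uᶜ} := by
    ext ω
    have hcont : Continuous fun z => Metric.infDist (X ω z) Uᶜ :=
      (Metric.continuous_infDist_pt _).comp (X ω).continuous
    simp only [mem_preimage, mem_ofPred_eq, mem_iUnion, mem_iInter]
    constructor
    · intro h
      obtain ⟨z, hz, hmin⟩ := hC.exists_isMinOn hne hcont.continuousOn
      have hpos : 0 < Metric.infDist (X ω z) Uᶜ :=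
        (hU.isClosed_compl.notMem_iff_infDist_pos hUne).1 fun hc => hc (h hz)
      obtain ⟨n, hn⟩ := exists_nat_one_div_lt hpos
      exact ⟨n, fun d _ => hn.le.trans (hmin d.2)⟩
    · rintro ⟨n, hn⟩ z hz
      have hcl : IsClosed {c : C | 1 / ((n : ℝ) + 1) ≤ Metric.infDist (X ω c) Uᶜ} :=
        isClosed_le continuous_const (hcont.comp continuous_subtype_val)
      have hall : (⟨z, hz⟩ : C) ∈ {c : C | 1 / ((n : ℝ) + 1) ≤ Metric.infDist (X ω c) Uᶜ} :=
        closure_minimal (fun d hd => hn d hd) hcl (hDd _)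
      have hpos : 0 < Metric.infDist (X ω z) Uᶜ :=
        lt_of_lt_of_le (by positivity) hall
      exact not_not.1 ((hU.isClosed_compl.notMem_iff_infDist_pos hUne).2 hpos)
  rw [hset]
  exact MeasurableSet.iUnion fun n => MeasurableSet.biInter hDc fun d _ =>
    measurableSet_le measurable_const
      ((Metric.continuous_infDist_pt _).measurable.comp (hX d))

theorem measurable_approxPath {Ω : Type*} [MeasurableSpace Ω] (L : ℝ≥0 → ℝ≥0 → Ω → ℝ)
    (hL : Measurable fun p : (ℝ≥0 × ℝ≥0) × Ω => L p.1.1 p.1.2 p.2)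
    (Ψ : ℝ → ℂ) (θ ε S T : ℝ) : Measurable (approxPath L hL Ψ θ ε S T) :=
  measurable_sheetPath fun z => (stronglyMeasurable_approxField hL Ψ θ ε z.1 z.2).measurable

/-- The law `P_ε` of `X_ε` in `C([0,S] × [0,T]; ℂ)`. -/
def approxLaw {Ω : Type*} [MeasurableSpace Ω] (P : Measure Ω) [IsProbabilityMeasure P]
    (L : ℝ≥0 → ℝ≥0 → Ω → ℝ)
    (hL : Measurable fun p : (ℝ≥0 × ℝ≥0) × Ω => L p.1.1 p.1.2 p.2)
    (Ψ : ℝ → ℂ) (θ ε S T : ℝ) : ProbabilityMeasure (SheetPath S T) :=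
  ⟨P.map (approxPath L hL Ψ θ ε S T),
    Measure.isProbabilityMeasure_map (measurable_approxPath L hL Ψ θ ε S T).aemeasurable⟩

/-- The canonical process `X(s,t)(x) = x(s,t)` on `C([0,S] × [0,T]; ℂ)`. -/
def canonicalProcess (S T : ℝ) (z : Icc (0 : ℝ) S × Icc (0 : ℝ) T) (x : SheetPath S T) : ℂ := x z

theorem stronglyMeasurable_canonicalProcess (S T : ℝ) (z : Icc (0 : ℝ) S × Icc (0 : ℝ) T) :
    StronglyMeasurable (canonicalProcess S T z) :=
  (ContinuousEvalConst.continuous_eval_const (F := SheetPath S T) z).measurable.stronglyMeasurable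

/-- The natural filtration `F_{s,t} = σ(X(u,v); u ≤ s, v ≤ t)` of the canonical process, indexed by
`[0,S] × [0,T]` with the product order. -/
def canonicalFiltration (S T : ℝ) :
    Filtration (Icc (0 : ℝ) S × Icc (0 : ℝ) T) (instMeasurableSpaceSheetPath S T) :=
  Filtration.natural (canonicalProcess S T) (stronglyMeasurable_canonicalProcess S T)

end

/-!
Why the theorem is true. Replacing the sheet by `(x, y) ↦ L(x/ε, y/ε)`, again a Lévy sheet, with
exponent `ε⁻² Ψ` (`IsLevySheet.rescale`), turns the increment of `X_ε` over a rectangle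
`(s,s'] × (t,t']` into `K ε⁻² Y`, where `Y` is the integral of `√(xy) exp (iθL(x,y))` over that same
rectangle for the rescaled sheet (`rectIncr_approxField`). So one has to understand the moments of
`Y` when the exponent is multiplied by a large number `N = ε⁻²`.

All moments reduce to characteristic functions of linear combinations of values of the sheet. Such a
combination is the integral of a step function against the independent increments, so its
characteristic function is an explicit exponential
(`IsLevySheet.integrable_and_charFun_sum`). Since `Re Ψ ≥ 0`, its modulus is bounded by the
contribution of any part of the plane, which produces kernels `exp (-N a t |x - x'|)` decaying away
from the diagonal.

* Fourth moment. `E|Y|⁴` is bounded by the sum over the pairings of four abscissas times the same sum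
  for ordinates, hence is `O(N⁻⁴)` (`IsLevySheet.integral_norm_blockIntegral_pow_four_le`). The
  increments of `X_ε` are therefore bounded in `L⁴`, and their squares are uniformly integrable.
* Second moment. Blowing up around the diagonal at scale `1/N`, `N² E|Y|²` converges to
  `(2a/|Ψ(θ)|²)²` times the area (`tendsto_integral_phaseCovariance`); the normalisation `K` makes the
  limit of `E|ΔX_ε|²` equal to twice the area.
* Square without modulus. The phase `exp (iθ(L(z) + L(z')))` contains the phase at frequency `2θ` of
  the part of the sheet over `(r, s] × (0, t]`, so that `E[F Y²]` is exponentially small in `N` for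
  functionals `F` of the sheet to the left of `r < s` (`IsLevySheet.norm_integral_mul_sq_le`). This is
  where `a(2θ) ≠ 0` enters.
* Decorrelation from the past. Given the sheet to the left of `r`, the conditional expectation of
  `|Y|²` is an integral of phases depending on the increments of `y ↦ L(r, y)` over short intervals.
  Phases over disjoint intervals are independent, so this integral has a variance of order `N⁻⁵`,
  negligible with respect to `N⁻⁴` (`IsLevySheet.sq_norm_integral_mul_normSq_sub_le`).

Together, `E[F (Re ΔX_ε)²]` and `E[F (Im ΔX_ε)²]` are asymptotic to the area times `E[F]`, for bounded
functionals `F` of the past of `r` (`IsLevySheet.tendsto_integral_mul_sq_rectIncr`). Uniform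
integrability carries this to the weak limit for continuous functionals of the path before `r`; then
`r` increases to `s`, and bounded continuous functions of finitely many coordinates determine the
conditional expectation given the σ-algebra generated by the process
(`condExp_comap_process_eq_const`).
-/

/-! ### Joint characteristic function of a Lévy sheet -/

theorem exists_monotone_grid (F : Finset ℝ≥0) :
    ∃ (M : ℕ) (g : ℕ → ℝ≥0), Monotone g ∧ g 0 = 0 ∧ ∀ a ∈ F, ∃ i ≤ M, g i = a := by
  have hne : (insert 0 F).card ≠ 0 := by simp
  obtain ⟨M, hM⟩ := Nat.exists_eq_succ_of_ne_zero hne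
  let e := (insert 0 F).orderEmbOfFin hM
  have hmem : ∀ a ∈ insert 0 F, ∃ i : Fin (M + 1), e i = a := by
    intro a ha
    have : a ∈ Set.range e := by
      rw [Finset.range_orderEmbOfFin]; exact ha
    exact this
  refine ⟨M, fun n => e ⟨min n M, by omega⟩, ?_, ?_, ?_⟩
  · intro a b hab
    exact e.monotone (by simp only [Fin.mk_le_mk]; omega)
  · obtain ⟨i, hi⟩ := hmem 0 (by simp)
    have : e ⟨min 0 M, by omega⟩ ≤ e i := e.monotone (by simp)
    rw [hi] at this
    exact le_antisymm this zero_le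
  · intro a ha
    obtain ⟨i, hi⟩ := hmem a (by simp [ha])
    refine ⟨i, Nat.lt_succ_iff.1 i.2, ?_⟩
    rw [← hi]
    exact congrArg e (Fin.ext (min_eq_left (Nat.lt_succ_iff.1 i.2)))

theorem sum_ite_rectIncr_grid {α β E : Type*} [AddCommGroup E] (Y : α → β → E) (g : ℕ → α)
    (h : ℕ → β) {M N m n : ℕ} (hm : m ≤ M) (hn : n ≤ N) :
    ∑ q : Fin M × Fin N, (if (q.1 : ℕ) < m ∧ (q.2 : ℕ) < n then
      rectIncr Y (g q.1) (h q.2) (g (q.1 + 1)) (h (q.2 + 1)) else 0) =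
      rectIncr Y (g 0) (h 0) (g m) (h n) := by
  have tr : ∀ {K k : ℕ} (f : ℕ → E), k ≤ K →
      ∑ i ∈ Finset.range K, (if i < k then f i else 0) = ∑ i ∈ Finset.range k, f i := by
    intro K k f hk
    rw [← Finset.sum_filter]
    congr 1
    ext i
    simp; omega
  rw [Fintype.sum_prod_type]
  simp only [ite_and]
  rw [Fin.sum_univ_eq_sum_range (fun i => ∑ j : Fin N, if i < m then if (j : ℕ) < n then
    rectIncr Y (g i) (h j) (g (i + 1)) (h (j + 1)) else 0 else 0) M]
  have : ∀ i, (∑ j : Fin N, if i < m then if (j : ℕ) < n then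
      rectIncr Y (g i) (h j) (g (i + 1)) (h (j + 1)) else 0 else 0) =
      if i < m then (rectIncr Y (g i) (h 0) (g (i + 1)) (h n)) else 0 := by
    intro i
    split_ifs with hi
    · rw [Fin.sum_univ_eq_sum_range (fun j => if j < n then
        rectIncr Y (g i) (h j) (g (i + 1)) (h (j + 1)) else 0) N, tr _ hn]
      have := Finset.sum_range_sub (fun j => Y (g (i + 1)) (h j) - Y (g i) (h j)) n
      simp only [rectIncr]
      rw [Finset.sum_congr rfl (g := fun j => (Y (g (i + 1)) (h (j + 1)) - Y (g i) (h (j + 1))) -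
        (Y (g (i + 1)) (h j) - Y (g i) (h j))) (fun _ _ => by abel), this]
      abel
    · simp
  simp only [this]
  rw [tr _ hm]
  have := Finset.sum_range_sub (fun i => Y (g i) (h n) - Y (g i) (h 0)) m
  simp only [rectIncr]
  rw [Finset.sum_congr rfl (g := fun i => (Y (g (i + 1)) (h n) - Y (g (i + 1)) (h 0)) -
        (Y (g i) (h n) - Y (g i) (h 0))) (fun _ _ => by abel), this]
  abel

theorem exists_mem_Ioc_grid {g : ℕ → ℝ} {m : ℕ} {x : ℝ} (h0 : g 0 < x) (hm : x ≤ g m) :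
    ∃ i < m, x ∈ Ioc (g i) (g (i + 1)) := by
  classical
  have hex : ∃ n, x ≤ g n := ⟨m, hm⟩
  have hpos : Nat.find hex ≠ 0 := by
    intro h
    have := Nat.find_spec hex
    rw [h] at this
    linarith
  obtain ⟨i, hi⟩ := Nat.exists_eq_succ_of_ne_zero hpos
  have hle : Nat.find hex ≤ m := Nat.find_min' hex hm
  refine ⟨i, by omega, ?_, ?_⟩
  · have := Nat.find_min hex (m := i) (by omega)
    exact not_le.1 this
  · have := Nat.find_spec hex
    rwa [hi] at this

theorem lt_iff_of_mem_Ioc_grid {g : ℕ → ℝ} (hg : Monotone g) {i k : ℕ} {x : ℝ}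
    (hx : x ∈ Ioc (g i) (g (i + 1))) : x ≤ g k ↔ i < k := by
  constructor
  · intro h
    by_contra hk
    have := hg (not_lt.1 hk)
    linarith [hx.1]
  · intro h
    exact hx.2.trans (hg h)

theorem eq_of_mem_Ioc_grid {g : ℕ → ℝ} (hg : Monotone g) {i k : ℕ} {x : ℝ}
    (hx : x ∈ Ioc (g i) (g (i + 1))) (hx' : x ∈ Ioc (g k) (g (k + 1))) : i = k := by
  have h1 := (lt_iff_of_mem_Ioc_grid hg hx).1 hx'.2
  have h2 := (lt_iff_of_mem_Ioc_grid hg hx').1 hx.2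
  omega

/-- The step function `∑ c_k 1_{(0,x_k] × (0,y_k]}` attached to finitely many points
`p_k = (x_k, y_k)` with weights `c_k`: the integrand representing `∑ c_k L(p_k)` as an integral
against the sheet. -/
noncomputable def sheetHeight {ι : Type*} [Fintype ι] (p : ι → ℝ≥0 × ℝ≥0) (c : ι → ℝ)
    (w : ℝ × ℝ) : ℝ :=
  ∑ k, (Ioc (0 : ℝ) (p k).1 ×ˢ Ioc (0 : ℝ) (p k).2).indicator (fun _ => c k) w

/-- Taking `r` small makes `r * w` too short to be a nonzero multiple of `2πi`. Used to recover the
exponent from the family `exp (-r Ψ(ξ))`, the complex logarithm being multivalued. -/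
theorem eq_zero_of_forall_exp_mul_eq_one {w : ℂ}
    (h : ∀ r : ℝ, 0 ≤ r → Complex.exp (r * w) = 1) : w = 0 := by
  set r : ℝ := 1 / (1 + ‖w‖) with hr
  have hrpos : 0 < r := by positivity
  obtain ⟨n, hn⟩ := Complex.exp_eq_one_iff.1 (h r hrpos.le)
  have hlt : ‖(r : ℂ) * w‖ < 1 := by
    rw [norm_mul, Complex.norm_real, Real.norm_of_nonneg hrpos.le, hr, one_div,
      inv_mul_lt_one₀ (by positivity)]
    linarith
  rw [hn] at hlt
  have h2 : ‖(n : ℂ) * (2 * Real.pi * Complex.I)‖ = |(n : ℝ)| * (2 * Real.pi) := by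
    simp [abs_of_pos Real.pi_pos]
  rw [h2] at hlt
  have hn0 : n = 0 := by
    by_contra hne
    have : (1 : ℝ) ≤ |(n : ℝ)| := by exact_mod_cast Int.one_le_abs hne
    nlinarith [Real.pi_gt_three]
  rw [hn0] at hn
  simp only [Int.cast_zero, zero_mul, mul_eq_zero, Complex.ofReal_eq_zero] at hn
  exact hn.resolve_left hrpos.ne'

namespace IsLevySheet

variable {Ω : Type*} [MeasurableSpace Ω] {P : Measure Ω}
  {L : ℝ≥0 → ℝ≥0 → Ω → ℝ} {Ψ : ℝ → ℂ}

theorem charFun_unit (hL : IsLevySheet P L Ψ) {r : ℝ} (hr : 0 ≤ r) (ξ : ℝ) :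
    ∫ ω, Complex.exp (Complex.I * ξ * (rectIncr (fun x y => L x y ω) 0 0 r.toNNReal 1 : ℝ)) ∂P =
      Complex.exp (-(r : ℂ) * Ψ ξ) := by
  rw [hL.charFun_increment 0 r.toNNReal 0 1 zero_le zero_le ξ]
  simp [Real.coe_toNNReal r hr]

theorem exponent_zero [IsProbabilityMeasure P] (hL : IsLevySheet P L Ψ) : Ψ 0 = 0 := by
  have : -Ψ 0 = 0 := by
    refine eq_zero_of_forall_exp_mul_eq_one fun r hr => ?_
    have := hL.charFun_unit hr 0
    simp at this
    rw [mul_neg, ← this]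
  simpa using this

theorem exponent_neg (hL : IsLevySheet P L Ψ) (ξ : ℝ) : Ψ (-ξ) = (starRingEnd ℂ) (Ψ ξ) := by
  have : (starRingEnd ℂ) (Ψ ξ) - Ψ (-ξ) = 0 := by
    refine eq_zero_of_forall_exp_mul_eq_one fun r hr => ?_
    have h1 := hL.charFun_unit hr ξ
    have h2 := hL.charFun_unit hr (-ξ)
    have h3 := congrArg (starRingEnd ℂ) h1
    rw [← integral_conj, ← Complex.exp_conj] at h3
    have h4 : Complex.exp (-(r : ℂ) * Ψ (-ξ)) =
        Complex.exp (-(r : ℂ) * (starRingEnd ℂ) (Ψ ξ)) := by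
      rw [← h2]
      convert h3 using 1
      · congr 1
        ext ω
        rw [← Complex.exp_conj]
        simp
      · simp
    have e : (r : ℂ) * ((starRingEnd ℂ) (Ψ ξ) - Ψ (-ξ)) =
      (-(r : ℂ) * Ψ (-ξ)) - (-(r : ℂ) * (starRingEnd ℂ) (Ψ ξ)) := by ring
    rw [e, Complex.exp_sub, h4, div_self (Complex.exp_ne_zero _)]
  exact (sub_eq_zero.1 this).symm

theorem exponent_re_of_abs (hL : IsLevySheet P L Ψ) {θ σ : ℝ} (h : |σ| = 1) :
    (Ψ (θ * σ)).re = (Ψ θ).re := by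
  rcases (abs_eq zero_le_one).1 h with h | h
  · rw [h, mul_one]
  · rw [h, mul_neg, mul_one, hL.exponent_neg, Complex.conj_re]

theorem exponent_re_nonneg [IsProbabilityMeasure P] (hL : IsLevySheet P L Ψ) (ξ : ℝ) : 0 ≤ (Ψ ξ).re := by
  have h := hL.charFun_unit zero_le_one ξ
  have h1 : ‖Complex.exp (-((1 : ℝ) : ℂ) * Ψ ξ)‖ ≤ 1 := by
    rw [← h]
    refine (norm_integral_le_of_norm_le_const (C := 1) (ae_of_all _ fun ω => ?_)).trans
      (by simp)
    rw [Complex.norm_exp]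
    simp
  rw [Complex.norm_exp] at h1
  have := Real.exp_le_one_iff.1 h1
  simpa using this

/-- Joint characteristic function of a Lévy sheet: `∑ c_k L(p_k)` is the integral of the step
function `sheetHeight p c` against the sheet, so its characteristic function is
`exp (-∫ Ψ ∘ sheetHeight)`. The proof refines all rectangles to a common grid. -/
theorem integrable_and_charFun_sum [IsProbabilityMeasure P] (hL : IsLevySheet P L Ψ) {ι : Type*} [Fintype ι]
    (p : ι → ℝ≥0 × ℝ≥0) (c : ι → ℝ) :
    Integrable (fun w => Ψ (sheetHeight p c w)) (volume : Measure (ℝ × ℝ)) ∧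
    ∫ ω, Complex.exp (Complex.I * ((∑ k, c k * L (p k).1 (p k).2 ω : ℝ) : ℂ)) ∂P =
      Complex.exp (-∫ w : ℝ × ℝ, Ψ (sheetHeight p c w)) := by
  classical
  obtain ⟨M, g, hg, hg0, hgk⟩ := exists_monotone_grid (Finset.univ.image fun k => (p k).1)
  obtain ⟨N, h, hh, hh0, hhk⟩ := exists_monotone_grid (Finset.univ.image fun k => (p k).2)
  have hgk' : ∀ k, ∃ i ≤ M, g i = (p k).1 := fun k => hgk _ (by simp)
  have hhk' : ∀ k, ∃ i ≤ N, h i = (p k).2 := fun k => hhk _ (by simp)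
  choose I hIM hI using hgk'
  choose J hJN hJ using hhk'
  let C : Fin M × Fin N → ℝ := fun q => ∑ k, if (q.1 : ℕ) < I k ∧ (q.2 : ℕ) < J k then c k else 0
  let X : Fin M × Fin N → Ω → ℝ := fun q ω =>
    rectIncr (fun x y => L x y ω) (g q.1) (h q.2) (g (q.1 + 1)) (h (q.2 + 1))
  let A : Fin M × Fin N → Set (ℝ × ℝ) := fun q =>
    Ioc (g q.1 : ℝ) (g (q.1 + 1)) ×ˢ Ioc (h q.2 : ℝ) (h (q.2 + 1))
  have hgR : Monotone fun n => (g n : ℝ) := fun a b hab => NNReal.coe_le_coe.2 (hg hab)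
  have hhR : Monotone fun n => (h n : ℝ) := fun a b hab => NNReal.coe_le_coe.2 (hh hab)
  -- the increments over the cells of the grid are independent
  have hXm : ∀ q, Measurable (X q) := fun q =>
    ((((hL.measurable _ _).sub (hL.measurable _ _)).sub (hL.measurable _ _)).add
      (hL.measurable _ _))
  have hind : iIndepFun X P := by
    have := hL.indep_increments (M * N)
      (fun i => g (finProdFinEquiv.symm i).1) (fun i => g ((finProdFinEquiv.symm i).1 + 1))
      (fun i => h (finProdFinEquiv.symm i).2) (fun i => h ((finProdFinEquiv.symm i).2 + 1))
      (fun i => hg (Nat.le_succ _)) (fun i => hh (Nat.le_succ _)) ?_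
    · have := this.precomp (g := finProdFinEquiv) finProdFinEquiv.injective
      simpa using this
    · intro i j hij
      rw [Set.disjoint_left]
      rintro ⟨x, y⟩ ⟨h1, h2⟩ ⟨h3, h4⟩
      apply hij
      have e1 := eq_of_mem_Ioc_grid hgR (x := (x : ℝ))
        (i := (finProdFinEquiv.symm i).1) (k := (finProdFinEquiv.symm j).1)
        ⟨by exact_mod_cast h1.1, by exact_mod_cast h1.2⟩
        ⟨by exact_mod_cast h3.1, by exact_mod_cast h3.2⟩
      have e2 := eq_of_mem_Ioc_grid hhR (x := (y : ℝ))
        (i := (finProdFinEquiv.symm i).2) (k := (finProdFinEquiv.symm j).2)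
        ⟨by exact_mod_cast h2.1, by exact_mod_cast h2.2⟩
        ⟨by exact_mod_cast h4.1, by exact_mod_cast h4.2⟩
      exact finProdFinEquiv.symm.injective (Prod.ext (Fin.ext e1) (Fin.ext e2))
  have hsum : ∀ᵐ ω ∂P, ∑ k, c k * L (p k).1 (p k).2 ω = ∑ q, C q * X q ω := by
    have hz : ∀ᵐ ω ∂P, ∀ k, L 0 (p k).2 ω = 0 ∧ L (p k).1 0 ω = 0 ∧ L 0 0 ω = 0 := by
      rw [ae_all_iff]
      intro k
      filter_upwards [hL.zero_left (p k).2, hL.zero_right (p k).1, hL.zero_left 0]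
        with ω h1 h2 h3
      exact ⟨h1, h2, h3⟩
    filter_upwards [hz] with ω hω
    have : ∀ k, L (p k).1 (p k).2 ω =
        ∑ q : Fin M × Fin N, if (q.1 : ℕ) < I k ∧ (q.2 : ℕ) < J k then X q ω else 0 := by
      intro k
      have := sum_ite_rectIncr_grid (fun x y => L x y ω) g h (hIM k) (hJN k)
      rw [hI, hJ, hg0, hh0] at this
      rw [show (∑ q : Fin M × Fin N, if (q.1 : ℕ) < I k ∧ (q.2 : ℕ) < J k then X q ω else 0) = _
        from this]
      simp only [rectIncr]
      rw [(hω k).1, (hω k).2.1, (hω k).2.2]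
      ring
    simp_rw [this, Finset.mul_sum, C, Finset.sum_mul]
    rw [Finset.sum_comm]
    refine Finset.sum_congr rfl fun q _ => Finset.sum_congr rfl fun k _ => ?_
    split_ifs <;> simp
  have hcell : ∀ w, Ψ (sheetHeight p c w) = ∑ q, (A q).indicator (fun _ => Ψ (C q)) w := by
    rintro ⟨x, y⟩
    by_cases hw : ∃ q, (x, y) ∈ A q
    · obtain ⟨q, hq⟩ := hw
      have hx : x ∈ Ioc (g q.1 : ℝ) (g (q.1 + 1)) := hq.1
      have hy : y ∈ Ioc (h q.2 : ℝ) (h (q.2 + 1)) := hq.2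
      rw [Finset.sum_eq_single q]
      · rw [indicator_of_mem hq]
        congr 1
        refine Finset.sum_congr rfl fun k _ => ?_
        have e1 := lt_iff_of_mem_Ioc_grid hgR hx (k := I k)
        have e2 := lt_iff_of_mem_Ioc_grid hhR hy (k := J k)
        simp only [hI, hJ] at e1 e2
        have x0 : 0 < x := lt_of_le_of_lt (NNReal.coe_nonneg _) hx.1
        have y0 : 0 < y := lt_of_le_of_lt (NNReal.coe_nonneg _) hy.1
        rw [indicator_apply]
        simp only [mem_prod, mem_Ioc, x0, y0, true_and, e1, e2]
      · intro q' _ hne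
        refine indicator_of_notMem (fun hq' => hne ?_) _
        exact Prod.ext (Fin.ext (eq_of_mem_Ioc_grid hgR hq'.1 hx))
          (Fin.ext (eq_of_mem_Ioc_grid hhR hq'.2 hy))
      · simp
    · have h0 : sheetHeight p c (x, y) = 0 := by
        refine Finset.sum_eq_zero fun k _ => indicator_of_notMem (fun hk => hw ?_) _
        obtain ⟨i, hi, hxi⟩ := exists_mem_Ioc_grid (g := fun n => (g n : ℝ)) (m := I k) (x := x)
          (by simpa [hg0] using hk.1.1) (by simpa [hI] using hk.1.2)
        obtain ⟨j, hj, hyj⟩ := exists_mem_Ioc_grid (g := fun n => (h n : ℝ)) (m := J k) (x := y)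
          (by simpa [hh0] using hk.2.1) (by simpa [hJ] using hk.2.2)
        exact ⟨(⟨i, by have := hIM k; omega⟩, ⟨j, by have := hJN k; omega⟩), hxi, hyj⟩
      rw [h0, hL.exponent_zero]
      exact (Finset.sum_eq_zero fun q _ => indicator_of_notMem (fun hq => hw ⟨q, hq⟩) _).symm
  have hAm : ∀ q, MeasurableSet (A q) := fun q => measurableSet_Ioc.prod measurableSet_Ioc
  have hAvol : ∀ q, volume (A q) = ENNReal.ofReal (((g (q.1 + 1) : ℝ) - g q.1) *
      ((h (q.2 + 1) : ℝ) - h q.2)) := by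
    intro q
    rw [Measure.volume_eq_prod, Measure.prod_prod, Real.volume_Ioc, Real.volume_Ioc,
      ENNReal.ofReal_mul (sub_nonneg.2 (hgR (Nat.le_succ _)))]
  have hAint : ∀ q, Integrable ((A q).indicator (fun _ => Ψ (C q))) volume := by
    intro q
    rw [integrable_indicator_iff (hAm q)]
    exact integrableOn_const (by rw [hAvol]; exact ENNReal.ofReal_ne_top)
  have hint : Integrable (fun w => Ψ (sheetHeight p c w)) (volume : Measure (ℝ × ℝ)) := by
    simp_rw [hcell]
    exact integrable_finsetSum _ fun q _ => hAint q
  refine ⟨hint, ?_⟩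
  have hexp : ∀ᵐ ω ∂P, Complex.exp (Complex.I * ((∑ k, c k * L (p k).1 (p k).2 ω : ℝ) : ℂ)) =
      ∏ q, Complex.exp (Complex.I * C q * X q ω) := by
    filter_upwards [hsum] with ω hω
    rw [hω, ← Complex.exp_sum]
    congr 1
    push_cast
    rw [Finset.mul_sum]
    exact Finset.sum_congr rfl fun q _ => by ring
  rw [integral_congr_ae hexp]
  rw [hind.integral_fun_prod_comp (f := fun q (x : ℝ) => Complex.exp (Complex.I * C q * x))
    (fun q => (hXm q).aemeasurable)
    (fun q => (by fun_prop : Measurable _).aestronglyMeasurable)]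
  simp_rw [hcell]
  rw [integral_finsetSum _ fun q _ => hAint q, ← Finset.sum_neg_distrib, Complex.exp_sum]
  refine Finset.prod_congr rfl fun q _ => ?_
  rw [hL.charFun_increment _ _ _ _ (hg (Nat.le_succ _)) (hh (Nat.le_succ _)),
    integral_indicator (hAm q), setIntegral_const, measureReal_def, hAvol, ENNReal.toReal_ofReal
      (mul_nonneg (sub_nonneg.2 (hgR (Nat.le_succ _))) (sub_nonneg.2 (hhR (Nat.le_succ _))))]
  congr 1
  simp

end IsLevySheet

/-! ### Decay and factorization of joint characteristic functions -/

theorem sheetHeight_sumElim {ι ι' : Type*} [Fintype ι] [Fintype ι'] (p : ι → ℝ≥0 × ℝ≥0)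
    (p' : ι' → ℝ≥0 × ℝ≥0) (c : ι → ℝ) (c' : ι' → ℝ) (w : ℝ × ℝ) :
    sheetHeight (Sum.elim p p') (Sum.elim c c') w = sheetHeight p c w + sheetHeight p' c' w := by
  simp [sheetHeight]

/-- For four reals with signs of total zero, split into a lower and an upper pair, exactly an odd
number of the four lie above any point between the two members of a pair. -/
theorem abs_signed_count_eq_one {x₁ x₂ x₃ x₄ σ₁ σ₂ σ₃ σ₄ u : ℝ} (h12 : x₁ ≤ x₂) (h23 : x₂ ≤ x₃)
    (h34 : x₃ ≤ x₄) (hσ : σ₁ + σ₂ + σ₃ + σ₄ = 0) (h1 : |σ₁| = 1) (h4 : |σ₄| = 1)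
    (hu : u ∈ Ioc x₁ x₂ ∪ Ioc x₃ x₄) :
    |(if u ≤ x₁ then σ₁ else 0) + (if u ≤ x₂ then σ₂ else 0) + (if u ≤ x₃ then σ₃ else 0) +
      (if u ≤ x₄ then σ₄ else 0)| = 1 := by
  rcases hu with hu | hu
  · rw [if_neg (not_le.2 hu.1), if_pos hu.2, if_pos (by linarith [hu.2]),
      if_pos (by linarith [hu.2]), show 0 + σ₂ + σ₃ + σ₄ = -σ₁ by linarith, abs_neg, h1]
  · rw [if_neg (by linarith [hu.1]), if_neg (by linarith [hu.1]), if_neg (not_le.2 hu.1),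
      if_pos hu.2, zero_add, zero_add, zero_add, h4]

/-- The sum of `exp (-κ (|x_i - x_j| + |x_k - x_l|))` over the three ways of pairing four reals. -/
noncomputable def pairingSum (κ x₁ x₂ x₃ x₄ : ℝ) : ℝ :=
  Real.exp (-κ * |x₁ - x₂|) * Real.exp (-κ * |x₃ - x₄|) +
  Real.exp (-κ * |x₁ - x₃|) * Real.exp (-κ * |x₂ - x₄|) +
  Real.exp (-κ * |x₁ - x₄|) * Real.exp (-κ * |x₂ - x₃|)

theorem pairingSum_nonneg (κ x₁ x₂ x₃ x₄ : ℝ) : 0 ≤ pairingSum κ x₁ x₂ x₃ x₄ := by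
  unfold pairingSum; positivity

theorem exists_odd_count_set_of_sorted {x₁ x₂ x₃ x₄ s : ℝ} (h12 : x₁ ≤ x₂) (h23 : x₂ ≤ x₃)
    (h34 : x₃ ≤ x₄) (hs : s ≤ x₁) (κ : ℝ) :
    Ioc x₁ x₂ ∪ Ioc x₃ x₄ ⊆ Ioi s ∧ volume (Ioc x₁ x₂ ∪ Ioc x₃ x₄) ≠ ⊤ ∧
      Real.exp (-κ * volume.real (Ioc x₁ x₂ ∪ Ioc x₃ x₄)) =
        Real.exp (-κ * |x₁ - x₂|) * Real.exp (-κ * |x₃ - x₄|) := by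
  refine ⟨?_, ?_, ?_⟩
  · rintro u (hu | hu)
    · exact lt_of_le_of_lt hs hu.1
    · exact lt_of_le_of_lt (by linarith) hu.1
  · exact ((measure_union_le _ _).trans_lt (by simp)).ne
  · have hd : Disjoint (Ioc x₁ x₂) (Ioc x₃ x₄) := by
      rw [Set.disjoint_left]
      intro u hu hu'
      linarith [hu.2, hu'.1]
    rw [measureReal_union hd measurableSet_Ioc (by simp) (by simp), Real.volume_real_Ioc_of_le h12,
      Real.volume_real_Ioc_of_le h34, ← Real.exp_add, abs_of_nonpos (by linarith),
      abs_of_nonpos (by linarith)]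
    congr 1
    ring

theorem exists_separated_pairing (x₁ x₂ x₃ x₄ : ℝ) :
    max x₁ x₂ ≤ min x₃ x₄ ∨ max x₃ x₄ ≤ min x₁ x₂ ∨ max x₁ x₃ ≤ min x₂ x₄ ∨
      max x₂ x₄ ≤ min x₁ x₃ ∨ max x₁ x₄ ≤ min x₂ x₃ ∨ max x₂ x₃ ≤ min x₁ x₄ := by
  simp only [max_le_iff, le_min_iff]
  grind

/-- Above the points of a set whose length is the sum of the gaps of some pairing, the alternating
count of four reals is odd. -/
theorem exists_odd_count_set (x₁ x₂ x₃ x₄ s : ℝ) (h1 : s ≤ x₁) (h2 : s ≤ x₂) (h3 : s ≤ x₃)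
    (h4 : s ≤ x₄) (κ : ℝ) : ∃ U : Set ℝ, MeasurableSet U ∧ U ⊆ Ioi s ∧ volume U ≠ ⊤ ∧
      Real.exp (-κ * volume.real U) ≤ pairingSum κ x₁ x₂ x₃ x₄ ∧
      ∀ u ∈ U, |(if u ≤ x₁ then (1 : ℝ) else 0) - (if u ≤ x₂ then 1 else 0) +
        (if u ≤ x₃ then 1 else 0) - (if u ≤ x₄ then 1 else 0)| = 1 := by
  have hone : |(-1 : ℝ)| = 1 := by norm_num
  have key : ∀ y₁ y₂ y₃ y₄ σ₁ σ₂ σ₃ σ₄ : ℝ, s ≤ y₁ → y₁ ≤ y₂ → y₂ ≤ y₃ → y₃ ≤ y₄ →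
      σ₁ + σ₂ + σ₃ + σ₄ = 0 → |σ₁| = 1 → |σ₄| = 1 →
      Real.exp (-κ * |y₁ - y₂|) * Real.exp (-κ * |y₃ - y₄|) ≤ pairingSum κ x₁ x₂ x₃ x₄ →
      (∀ u, (if u ≤ x₁ then (1 : ℝ) else 0) - (if u ≤ x₂ then 1 else 0) +
        (if u ≤ x₃ then 1 else 0) - (if u ≤ x₄ then 1 else 0) =
        (if u ≤ y₁ then σ₁ else 0) + (if u ≤ y₂ then σ₂ else 0) + (if u ≤ y₃ then σ₃ else 0) +
          (if u ≤ y₄ then σ₄ else 0)) →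
      ∃ U : Set ℝ, MeasurableSet U ∧ U ⊆ Ioi s ∧ volume U ≠ ⊤ ∧
      Real.exp (-κ * volume.real U) ≤ pairingSum κ x₁ x₂ x₃ x₄ ∧
      ∀ u ∈ U, |(if u ≤ x₁ then (1 : ℝ) else 0) - (if u ≤ x₂ then 1 else 0) +
        (if u ≤ x₃ then 1 else 0) - (if u ≤ x₄ then 1 else 0)| = 1 := by
    intro y₁ y₂ y₃ y₄ σ₁ σ₂ σ₃ σ₄ hs h12 h23 h34 hσ hσ1 hσ4 hle heq
    obtain ⟨a1, a2, a3⟩ := exists_odd_count_set_of_sorted h12 h23 h34 hs κ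
    refine ⟨_, measurableSet_Ioc.union measurableSet_Ioc, a1, a2, a3.trans_le hle, ?_⟩
    intro u hu
    rw [heq]
    exact abs_signed_count_eq_one h12 h23 h34 hσ hσ1 hσ4 hu
  have p1 : ∀ a b c d : ℝ, 0 ≤ Real.exp (-κ * |a - b|) * Real.exp (-κ * |c - d|) :=
    fun a b c d => by positivity
  have q1 : Real.exp (-κ * |x₁ - x₂|) * Real.exp (-κ * |x₃ - x₄|) ≤ pairingSum κ x₁ x₂ x₃ x₄ := by
    unfold pairingSum; linarith [p1 x₁ x₃ x₂ x₄, p1 x₁ x₄ x₂ x₃]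
  have q2 : Real.exp (-κ * |x₁ - x₃|) * Real.exp (-κ * |x₂ - x₄|) ≤ pairingSum κ x₁ x₂ x₃ x₄ := by
    unfold pairingSum; linarith [p1 x₁ x₂ x₃ x₄, p1 x₁ x₄ x₂ x₃]
  have q3 : Real.exp (-κ * |x₁ - x₄|) * Real.exp (-κ * |x₂ - x₃|) ≤ pairingSum κ x₁ x₂ x₃ x₄ := by
    unfold pairingSum; linarith [p1 x₁ x₂ x₃ x₄, p1 x₁ x₃ x₂ x₄]
  have key' : ∀ y₁ y₂ y₃ y₄ σ₁ σ₂ σ₃ σ₄ : ℝ, s ≤ y₁ → s ≤ y₂ → s ≤ y₃ → s ≤ y₄ →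
      max y₁ y₂ ≤ min y₃ y₄ →
      σ₁ + σ₂ + σ₃ + σ₄ = 0 → |σ₁| = 1 → |σ₂| = 1 → |σ₃| = 1 → |σ₄| = 1 →
      Real.exp (-κ * |y₁ - y₂|) * Real.exp (-κ * |y₃ - y₄|) ≤ pairingSum κ x₁ x₂ x₃ x₄ →
      (∀ u, (if u ≤ x₁ then (1 : ℝ) else 0) - (if u ≤ x₂ then 1 else 0) +
        (if u ≤ x₃ then 1 else 0) - (if u ≤ x₄ then 1 else 0) =
        (if u ≤ y₁ then σ₁ else 0) + (if u ≤ y₂ then σ₂ else 0) + (if u ≤ y₃ then σ₃ else 0) +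
          (if u ≤ y₄ then σ₄ else 0)) →
      ∃ U : Set ℝ, MeasurableSet U ∧ U ⊆ Ioi s ∧ volume U ≠ ⊤ ∧
      Real.exp (-κ * volume.real U) ≤ pairingSum κ x₁ x₂ x₃ x₄ ∧
      ∀ u ∈ U, |(if u ≤ x₁ then (1 : ℝ) else 0) - (if u ≤ x₂ then 1 else 0) +
        (if u ≤ x₃ then 1 else 0) - (if u ≤ x₄ then 1 else 0)| = 1 := by
    intro y₁ y₂ y₃ y₄ σ₁ σ₂ σ₃ σ₄ g1 g2 g3 g4 hm hσ k1 k2 k3 k4 hle heq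
    have m1 := (le_max_left y₁ y₂).trans hm
    have m2 := (le_max_right y₁ y₂).trans hm
    have n1 := m1.trans (min_le_left _ _)
    have n2 := m1.trans (min_le_right _ _)
    have n3 := m2.trans (min_le_left _ _)
    have n4 := m2.trans (min_le_right _ _)
    rcases le_total y₁ y₂ with a | a <;> rcases le_total y₃ y₄ with b | b
    · exact key y₁ y₂ y₃ y₄ σ₁ σ₂ σ₃ σ₄ g1 a n3 b hσ k1 k4 hle heq
    · exact key y₁ y₂ y₄ y₃ σ₁ σ₂ σ₄ σ₃ g1 a n4 b (by linarith) k1 k3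
        (by rwa [abs_sub_comm y₄]) (fun u => by rw [heq]; ring)
    · exact key y₂ y₁ y₃ y₄ σ₂ σ₁ σ₃ σ₄ g2 a n1 b (by linarith) k2 k4
        (by rwa [abs_sub_comm y₂]) (fun u => by rw [heq]; ring)
    · exact key y₂ y₁ y₄ y₃ σ₂ σ₁ σ₄ σ₃ g2 a n2 b (by linarith) k2 k3
        (by rwa [abs_sub_comm y₂, abs_sub_comm y₄]) (fun u => by rw [heq]; ring)
  have neg_ite : ∀ u v : ℝ, (if u ≤ v then (-1 : ℝ) else 0) = - (if u ≤ v then (1 : ℝ) else 0) := by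
    intro u v; split_ifs <;> simp
  rcases exists_separated_pairing x₁ x₂ x₃ x₄ with h | h | h | h | h | h
  · exact key' x₁ x₂ x₃ x₄ 1 (-1) 1 (-1) h1 h2 h3 h4 h (by norm_num) abs_one hone abs_one hone q1
      (fun u => by simp only [neg_ite]; ring)
  · exact key' x₃ x₄ x₁ x₂ 1 (-1) 1 (-1) h3 h4 h1 h2 h (by norm_num) abs_one hone abs_one hone
      (by rwa [mul_comm]) (fun u => by simp only [neg_ite]; ring)
  · exact key' x₁ x₃ x₂ x₄ 1 1 (-1) (-1) h1 h3 h2 h4 h (by norm_num) abs_one abs_one hone hone q2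
      (fun u => by simp only [neg_ite]; ring)
  · exact key' x₂ x₄ x₁ x₃ (-1) (-1) 1 1 h2 h4 h1 h3 h (by norm_num) hone hone abs_one abs_one
      (by rwa [mul_comm]) (fun u => by simp only [neg_ite]; ring)
  · exact key' x₁ x₄ x₂ x₃ 1 (-1) (-1) 1 h1 h4 h2 h3 h (by norm_num) abs_one hone hone abs_one q3
      (fun u => by simp only [neg_ite]; ring)
  · exact key' x₂ x₃ x₁ x₄ (-1) 1 1 (-1) h2 h3 h1 h4 h (by norm_num) hone abs_one abs_one hone
      (by rwa [mul_comm]) (fun u => by simp only [neg_ite]; ring)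

namespace IsLevySheet

variable {Ω : Type*} [MeasurableSpace Ω] {P : Measure Ω} [IsProbabilityMeasure P]
  {L : ℝ≥0 → ℝ≥0 → Ω → ℝ} {Ψ : ℝ → ℂ}

/-- As `Re Ψ ≥ 0`, the integral of `Re Ψ ∘ sheetHeight` over the plane is bounded below by its integral
over any region `A`. -/
theorem norm_charFun_sum_le (hL : IsLevySheet P L Ψ) {ι : Type*} [Fintype ι]
    (p : ι → ℝ≥0 × ℝ≥0) (c : ι → ℝ) {A : Set (ℝ × ℝ)} (hA : MeasurableSet A)
    (hfin : volume A ≠ ⊤) {α : ℝ} (hα : ∀ w ∈ A, α ≤ (Ψ (sheetHeight p c w)).re) :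
    ‖∫ ω, Complex.exp (Complex.I * ((∑ k, c k * L (p k).1 (p k).2 ω : ℝ) : ℂ)) ∂P‖ ≤
      Real.exp (-α * volume.real A) := by
  obtain ⟨hint, h⟩ := hL.integrable_and_charFun_sum p c
  rw [h, Complex.norm_exp, Real.exp_le_exp, Complex.neg_re, neg_mul, neg_le_neg_iff]
  have h2 : (∫ w, Ψ (sheetHeight p c w)).re = ∫ w, (Ψ (sheetHeight p c w)).re :=
    (integral_re hint).symm
  rw [h2, mul_comm, ← smul_eq_mul, ← integral_indicator_const α hA]
  refine integral_mono ?_ hint.re ?_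
  · rw [integrable_indicator_iff hA]
    exact integrableOn_const hfin
  · intro w
    by_cases hw : w ∈ A
    · rw [indicator_of_mem hw]; exact hα w hw
    · rw [indicator_of_notMem hw]; exact hL.exponent_re_nonneg _

/-- Decay of the joint characteristic function from two disjoint parts of the quadrant: a union of
vertical strips `U × (0,t]` to the right of `s`, and a union of horizontal strips `(r,s] × V`. -/
theorem norm_charFun_sum_le_cross (hL : IsLevySheet P L Ψ) {ι : Type*} [Fintype ι]
    (p : ι → ℝ≥0 × ℝ≥0) (c : ι → ℝ) {r s t : ℝ} (hrs : r ≤ s) (ht : 0 ≤ t) {U V : Set ℝ}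
    (hU : MeasurableSet U) (hV : MeasurableSet V) (hUf : volume U ≠ ⊤) (hVf : volume V ≠ ⊤)
    (hUs : U ⊆ Ioi s) {α : ℝ}
    (h1 : ∀ x ∈ U, ∀ y ∈ Ioc 0 t, α ≤ (Ψ (sheetHeight p c (x, y))).re)
    (h2 : ∀ x ∈ Ioc r s, ∀ y ∈ V, α ≤ (Ψ (sheetHeight p c (x, y))).re) :
    ‖∫ ω, Complex.exp (Complex.I * ((∑ k, c k * L (p k).1 (p k).2 ω : ℝ) : ℂ)) ∂P‖ ≤
      Real.exp (-(α * t) * volume.real U) * Real.exp (-(α * (s - r)) * volume.real V) := by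
  have hf1 : volume (U ×ˢ Ioc 0 t) ≠ ⊤ := by
    rw [Measure.volume_eq_prod, Measure.prod_prod]
    exact ENNReal.mul_ne_top hUf (by simp)
  have hf2 : volume (Ioc r s ×ˢ V) ≠ ⊤ := by
    rw [Measure.volume_eq_prod, Measure.prod_prod]
    exact ENNReal.mul_ne_top (by simp) hVf
  have hd : Disjoint (U ×ˢ Ioc 0 t) (Ioc r s ×ˢ V) := by
    rw [Set.disjoint_left]
    rintro ⟨x, y⟩ ⟨hx, _⟩ ⟨hx', _⟩
    exact absurd (hUs hx) (not_lt.2 hx'.2)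
  have := hL.norm_charFun_sum_le p c (A := U ×ˢ Ioc 0 t ∪ Ioc r s ×ˢ V) (α := α)
    ((hU.prod measurableSet_Ioc).union (measurableSet_Ioc.prod hV))
    ((measure_union_le _ _).trans_lt (ENNReal.add_lt_top.2 ⟨hf1.lt_top, hf2.lt_top⟩)).ne ?_
  · refine this.trans_eq ?_
    rw [measureReal_union hd (measurableSet_Ioc.prod hV) hf1 hf2, ← Real.exp_add,
      Measure.volume_eq_prod, measureReal_prod_prod, measureReal_prod_prod,
      Real.volume_real_Ioc_of_le hrs, Real.volume_real_Ioc_of_le ht]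
    congr 1
    ring
  · rintro ⟨x, y⟩ (⟨hx, hy⟩ | ⟨hx, hy⟩)
    · exact h1 x hx y hy
    · exact h2 x hx y hy

/-- Linear functionals of the sheet carried by disjoint regions have a joint characteristic function
that factorizes. -/
theorem charFun_sum_add (hL : IsLevySheet P L Ψ) {ι ι' : Type*} [Fintype ι] [Fintype ι']
    (p : ι → ℝ≥0 × ℝ≥0) (p' : ι' → ℝ≥0 × ℝ≥0) (c : ι → ℝ) (c' : ι' → ℝ)
    (h : ∀ w, sheetHeight p c w = 0 ∨ sheetHeight p' c' w = 0) :
    ∫ ω, Complex.exp (Complex.I * ((∑ k, c k * L (p k).1 (p k).2 ω : ℝ) : ℂ)) *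
        Complex.exp (Complex.I * ((∑ k, c' k * L (p' k).1 (p' k).2 ω : ℝ) : ℂ)) ∂P =
      (∫ ω, Complex.exp (Complex.I * ((∑ k, c k * L (p k).1 (p k).2 ω : ℝ) : ℂ)) ∂P) *
      ∫ ω, Complex.exp (Complex.I * ((∑ k, c' k * L (p' k).1 (p' k).2 ω : ℝ) : ℂ)) ∂P := by
  obtain ⟨i1, e1⟩ := hL.integrable_and_charFun_sum p c
  obtain ⟨i2, e2⟩ := hL.integrable_and_charFun_sum p' c'
  obtain ⟨i3, e3⟩ := hL.integrable_and_charFun_sum (Sum.elim p p') (Sum.elim c c')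
  rw [e1, e2, ← Complex.exp_add, ← neg_add, ← integral_add i1 i2]
  have : ∀ w, Ψ (sheetHeight p c w) + Ψ (sheetHeight p' c' w) =
      Ψ (sheetHeight (Sum.elim p p') (Sum.elim c c') w) := by
    intro w
    rw [sheetHeight_sumElim]
    rcases h w with h | h
    · rw [h, hL.exponent_zero]; simp
    · rw [h, hL.exponent_zero]; simp
  simp_rw [this]
  rw [← e3]
  congr 1
  ext ω
  rw [← Complex.exp_add, ← mul_add]
  simp

end IsLevySheet

namespace IsLevySheet

variable {Ω : Type*} [MeasurableSpace Ω] {P : Measure Ω} [IsProbabilityMeasure P]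
  {L : ℝ≥0 → ℝ≥0 → Ω → ℝ} {Ψ : ℝ → ℂ}

/-- For an alternating sum of four values, the height is `±θ` over the points of `U × (0,t]` and
`(0,s] × V`, where `U` and `V` are sets of odd count of the abscissas and of the ordinates; their
lengths are sums of gaps of pairings. -/
theorem norm_charFun_alternating_le (hL : IsLevySheet P L Ψ) (θ : ℝ) {s t : ℝ≥0}
    {x₁ x₂ x₃ x₄ y₁ y₂ y₃ y₄ : ℝ≥0} (hx₁ : s ≤ x₁) (hx₂ : s ≤ x₂) (hx₃ : s ≤ x₃) (hx₄ : s ≤ x₄)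
    (hy₁ : t ≤ y₁) (hy₂ : t ≤ y₂) (hy₃ : t ≤ y₃) (hy₄ : t ≤ y₄) :
    ‖∫ ω, Complex.exp (Complex.I *
      ((θ * (L x₁ y₁ ω - L x₂ y₂ ω + L x₃ y₃ ω - L x₄ y₄ ω) : ℝ) : ℂ)) ∂P‖ ≤
      pairingSum ((Ψ θ).re * t) x₁ x₂ x₃ x₄ * pairingSum ((Ψ θ).re * s) y₁ y₂ y₃ y₄ := by
  obtain ⟨U, hU, hUs, hUf, hUle, hU1⟩ := exists_odd_count_set (x₁ : ℝ) x₂ x₃ x₄ s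
    (by exact_mod_cast hx₁) (by exact_mod_cast hx₂) (by exact_mod_cast hx₃)
    (by exact_mod_cast hx₄) ((Ψ θ).re * t)
  obtain ⟨V, hV, hVs, hVf, hVle, hV1⟩ := exists_odd_count_set (y₁ : ℝ) y₂ y₃ y₄ t
    (by exact_mod_cast hy₁) (by exact_mod_cast hy₂) (by exact_mod_cast hy₃)
    (by exact_mod_cast hy₄) ((Ψ θ).re * s)
  have := hL.norm_charFun_sum_le_cross ![(x₁, y₁), (x₂, y₂), (x₃, y₃), (x₄, y₄)] ![θ, -θ, θ, -θ]
    (r := 0) (s := s) (t := t) s.coe_nonneg t.coe_nonneg hU hV hUf hVf hUs (α := (Ψ θ).re) ?_ ?_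
  · refine le_trans (le_of_eq ?_) (this.trans (mul_le_mul hUle ?_ (Real.exp_pos _).le
      (pairingSum_nonneg _ _ _ _ _)))
    · congr 2
      ext ω
      simp only [Fin.sum_univ_four, Matrix.cons_val]
      congr 3
      ring
    · simpa using hVle
  · intro u hu v hv
    have hs0 : 0 < u := s.coe_nonneg.trans_lt (hUs hu)
    have e : sheetHeight ![(x₁, y₁), (x₂, y₂), (x₃, y₃), (x₄, y₄)] ![θ, -θ, θ, -θ] (u, v) =
        θ * ((if u ≤ x₁ then (1 : ℝ) else 0) - (if u ≤ x₂ then 1 else 0) +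
        (if u ≤ x₃ then 1 else 0) - (if u ≤ x₄ then 1 else 0)) := by
      have v1 : v ≤ y₁ := hv.2.trans (by exact_mod_cast hy₁)
      have v2 : v ≤ y₂ := hv.2.trans (by exact_mod_cast hy₂)
      have v3 : v ≤ y₃ := hv.2.trans (by exact_mod_cast hy₃)
      have v4 : v ≤ y₄ := hv.2.trans (by exact_mod_cast hy₄)
      simp only [sheetHeight, Fin.sum_univ_four, Matrix.cons_val, indicator_apply, mem_prod, mem_Ioc,
        hs0, hv.1, v1, v2, v3, v4, true_and, and_true]
      split_ifs <;> ring
    rw [e, hL.exponent_re_of_abs (hU1 u hu)]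
  · intro u hu v hv
    have hs0 : 0 < v := t.coe_nonneg.trans_lt (hVs hv)
    have e : sheetHeight ![(x₁, y₁), (x₂, y₂), (x₃, y₃), (x₄, y₄)] ![θ, -θ, θ, -θ] (u, v) =
        θ * ((if v ≤ y₁ then (1 : ℝ) else 0) - (if v ≤ y₂ then 1 else 0) +
        (if v ≤ y₃ then 1 else 0) - (if v ≤ y₄ then 1 else 0)) := by
      have v1 : u ≤ x₁ := hu.2.trans (by exact_mod_cast hx₁)
      have v2 : u ≤ x₂ := hu.2.trans (by exact_mod_cast hx₂)
      have v3 : u ≤ x₃ := hu.2.trans (by exact_mod_cast hx₃)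
      have v4 : u ≤ x₄ := hu.2.trans (by exact_mod_cast hx₄)
      simp only [sheetHeight, Fin.sum_univ_four, Matrix.cons_val, indicator_apply, mem_prod, mem_Ioc,
        hs0, hu.1, v1, v2, v3, v4, true_and]
      split_ifs <;> ring
    rw [e, hL.exponent_re_of_abs (hV1 v hv)]

theorem abs_ite_sub_ite_of_mem_Ioc {a b u : ℝ} (hu : u ∈ Ioc (min a b) (max a b)) :
    |(if u ≤ a then (1 : ℝ) else 0) - (if u ≤ b then 1 else 0)| = 1 := by
  rcases le_total a b with h | h
  · rw [min_eq_left h, max_eq_right h] at hu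
    rw [if_neg (not_le.2 hu.1), if_pos hu.2]; simp
  · rw [min_eq_right h, max_eq_left h] at hu
    rw [if_neg (not_le.2 hu.1), if_pos hu.2]; simp

theorem volume_real_Ioc_min_max (a b : ℝ) : volume.real (Ioc (min a b) (max a b)) = |a - b| := by
  rw [Real.volume_real_Ioc_of_le min_le_max, max_sub_min_eq_abs']

/-- Opposite signs: the height is `±θ` over the symmetric difference of the two rectangles to the right
of `r`. -/
theorem norm_charFun_strip_sub_le (hL : IsLevySheet P L Ψ) (θ : ℝ) {r s t x x' y y' : ℝ≥0}
    (hrs : r ≤ s) (hx : s ≤ x) (hx' : s ≤ x') (hy : t ≤ y) (hy' : t ≤ y') :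
    ‖∫ ω, Complex.exp (Complex.I *
      ((θ * ((L x y ω - L r y ω) - (L x' y' ω - L r y' ω)) : ℝ) : ℂ)) ∂P‖ ≤
      Real.exp (-((Ψ θ).re * t) * |(x : ℝ) - x'|) *
        Real.exp (-((Ψ θ).re * ((s : ℝ) - r)) * |(y : ℝ) - y'|) := by
  have hx1 : (s : ℝ) ≤ x := by exact_mod_cast hx
  have hx2 : (s : ℝ) ≤ x' := by exact_mod_cast hx'
  have hy1 : (t : ℝ) ≤ y := by exact_mod_cast hy
  have hy2 : (t : ℝ) ≤ y' := by exact_mod_cast hy'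
  have hr1 : (r : ℝ) ≤ s := by exact_mod_cast hrs
  have := hL.norm_charFun_sum_le_cross ![(x, y), (r, y), (x', y'), (r, y')] ![θ, -θ, -θ, θ]
    (r := r) (s := s) (t := t) hr1 t.coe_nonneg
    (U := Ioc (min (x : ℝ) x') (max (x : ℝ) x')) (V := Ioc (min (y : ℝ) y') (max (y : ℝ) y'))
    measurableSet_Ioc measurableSet_Ioc (by simp) (by simp)
    (fun u hu => lt_of_le_of_lt (le_min hx1 hx2) hu.1) (α := (Ψ θ).re) ?_ ?_
  · rw [volume_real_Ioc_min_max, volume_real_Ioc_min_max] at this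
    refine le_trans (le_of_eq ?_) this
    congr 2
    ext ω
    simp only [Fin.sum_univ_four, Matrix.cons_val]
    congr 3
    ring
  · intro u hu v hv
    have hs0 : (s : ℝ) < u := lt_of_le_of_lt (le_min hx1 hx2) hu.1
    have hr0 : ¬ u ≤ r := not_le.2 (by linarith)
    have hu0 : 0 < u := s.coe_nonneg.trans_lt hs0
    have e : sheetHeight ![(x, y), (r, y), (x', y'), (r, y')] ![θ, -θ, -θ, θ] (u, v) =
        θ * ((if u ≤ x then (1 : ℝ) else 0) - (if u ≤ x' then 1 else 0)) := by
      have v1 : v ≤ y := hv.2.trans hy1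
      have v2 : v ≤ y' := hv.2.trans hy2
      simp only [sheetHeight, Fin.sum_univ_four, Matrix.cons_val, indicator_apply, mem_prod, mem_Ioc,
        hr0, hu0, hv.1, v1, v2, true_and, and_true, if_false]
      split_ifs <;> ring
    rw [e, hL.exponent_re_of_abs (abs_ite_sub_ite_of_mem_Ioc hu)]
  · intro u hu v hv
    have hr0 : ¬ u ≤ r := not_le.2 hu.1
    have hu0 : 0 < u := r.coe_nonneg.trans_lt hu.1
    have hv0 : 0 < v := lt_of_le_of_lt (le_min y.coe_nonneg y'.coe_nonneg) hv.1
    have e : sheetHeight ![(x, y), (r, y), (x', y'), (r, y')] ![θ, -θ, -θ, θ] (u, v) =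
        θ * ((if v ≤ y then (1 : ℝ) else 0) - (if v ≤ y' then 1 else 0)) := by
      have v1 : u ≤ x := hu.2.trans hx1
      have v2 : u ≤ x' := hu.2.trans hx2
      simp only [sheetHeight, Fin.sum_univ_four, Matrix.cons_val, indicator_apply, mem_prod, mem_Ioc,
        hr0, hu0, hv0, v1, v2, true_and, false_and, if_false]
      split_ifs <;> ring
    rw [e, hL.exponent_re_of_abs (abs_ite_sub_ite_of_mem_Ioc hv)]

/-- Equal signs: the height is `2θ` on the common part `(r,s] × (0,t]` of the two rectangles. -/
theorem norm_charFun_strip_add_le (hL : IsLevySheet P L Ψ) (θ : ℝ) {r s t x x' y y' : ℝ≥0}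
    (hrs : r ≤ s) (hx : s ≤ x) (hx' : s ≤ x') (hy : t ≤ y) (hy' : t ≤ y') :
    ‖∫ ω, Complex.exp (Complex.I *
      ((θ * ((L x y ω - L r y ω) + (L x' y' ω - L r y' ω)) : ℝ) : ℂ)) ∂P‖ ≤
      Real.exp (-((Ψ (2 * θ)).re * ((s : ℝ) - r)) * t) := by
  have hx1 : (s : ℝ) ≤ x := by exact_mod_cast hx
  have hx2 : (s : ℝ) ≤ x' := by exact_mod_cast hx'
  have hy1 : (t : ℝ) ≤ y := by exact_mod_cast hy
  have hy2 : (t : ℝ) ≤ y' := by exact_mod_cast hy'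
  have hr1 : (r : ℝ) ≤ s := by exact_mod_cast hrs
  have := hL.norm_charFun_sum_le_cross ![(x, y), (r, y), (x', y'), (r, y')] ![θ, -θ, θ, -θ]
    (r := r) (s := s) (t := t) hr1 t.coe_nonneg
    (U := ∅) (V := Ioc 0 (t : ℝ))
    MeasurableSet.empty measurableSet_Ioc (by simp) (by simp)
    (empty_subset _) (α := (Ψ (2 * θ)).re) (fun u hu => absurd hu (notMem_empty u)) ?_
  · rw [Real.volume_real_Ioc_of_le t.coe_nonneg] at this
    refine le_trans (le_of_eq ?_) (this.trans_eq (by simp))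
    congr 2
    ext ω
    simp only [Fin.sum_univ_four, Matrix.cons_val]
    congr 3
    ring
  · intro u hu v hv
    have hr0 : ¬ u ≤ r := not_le.2 hu.1
    have hu0 : 0 < u := r.coe_nonneg.trans_lt hu.1
    have e : sheetHeight ![(x, y), (r, y), (x', y'), (r, y')] ![θ, -θ, θ, -θ] (u, v) = 2 * θ := by
      have v1 : u ≤ x := hu.2.trans hx1
      have v2 : u ≤ x' := hu.2.trans hx2
      have v3 : v ≤ y := hv.2.trans hy1
      have v4 : v ≤ y' := hv.2.trans hy2
      simp only [sheetHeight, Fin.sum_univ_four, Matrix.cons_val, indicator_apply, mem_prod, mem_Ioc,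
        hr0, hu0, hv.1, v1, v2, v3, v4, true_and, false_and, if_false, and_self, if_true]
      ring
    rw [e]

theorem charFun_sub (hL : IsLevySheet P L Ψ) (θ : ℝ) (x x' y y' : ℝ≥0) :
    ∫ ω, Complex.exp (Complex.I * ((θ * (L x y ω - L x' y' ω) : ℝ) : ℂ)) ∂P =
      Complex.exp (-((((x : ℝ) * y - min (x : ℝ) x' * min (y : ℝ) y' : ℝ) : ℂ) * Ψ θ +
        (((x' : ℝ) * y' - min (x : ℝ) x' * min (y : ℝ) y' : ℝ) : ℂ) *
          (starRingEnd ℂ) (Ψ θ))) := by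
  have h := (hL.integrable_and_charFun_sum ![(x, y), (x', y')] ![θ, -θ]).2
  have hrect : ∀ a b : ℝ, 0 ≤ a → 0 ≤ b → volume.real (Ioc 0 a ×ˢ Ioc 0 b) = a * b := by
    intro a b ha hb
    rw [Measure.volume_eq_prod, measureReal_prod_prod, Real.volume_real_Ioc_of_le ha,
      Real.volume_real_Ioc_of_le hb, sub_zero, sub_zero]
  have hfin : ∀ a b : ℝ, volume (Ioc 0 a ×ˢ Ioc 0 b) ≠ ⊤ := by
    intro a b
    rw [Measure.volume_eq_prod, Measure.prod_prod]
    exact ENNReal.mul_ne_top (by simp) (by simp)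
  set A : Set (ℝ × ℝ) := Ioc 0 (x : ℝ) ×ˢ Ioc 0 (y : ℝ) with hA
  set B : Set (ℝ × ℝ) := Ioc 0 (x' : ℝ) ×ˢ Ioc 0 (y' : ℝ) with hB
  have hAm : MeasurableSet A := measurableSet_Ioc.prod measurableSet_Ioc
  have hBm : MeasurableSet B := measurableSet_Ioc.prod measurableSet_Ioc
  have hAB : A ∩ B = Ioc 0 (min (x : ℝ) x') ×ˢ Ioc 0 (min (y : ℝ) y') := by
    rw [hA, hB, prod_inter_prod, Ioc_inter_Ioc, Ioc_inter_Ioc]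
    simp
  have hABv : volume.real (A ∩ B) = min (x : ℝ) x' * min (y : ℝ) y' := by
    rw [hAB, hrect _ _ (le_min x.coe_nonneg x'.coe_nonneg)
      (le_min y.coe_nonneg y'.coe_nonneg)]
  have h1 : volume.real (A \ B) = (x : ℝ) * y - min (x : ℝ) x' * min (y : ℝ) y' := by
    have := measureReal_inter_add_sdiff (μ := volume) (s := A) hBm (hfin _ _)
    rw [hABv, hrect _ _ x.coe_nonneg y.coe_nonneg] at this
    linarith
  have h2 : volume.real (B \ A) = (x' : ℝ) * y' - min (x : ℝ) x' * min (y : ℝ) y' := by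
    have := measureReal_inter_add_sdiff (μ := volume) (s := B) hAm (hfin _ _)
    rw [inter_comm, hABv, hrect _ _ x'.coe_nonneg y'.coe_nonneg] at this
    linarith
  have hpt : ∀ w, Ψ (sheetHeight ![(x, y), (x', y')] ![θ, -θ] w) =
      (A \ B).indicator (fun _ => Ψ θ) w + (B \ A).indicator (fun _ => (starRingEnd ℂ) (Ψ θ)) w := by
    intro w
    have e : sheetHeight ![(x, y), (x', y')] ![θ, -θ] w =
        A.indicator (fun _ => θ) w + B.indicator (fun _ => -θ) w := by
      simp [sheetHeight, Fin.sum_univ_two, A, B]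
    rw [e]
    by_cases ha : w ∈ A <;> by_cases hb : w ∈ B <;>
      simp [ha, hb, hL.exponent_neg, hL.exponent_zero]
  have hint : ∫ w, Ψ (sheetHeight ![(x, y), (x', y')] ![θ, -θ] w) =
      (((x : ℝ) * y - min (x : ℝ) x' * min (y : ℝ) y' : ℝ) : ℂ) * Ψ θ +
        (((x' : ℝ) * y' - min (x : ℝ) x' * min (y : ℝ) y' : ℝ) : ℂ) *
          (starRingEnd ℂ) (Ψ θ) := by
    simp_rw [hpt]
    have fin1 : volume (A \ B) ≠ ⊤ := measure_ne_top_of_subset sdiff_subset (hfin _ _)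
    have fin2 : volume (B \ A) ≠ ⊤ := measure_ne_top_of_subset sdiff_subset (hfin _ _)
    rw [integral_add, integral_indicator_const _ (hAm.diff hBm),
      integral_indicator_const _ (hBm.diff hAm), h1, h2]
    · simp
    · exact (integrable_indicator_iff (hAm.diff hBm)).2 (integrableOn_const fin1)
    · exact (integrable_indicator_iff (hBm.diff hAm)).2 (integrableOn_const fin2)
  rw [← hint, ← h]
  congr 1
  ext ω
  simp only [Fin.sum_univ_two, Matrix.cons_val]
  congr 3
  ring

/-- Increments along a vertical line over disjoint intervals are uncorrelated phases. -/
theorem charFun_vertical_mul (hL : IsLevySheet P L Ψ) (θ : ℝ) (r : ℝ≥0) {y₁ y₁' y₂ y₂' : ℝ≥0}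
    (h : max y₁ y₁' ≤ min y₂ y₂' ∨ max y₂ y₂' ≤ min y₁ y₁') :
    ∫ ω, Complex.exp (Complex.I * ((θ * (L r y₁ ω - L r y₁' ω) : ℝ) : ℂ)) *
        Complex.exp (Complex.I * ((θ * (L r y₂' ω - L r y₂ ω) : ℝ) : ℂ)) ∂P =
      (∫ ω, Complex.exp (Complex.I * ((θ * (L r y₁ ω - L r y₁' ω) : ℝ) : ℂ)) ∂P) *
        ∫ ω, Complex.exp (Complex.I * ((θ * (L r y₂' ω - L r y₂ ω) : ℝ) : ℂ)) ∂P := by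
  have := hL.charFun_sum_add ![(r, y₁), (r, y₁')] ![(r, y₂'), (r, y₂)] ![θ, -θ] ![θ, -θ] ?_
  · simp only [Fin.sum_univ_two, Matrix.cons_val] at this
    have e : ∀ y y' ω, θ * L r y ω + -θ * L r y' ω = θ * (L r y ω - L r y' ω) := by
      intros; ring
    simpa only [e] using this
  · rintro ⟨u, v⟩
    simp only [sheetHeight, Fin.sum_univ_two, Matrix.cons_val, indicator_apply, mem_prod, mem_Ioc]
    have h' : max (y₁ : ℝ) y₁' ≤ min (y₂ : ℝ) y₂' ∨ max (y₂ : ℝ) y₂' ≤ min (y₁ : ℝ) y₁' := by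
      exact_mod_cast h
    simp only [max_le_iff, le_min_iff] at h'
    grind

end IsLevySheet

/-! ### Independence from the part of the sheet to the left of a vertical line -/

/-- An integral `∫ f(z, ·) dν(z)` of `m`-measurable variables is a.e. `m`-measurable, even though
`f` is only assumed jointly measurable for the full σ-algebra on `Ω`: the integral is
orthogonal to `X - E[X | m]` by Fubini, hence equal to its conditional expectation. -/
theorem aestronglyMeasurable_integral_of_forall {Z Ω : Type*} [MeasurableSpace Z]
    {m mΩ : MeasurableSpace Ω} (hm : m ≤ mΩ) {P : Measure Ω} [IsProbabilityMeasure P]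
    {ν : Measure Z} [IsFiniteMeasure ν] {f : Z → Ω → ℝ}
    (hf : StronglyMeasurable fun p : Ω × Z => f p.2 p.1) {C : ℝ} (hC : ∀ z ω, |f z ω| ≤ C)
    (hfm : ∀ z, StronglyMeasurable[m] (f z)) :
    AEStronglyMeasurable[m] (fun ω => ∫ z, f z ω ∂ν) P := by
  set X : Ω → ℝ := fun ω => ∫ z, f z ω ∂ν with hX
  have hXm : StronglyMeasurable X := hf.integral_prod_right'
  have hXb : ∀ ω, ‖X ω‖ ≤ C * ν.real univ := fun ω =>
    norm_integral_le_of_norm_le_const (ae_of_all _ fun z => hC z ω)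
  have hXi : Integrable X P := Integrable.of_bound hXm.aestronglyMeasurable _ (ae_of_all _ hXb)
  set D : Ω → ℝ := X - P[X|m] with hD
  have hDi : Integrable D P := hXi.sub integrable_condExp
  have hDc : P[D|m] =ᵐ[P] 0 := by
    have h1 : P[D|m] =ᵐ[P] P[X|m] - P[P[X|m]|m] := condExp_sub hXi integrable_condExp m
    rw [condExp_of_stronglyMeasurable hm stronglyMeasurable_condExp integrable_condExp] at h1
    simpa using h1
  -- the difference is orthogonal to every bounded `m`-measurable function
  have horth : ∀ g : Ω → ℝ, AEStronglyMeasurable[m] g P → Integrable (g * D) P →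
      ∫ ω, g ω * D ω ∂P = 0 := by
    intro g hg hgi
    have h1 := condExp_mul_of_aestronglyMeasurable_left hg hgi hDi
    have h2 : ∫ ω, (g * D) ω ∂P = ∫ ω, (P[g * D|m]) ω ∂P := (integral_condExp hm).symm
    rw [show (∫ ω, g ω * D ω ∂P) = ∫ ω, (g * D) ω ∂P from rfl, h2]
    refine integral_eq_zero_of_ae ?_
    filter_upwards [h1, hDc] with ω a b
    rw [a, Pi.mul_apply, b]
    simp
  have hYb : ∀ᵐ ω ∂P, ‖(P[X|m]) ω‖ ≤ C * ν.real univ := by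
    exact ae_bdd_abs_condExp_of_ae_bdd_abs (ae_of_all _ hXb)
  have hYDi : Integrable (P[X|m] * D) P :=
    hDi.bdd_mul integrable_condExp.aestronglyMeasurable hYb
  have hY : ∫ ω, (P[X|m]) ω * D ω ∂P = 0 :=
    horth _ stronglyMeasurable_condExp.aestronglyMeasurable hYDi
  have hXDi : Integrable (X * D) P := hDi.bdd_mul hXm.aestronglyMeasurable (ae_of_all _ hXb)
  have hXD : ∫ ω, X ω * D ω ∂P = 0 := by
    have e : ∀ ω, X ω * D ω = ∫ z, f z ω * D ω ∂ν := fun ω => by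
      rw [integral_mul_const]
    simp_rw [e]
    have hint : Integrable (fun p : Ω × Z => f p.2 p.1 * D p.1) (P.prod ν) :=
      (hDi.comp_fst ν).bdd_mul hf.aestronglyMeasurable (ae_of_all _ fun p => hC p.2 p.1)
    rw [integral_integral_swap hint]
    refine integral_eq_zero_of_ae (ae_of_all _ fun z => ?_)
    refine horth (f z) (hfm z).aestronglyMeasurable (hDi.bdd_mul ?_ (ae_of_all _ (hC z)))
    exact ((hfm z).mono hm).aestronglyMeasurable
  have hD2 : ∫ ω, D ω * D ω ∂P = 0 := by
    have e : ∀ ω, D ω * D ω = X ω * D ω - (P[X|m]) ω * D ω := fun ω => by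
      simp only [hD, Pi.sub_apply]; ring
    simp_rw [e]
    refine (integral_sub hXDi hYDi).trans ?_
    rw [show (∫ ω, (X * D) ω ∂P) = 0 from hXD, show (∫ ω, (P[X|m] * D) ω ∂P) = 0 from hY, sub_zero]
  have hDDi : Integrable (fun ω => D ω * D ω) P := by
    have : (fun ω => D ω * D ω) = X * D - P[X|m] * D := by
      ext ω; simp only [hD, Pi.sub_apply, Pi.mul_apply]; ring
    rw [this]
    exact hXDi.sub hYDi
  rw [integral_eq_zero_iff_of_nonneg (fun ω => mul_self_nonneg _) hDDi] at hD2
  refine ⟨P[X|m], stronglyMeasurable_condExp, ?_⟩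
  filter_upwards [hD2] with ω hω
  have : D ω = 0 := mul_self_eq_zero.1 hω
  simpa [hD, sub_eq_zero] using this

theorem aestronglyMeasurable_integral_complex_of_forall {Z Ω : Type*} [MeasurableSpace Z]
    {m mΩ : MeasurableSpace Ω} (hm : m ≤ mΩ) {P : Measure Ω} [IsProbabilityMeasure P]
    {ν : Measure Z} [IsFiniteMeasure ν] {f : Z → Ω → ℂ}
    (hf : StronglyMeasurable fun p : Ω × Z => f p.2 p.1) {C : ℝ} (hC : ∀ z ω, ‖f z ω‖ ≤ C)
    (hfm : ∀ z, StronglyMeasurable[m] (f z)) :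
    AEStronglyMeasurable[m] (fun ω => ∫ z, f z ω ∂ν) P := by
  have hre := aestronglyMeasurable_integral_of_forall hm (P := P) (ν := ν)
    (f := fun z ω => (f z ω).re) (Complex.continuous_re.comp_stronglyMeasurable hf)
    (fun z ω => (Complex.abs_re_le_norm _).trans (hC z ω))
    (fun z => Complex.continuous_re.comp_stronglyMeasurable (hfm z))
  have him := aestronglyMeasurable_integral_of_forall hm (P := P) (ν := ν)
    (f := fun z ω => (f z ω).im) (Complex.continuous_im.comp_stronglyMeasurable hf)
    (fun z ω => (Complex.abs_im_le_norm _).trans (hC z ω))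
    (fun z => Complex.continuous_im.comp_stronglyMeasurable (hfm z))
  have hint : ∀ ω, Integrable (fun z => f z ω) ν := fun ω =>
    Integrable.of_bound (hf.comp_measurable measurable_prodMk_left).aestronglyMeasurable C
      (ae_of_all _ fun z => hC z ω)
  have e : (fun ω => ∫ z, f z ω ∂ν) = fun ω =>
      ((∫ z, (f z ω).re ∂ν : ℝ) : ℂ) + ((∫ z, (f z ω).im ∂ν : ℝ) : ℂ) * Complex.I := by
    ext ω
    exact (integral_re_add_im (hint ω)).symm
  rw [e]
  exact (Complex.continuous_ofReal.comp_aestronglyMeasurable hre).add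
    ((Complex.continuous_ofReal.comp_aestronglyMeasurable him).mul aestronglyMeasurable_const)

/-- The σ-algebra generated by the values `L(x,y)`, `x ≤ r`, of the sheet to the left of the vertical
line at `r`. -/
abbrev leftSigma {Ω : Type*} (L : ℝ≥0 → ℝ≥0 → Ω → ℝ) (r : ℝ≥0) : MeasurableSpace Ω :=
  MeasurableSpace.comap (fun ω (k : {p : ℝ≥0 × ℝ≥0 // p.1 ≤ r}) => L k.1.1 k.1.2 ω) inferInstance

theorem measurable_leftSigma {Ω : Type*} (L : ℝ≥0 → ℝ≥0 → Ω → ℝ) {r x : ℝ≥0} (hx : x ≤ r)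
    (y : ℝ≥0) : Measurable[leftSigma L r] (L x y) := by
  have h1 : Measurable[leftSigma L r]
      (fun ω (k : {p : ℝ≥0 × ℝ≥0 // p.1 ≤ r}) => L k.1.1 k.1.2 ω) := comap_measurable _
  exact (measurable_pi_apply (⟨(x, y), hx⟩ : {p : ℝ≥0 × ℝ≥0 // p.1 ≤ r})).comp h1

namespace IsLevySheet

variable {Ω : Type*} [mΩ : MeasurableSpace Ω] {P : Measure Ω}
  {L : ℝ≥0 → ℝ≥0 → Ω → ℝ} {Ψ : ℝ → ℂ}

theorem leftSigma_le (hL : IsLevySheet P L Ψ) (r : ℝ≥0) : leftSigma L r ≤ mΩ :=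
  (measurable_pi_iff.2 fun k : {p : ℝ≥0 × ℝ≥0 // p.1 ≤ r} => hL.measurable k.1.1 k.1.2).comap_le

/-- The values of the sheet to the left of `r` are independent of its increments to the right of
`r`: their joint characteristic functions factorize because the two step functions have disjoint
supports. -/
theorem indepFun_left [IsProbabilityMeasure P] (hL : IsLevySheet P L Ψ) {r x x' : ℝ≥0}
    (hx : r ≤ x) (hx' : r ≤ x') (y y' : ℝ≥0) (c c' : ℝ) :
    IndepFun (fun ω (k : {p : ℝ≥0 × ℝ≥0 // p.1 ≤ r}) => L k.1.1 k.1.2 ω)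
      (fun ω => c * (L x y ω - L r y ω) + c' * (L x' y' ω - L r y' ω)) P := by
  set U : Ω → ℝ := fun ω => c * (L x y ω - L r y ω) + c' * (L x' y' ω - L r y' ω) with hU
  have hUm : Measurable U :=
    (((hL.measurable _ _).sub (hL.measurable _ _)).const_mul c).add
      (((hL.measurable _ _).sub (hL.measurable _ _)).const_mul c')
  refine IndepFun.process_indepFun (fun k => hL.measurable _ _) hUm fun I => ?_
  have hVm : Measurable (fun ω (k : I) => L k.1.1.1 k.1.1.2 ω) :=
    measurable_pi_iff.2 fun k => hL.measurable _ _
  rw [indepFun_iff_charFunDual_prod hVm.aemeasurable hUm.aemeasurable]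
  intro Λ
  classical
  set d : ℝ := Λ (0, 1) with hd
  set a : I → ℝ := fun k => Λ (Pi.single k 1, 0) with ha
  have hΛ1 : ∀ v : I → ℝ, Λ (v, 0) = ∑ k, a k * v k := by
    intro v
    have h1 : ((v, 0) : (I → ℝ) × ℝ) = ContinuousLinearMap.inl ℝ (I → ℝ) ℝ v := rfl
    rw [h1, ← ContinuousLinearMap.comp_apply]
    conv_lhs => rw [← Finset.univ_sum_single v]
    rw [map_sum]
    refine Finset.sum_congr rfl fun k _ => ?_
    have : (Pi.single k (v k) : I → ℝ) = v k • Pi.single k 1 := by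
      rw [← Pi.single_smul]; simp
    rw [this, map_smul, smul_eq_mul, mul_comm]
    rfl
  have hΛ2 : ∀ u : ℝ, Λ (0, u) = d * u := by
    intro u
    have : ((0, u) : (I → ℝ) × ℝ) = u • (0, 1) := by simp
    rw [this, map_smul, smul_eq_mul, mul_comm]
  have hΛ : ∀ (v : I → ℝ) (u : ℝ), Λ (v, u) = ∑ k, a k * v k + d * u := by
    intro v u
    rw [← hΛ1, ← hΛ2, ← map_add]
    simp
  simp only [charFunDual_apply]
  rw [integral_map (hVm.prodMk hUm).aemeasurable (by fun_prop),
    integral_map hVm.aemeasurable (by fun_prop), integral_map hUm.aemeasurable (by fun_prop)]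
  simp only [ContinuousLinearMap.comp_apply, ContinuousLinearMap.inl_apply,
    ContinuousLinearMap.inr_apply, hΛ, Pi.zero_apply, mul_zero, add_zero, zero_add,
    Finset.sum_const_zero]
  have key := hL.charFun_sum_add (fun k : I => k.1.1) ![(x, y), (r, y), (x', y'), (r, y')] a
    ![d * c, -(d * c), d * c', -(d * c')] ?_
  · have e1 : ∀ ω, (∑ k : Fin 4, ![d * c, -(d * c), d * c', -(d * c')] k *
        L (![(x, y), (r, y), (x', y'), (r, y')] k).1 (![(x, y), (r, y), (x', y'), (r, y')] k).2 ω) =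
        d * U ω := by
      intro ω
      simp only [Fin.sum_univ_four, Matrix.cons_val, hU]
      ring
    simp only [e1] at key
    simp only [mul_comm _ Complex.I]
    rw [← key]
    congr 1
    ext ω
    rw [← Complex.exp_add]
    congr 1
    push_cast
    ring
  · rintro ⟨u, v⟩
    by_cases hu : u ≤ r
    · right
      have v1 : u ≤ x := hu.trans (by exact_mod_cast hx)
      have v2 : u ≤ x' := hu.trans (by exact_mod_cast hx')
      simp only [sheetHeight, Fin.sum_univ_four, Matrix.cons_val, indicator_apply, mem_prod,
        mem_Ioc, hu, v1, v2]
      split_ifs <;> ring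
    · left
      refine Finset.sum_eq_zero fun k _ => indicator_of_notMem (fun hk => hu ?_) _
      exact hk.1.2.trans (by exact_mod_cast k.1.2)

theorem integral_mul_exp_right [IsProbabilityMeasure P] (hL : IsLevySheet P L Ψ) {r x x' : ℝ≥0}
    (hx : r ≤ x) (hx' : r ≤ x') (y y' : ℝ≥0) (c c' : ℝ) {F : Ω → ℂ}
    (hF : AEStronglyMeasurable[leftSigma L r] F P) :
    ∫ ω, F ω * Complex.exp (Complex.I *
        ((c * (L x y ω - L r y ω) + c' * (L x' y' ω - L r y' ω) : ℝ) : ℂ)) ∂P =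
      (∫ ω, F ω ∂P) * ∫ ω, Complex.exp (Complex.I *
        ((c * (L x y ω - L r y ω) + c' * (L x' y' ω - L r y' ω) : ℝ) : ℂ)) ∂P := by
  obtain ⟨F', hF', hFF'⟩ := hF
  have hind := hL.indepFun_left hx hx' y y' c c'
  set U : Ω → ℝ := fun ω => c * (L x y ω - L r y ω) + c' * (L x' y' ω - L r y' ω) with hU
  have hUm : Measurable U :=
    (((hL.measurable _ _).sub (hL.measurable _ _)).const_mul c).add
      (((hL.measurable _ _).sub (hL.measurable _ _)).const_mul c')
  have hG : Measurable fun u : ℝ => Complex.exp (Complex.I * (u : ℂ)) := by fun_prop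
  have hi : IndepFun F' (fun ω => Complex.exp (Complex.I * (U ω : ℂ))) P := by
    rw [IndepFun_iff_Indep] at hind ⊢
    refine indep_of_indep_of_le_left (indep_of_indep_of_le_right hind ?_) hF'.measurable.comap_le
    have : Measurable[MeasurableSpace.comap U inferInstance]
        (fun ω => Complex.exp (Complex.I * (U ω : ℂ))) := hG.comp (comap_measurable U)
    exact this.comap_le
  have h := hi.integral_fun_mul_eq_mul_integral
    (hF'.mono (hL.leftSigma_le r)).aestronglyMeasurable (hG.comp hUm).aestronglyMeasurable
  rw [integral_congr_ae hFF', ← h]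
  refine integral_congr_ae ?_
  filter_upwards [hFF'] with ω hω
  rw [hω]

/-- Diffusive rescaling of a Lévy sheet multiplies its exponent. -/
theorem rescale (hL : IsLevySheet P L Ψ) {ε : ℝ≥0} (hε : 0 < ε) :
    IsLevySheet P (fun x y ω => L (x / ε) (y / ε) ω)
      (fun ξ => (((ε : ℝ) ^ 2)⁻¹ : ℝ) * Ψ ξ) where
  measurable x y := hL.measurable _ _
  zero_left y := by simpa using hL.zero_left (y / ε)
  zero_right x := by simpa using hL.zero_right (x / ε)
  continuous_in_probability z := by
    have h := hL.continuous_in_probability (z.1 / ε, z.2 / ε)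
    intro δ hδ
    refine (h δ hδ).comp (f := fun w : ℝ≥0 × ℝ≥0 => (w.1 / ε, w.2 / ε)) ?_
    have : Continuous fun w : ℝ≥0 × ℝ≥0 => (w.1 / ε, w.2 / ε) :=
      (continuous_fst.div_const _).prodMk (continuous_snd.div_const _)
    exact this.tendsto z
  indep_increments n a b c d hab hcd hdisj := by
    refine hL.indep_increments n (fun i => a i / ε) (fun i => b i / ε) (fun i => c i / ε)
      (fun i => d i / ε) (fun i => by gcongr; exact hab i) (fun i => by gcongr; exact hcd i) ?_
    intro i j hij
    rw [Set.disjoint_left]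
    rintro ⟨x, y⟩ ⟨h1, h2⟩ ⟨h3, h4⟩
    refine Set.disjoint_left.1 (hdisj i j hij)
      (show (x * ε, y * ε) ∈ _ from ⟨?_, ?_⟩) ⟨?_, ?_⟩
    · exact ⟨(div_lt_iff₀ hε).1 h1.1, (le_div_iff₀ hε).1 h1.2⟩
    · exact ⟨(div_lt_iff₀ hε).1 h2.1, (le_div_iff₀ hε).1 h2.2⟩
    · exact ⟨(div_lt_iff₀ hε).1 h3.1, (le_div_iff₀ hε).1 h3.2⟩
    · exact ⟨(div_lt_iff₀ hε).1 h4.1, (le_div_iff₀ hε).1 h4.2⟩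
  charFun_increment a b c d hab hcd ξ := by
    have := hL.charFun_increment (a / ε) (b / ε) (c / ε) (d / ε) (by gcongr) (by gcongr) ξ
    refine this.trans ?_
    congr 1
    have hε' : (ε : ℂ) ≠ 0 := by exact_mod_cast hε.ne'
    push_cast
    field_simp

end IsLevySheet

/-! ### Exponential kernels -/

theorem measurable_expKernel (κ : ℝ) :
    Measurable fun p : ℝ × ℝ => ENNReal.ofReal (Real.exp (-κ * |p.1 - p.2|)) :=
  ENNReal.measurable_ofReal.comp (by fun_prop)

theorem integrable_exp_neg_mul_abs {κ : ℝ} (hκ : 0 < κ) :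
    Integrable (fun u : ℝ => Real.exp (-κ * |u|)) := by
  have h1 : IntegrableOn (fun u : ℝ => Real.exp (-κ * |u|)) (Ioi 0) :=
    (integrableOn_exp_mul_Ioi (neg_lt_zero.2 hκ) 0).congr_fun
      (fun u hu => by rw [abs_of_pos hu]) measurableSet_Ioi
  have h2 : IntegrableOn (fun u : ℝ => Real.exp (-κ * |u|)) (Iic 0) :=
    (integrableOn_exp_mul_Iic hκ 0).congr_fun
      (fun u hu => by rw [abs_of_nonpos hu]; ring_nf) measurableSet_Iic
  rw [← integrableOn_univ, ← Iic_union_Ioi (a := (0 : ℝ))]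
  exact h2.union h1

theorem lintegral_expKernel_le {κ : ℝ} (hκ : 0 < κ) (x : ℝ) (A : Set ℝ) :
    ∫⁻ u in A, ENNReal.ofReal (Real.exp (-κ * |x - u|)) ≤ ENNReal.ofReal (2 / κ) := by
  have hIoi := integrable_exp_neg_mul_abs hκ
  calc ∫⁻ u in A, ENNReal.ofReal (Real.exp (-κ * |x - u|))
      ≤ ∫⁻ u, ENNReal.ofReal (Real.exp (-κ * |x - u|)) := setLIntegral_le_lintegral _ _
    _ = ∫⁻ u, ENNReal.ofReal (Real.exp (-κ * |u|)) :=
        lintegral_sub_left_eq_self (fun u => ENNReal.ofReal (Real.exp (-κ * |u|))) x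
    _ = ENNReal.ofReal (∫ u, Real.exp (-κ * |u|)) :=
        (ofReal_integral_eq_lintegral_ofReal hIoi (ae_of_all _ fun u => (Real.exp_pos _).le)).symm
    _ = ENNReal.ofReal (2 / κ) := by
        rw [integral_comp_abs (f := fun u => Real.exp (-κ * u)),
          integral_exp_mul_Ioi (neg_lt_zero.2 hκ)]
        congr 1
        simp
        field_simp

/-- The four-fold product of a measure with itself. -/
noncomputable abbrev quadMeasure (μ : Measure ℝ) : Measure (ℝ × ℝ × ℝ × ℝ) :=
  μ.prod (μ.prod (μ.prod μ))

theorem quadMeasure_integral_mul (μ : Measure ℝ) [SFinite μ] (f₁ f₂ f₃ f₄ : ℝ → ℂ) :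
    ∫ p, f₁ p.1 * (f₂ p.2.1 * (f₃ p.2.2.1 * f₄ p.2.2.2)) ∂(quadMeasure μ) =
      (∫ x, f₁ x ∂μ) * ((∫ x, f₂ x ∂μ) * ((∫ x, f₃ x ∂μ) * ∫ x, f₄ x ∂μ)) := by
  rw [quadMeasure, integral_prod_mul f₁ fun p : ℝ × ℝ × ℝ => f₂ p.1 * (f₃ p.2.1 * f₄ p.2.2),
    integral_prod_mul f₂ fun p : ℝ × ℝ => f₃ p.1 * f₄ p.2, integral_prod_mul]

/-- The three pairings contribute equally: each is a product of two double integrals. -/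
theorem integral_pairingSum_le {κ : ℝ} (hκ : 0 < κ) {A : Set ℝ} (hA : volume A ≠ ⊤) :
    ∫ p, pairingSum κ p.1 p.2.1 p.2.2.1 p.2.2.2 ∂(quadMeasure (volume.restrict A)) ≤
      3 * (volume.real A * (2 / κ)) ^ 2 := by
  set μ : Measure ℝ := volume.restrict A with hμ
  have : IsFiniteMeasure μ := ⟨by rw [hμ, Measure.restrict_apply_univ]; exact hA.lt_top⟩
  set k : ℝ → ℝ → ENNReal := fun x u => ENNReal.ofReal (Real.exp (-κ * |x - u|)) with hk
  set J : ENNReal := ENNReal.ofReal (2 / κ) with hJ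
  set M : ENNReal := volume A with hM
  have hkm : Measurable (Function.uncurry k) := measurable_expKernel κ
  have hk1 : ∀ x, Measurable (k x) := fun x => hkm.of_uncurry_left
  have hkJ : ∀ x, ∫⁻ u, k x u ∂μ ≤ J := fun x => lintegral_expKernel_le hκ x A
  have hone : ∀ c : ENNReal, ∫⁻ _, c ∂μ = c * M := fun c => by
    rw [lintegral_const, hμ, Measure.restrict_apply_univ]
  have nested : ∀ f : ℝ × ℝ × ℝ × ℝ → ENNReal, ∫⁻ p, f p ∂(quadMeasure μ) ≤
      ∫⁻ x₁, ∫⁻ x₂, ∫⁻ x₃, ∫⁻ x₄, f (x₁, x₂, x₃, x₄) ∂μ ∂μ ∂μ ∂μ := by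
    intro f
    refine (lintegral_prod_le f).trans (lintegral_mono fun x₁ => ?_)
    refine (lintegral_prod_le _).trans (lintegral_mono fun x₂ => ?_)
    exact lintegral_prod_le _
  have pull : ∀ (c : ENNReal) (x : ℝ), ∫⁻ u, c * k x u ∂μ ≤ c * J := by
    intro c x
    rw [lintegral_const_mul _ (hk1 x)]
    gcongr
    exact hkJ x
  have pull' : ∀ (c : ENNReal) (x : ℝ), ∫⁻ u, k x u * c ∂μ ≤ c * J := by
    intro c x
    simp_rw [mul_comm _ c]
    exact pull c x
  have T1 : ∫⁻ p, k p.1 p.2.1 * k p.2.2.1 p.2.2.2 ∂(quadMeasure μ) ≤ (M * J) ^ 2 := by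
    refine (nested _).trans ?_
    calc _ ≤ ∫⁻ x₁, ∫⁻ x₂, ∫⁻ _, k x₁ x₂ * J ∂μ ∂μ ∂μ := by
          gcongr with x₁ x₂ x₃; exact pull _ _
      _ ≤ ∫⁻ _, J * M * J ∂μ := by
          gcongr with x₁
          simp_rw [hone, mul_assoc]
          exact (pull' _ _).trans_eq (by ring)
      _ = (M * J) ^ 2 := by rw [hone]; ring
  have T2 : ∫⁻ p, k p.1 p.2.2.1 * k p.2.1 p.2.2.2 ∂(quadMeasure μ) ≤ (M * J) ^ 2 := by
    refine (nested _).trans ?_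
    calc _ ≤ ∫⁻ x₁, ∫⁻ x₂, ∫⁻ x₃, k x₁ x₃ * J ∂μ ∂μ ∂μ := by
          gcongr with x₁ x₂ x₃; exact pull _ _
      _ ≤ ∫⁻ x₁, ∫⁻ _, J * J ∂μ ∂μ := by
          gcongr with x₁ x₂; exact pull' _ _
      _ = (M * J) ^ 2 := by rw [hone, hone]; ring
  have T3 : ∫⁻ p, k p.1 p.2.2.2 * k p.2.1 p.2.2.1 ∂(quadMeasure μ) ≤ (M * J) ^ 2 := by
    refine (nested _).trans ?_
    calc _ ≤ ∫⁻ x₁, ∫⁻ x₂, ∫⁻ x₃, k x₂ x₃ * J ∂μ ∂μ ∂μ := by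
          gcongr with x₁ x₂ x₃; exact (pull' _ _)
      _ ≤ ∫⁻ x₁, ∫⁻ _, J * J ∂μ ∂μ := by
          gcongr with x₁ x₂; exact pull' _ _
      _ = (M * J) ^ 2 := by rw [hone, hone]; ring
  have hcont : Continuous fun p : ℝ × ℝ × ℝ × ℝ => pairingSum κ p.1 p.2.1 p.2.2.1 p.2.2.2 := by
    unfold pairingSum; fun_prop
  rw [integral_eq_lintegral_of_nonneg_ae (ae_of_all _ fun p => pairingSum_nonneg _ _ _ _ _)
    hcont.aestronglyMeasurable]
  refine ENNReal.toReal_le_of_le_ofReal (by positivity) ?_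
  have hsplit : ∀ p : ℝ × ℝ × ℝ × ℝ, ENNReal.ofReal (pairingSum κ p.1 p.2.1 p.2.2.1 p.2.2.2) =
      k p.1 p.2.1 * k p.2.2.1 p.2.2.2 + (k p.1 p.2.2.1 * k p.2.1 p.2.2.2 +
        k p.1 p.2.2.2 * k p.2.1 p.2.2.1) := by
    intro p
    simp only [pairingSum, hk]
    rw [ENNReal.ofReal_add (by positivity) (by positivity),
      ENNReal.ofReal_add (by positivity) (by positivity), ENNReal.ofReal_mul (by positivity),
      ENNReal.ofReal_mul (by positivity), ENNReal.ofReal_mul (by positivity), add_assoc]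
  have hm : ∀ {f g : ℝ × ℝ × ℝ × ℝ → ℝ}, Measurable f → Measurable g →
      Measurable fun p => k (f p) (g p) := fun hf hg => hkm.comp (hf.prodMk hg)
  simp_rw [hsplit]
  have m1 : Measurable fun p : ℝ × ℝ × ℝ × ℝ => k p.1 p.2.1 * k p.2.2.1 p.2.2.2 :=
    (hm (by fun_prop) (by fun_prop)).mul (hm (by fun_prop) (by fun_prop))
  have m2 : Measurable fun p : ℝ × ℝ × ℝ × ℝ => k p.1 p.2.2.1 * k p.2.1 p.2.2.2 :=
    (hm (by fun_prop) (by fun_prop)).mul (hm (by fun_prop) (by fun_prop))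
  rw [lintegral_add_left m1, lintegral_add_left m2]
  refine (add_le_add T1 (add_le_add T2 T3)).trans_eq ?_
  have e : M * J = ENNReal.ofReal (volume.real A * (2 / κ)) := by
    rw [ENNReal.ofReal_mul measureReal_nonneg, ofReal_measureReal hA]
  rw [e, ← ENNReal.ofReal_pow (by positivity), ← ENNReal.ofReal_add (by positivity) (by positivity),
    ← ENNReal.ofReal_add (by positivity) (by positivity)]
  congr 1
  ring

/-- Chaining exponential kernels on the plane: two points linked to partners by a planar kernel and to
each other by a kernel in the second coordinate. -/
theorem integral_chained_kernel_le {κ : ℝ} (hκ : 0 < κ) {A B : Set ℝ} (hA : volume A ≠ ⊤)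
    (hB : volume B ≠ ⊤) :
    ∫ p : ((ℝ × ℝ) × ℝ × ℝ) × (ℝ × ℝ) × ℝ × ℝ,
      (Real.exp (-κ * |p.1.1.1 - p.1.2.1|) * Real.exp (-κ * |p.1.1.2 - p.1.2.2|)) *
      ((Real.exp (-κ * |p.2.1.1 - p.2.2.1|) * Real.exp (-κ * |p.2.1.2 - p.2.2.2|)) *
      Real.exp (-κ * |p.1.1.2 - p.2.1.2|))
      ∂((((volume.restrict A).prod (volume.restrict B)).prod
        ((volume.restrict A).prod (volume.restrict B))).prod
        (((volume.restrict A).prod (volume.restrict B)).prod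
        ((volume.restrict A).prod (volume.restrict B)))) ≤
      volume.real A ^ 2 * volume.real B * (2 / κ) ^ 5 := by
  set μ : Measure ℝ := volume.restrict A with hμ
  set ν : Measure ℝ := volume.restrict B with hν
  have : IsFiniteMeasure μ := ⟨by rw [hμ, Measure.restrict_apply_univ]; exact hA.lt_top⟩
  have : IsFiniteMeasure ν := ⟨by rw [hν, Measure.restrict_apply_univ]; exact hB.lt_top⟩
  set k : ℝ → ℝ → ENNReal := fun x u => ENNReal.ofReal (Real.exp (-κ * |x - u|)) with hk
  set J : ENNReal := ENNReal.ofReal (2 / κ) with hJ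
  have hkm : Measurable (Function.uncurry k) := measurable_expKernel κ
  have hk1 : ∀ x, Measurable (k x) := fun x => hkm.of_uncurry_left
  have hplane : ∀ z : ℝ × ℝ, ∫⁻ w : ℝ × ℝ, k z.1 w.1 * k z.2 w.2 ∂(μ.prod ν) ≤ J * J := by
    intro z
    rw [lintegral_prod_mul (hk1 _).aemeasurable (hk1 _).aemeasurable]
    exact mul_le_mul' (lintegral_expKernel_le hκ _ A) (lintegral_expKernel_le hκ _ B)
  have hkp : ∀ z : ℝ × ℝ, Measurable fun w : ℝ × ℝ => k z.1 w.1 * k z.2 w.2 := fun z =>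
    ((hk1 _).comp measurable_fst).mul ((hk1 _).comp measurable_snd)
  have hk2 : ∀ y : ℝ, Measurable fun w : ℝ × ℝ => k y w.2 := fun y => (hk1 y).comp measurable_snd
  have hpull : ∀ (c : ENNReal) (z : ℝ × ℝ),
      ∫⁻ w : ℝ × ℝ, k z.1 w.1 * k z.2 w.2 * c ∂(μ.prod ν) ≤ J * J * c := by
    intro c z
    rw [lintegral_mul_const _ (hkp z)]
    gcongr
    exact hplane z
  have hline : ∀ y : ℝ, ∫⁻ w : ℝ × ℝ, k y w.2 ∂(μ.prod ν) ≤ volume A * J := by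
    intro y
    have := lintegral_prod_mul (μ := μ) (ν := ν) (f := fun _ => 1) (g := k y)
      aemeasurable_const (hk1 _).aemeasurable
    simp only [one_mul, lintegral_const, hμ, Measure.restrict_apply_univ] at this
    rw [hμ, this]
    gcongr
    exact lintegral_expKernel_le hκ _ B
  have hcont : Continuous fun p : ((ℝ × ℝ) × ℝ × ℝ) × (ℝ × ℝ) × ℝ × ℝ =>
      (Real.exp (-κ * |p.1.1.1 - p.1.2.1|) * Real.exp (-κ * |p.1.1.2 - p.1.2.2|)) *
      ((Real.exp (-κ * |p.2.1.1 - p.2.2.1|) * Real.exp (-κ * |p.2.1.2 - p.2.2.2|)) *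
      Real.exp (-κ * |p.1.1.2 - p.2.1.2|)) := by fun_prop
  rw [integral_eq_lintegral_of_nonneg_ae (ae_of_all _ fun p => by positivity)
    hcont.aestronglyMeasurable]
  refine ENNReal.toReal_le_of_le_ofReal (by positivity) ?_
  have e : ∀ p : ((ℝ × ℝ) × ℝ × ℝ) × (ℝ × ℝ) × ℝ × ℝ, ENNReal.ofReal
      ((Real.exp (-κ * |p.1.1.1 - p.1.2.1|) * Real.exp (-κ * |p.1.1.2 - p.1.2.2|)) *
      ((Real.exp (-κ * |p.2.1.1 - p.2.2.1|) * Real.exp (-κ * |p.2.1.2 - p.2.2.2|)) *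
      Real.exp (-κ * |p.1.1.2 - p.2.1.2|))) =
      (k p.1.1.1 p.1.2.1 * k p.1.1.2 p.1.2.2) *
        ((k p.2.1.1 p.2.2.1 * k p.2.1.2 p.2.2.2) * k p.1.1.2 p.2.1.2) := by
    intro p
    simp only [hk]
    rw [ENNReal.ofReal_mul (by positivity), ENNReal.ofReal_mul (by positivity),
      ENNReal.ofReal_mul (by positivity), ENNReal.ofReal_mul (by positivity)]
  simp_rw [e]
  calc _ ≤ ∫⁻ z, ∫⁻ z', ∫⁻ w, ∫⁻ w', (k z.1 z'.1 * k z.2 z'.2) *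
        ((k w.1 w'.1 * k w.2 w'.2) * k z.2 w.2) ∂(μ.prod ν) ∂(μ.prod ν) ∂(μ.prod ν) ∂(μ.prod ν) := by
        refine (lintegral_prod_le _).trans ((lintegral_prod_le _).trans ?_)
        gcongr with z z'
        exact lintegral_prod_le _
    _ ≤ ∫⁻ z, ∫⁻ z', ∫⁻ w, (k z.1 z'.1 * k z.2 z'.2) * (J * J * k z.2 w.2)
          ∂(μ.prod ν) ∂(μ.prod ν) ∂(μ.prod ν) := by
        gcongr with z z' w
        rw [lintegral_const_mul _ ((hkp w).mul_const _)]
        gcongr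
        exact hpull _ _
    _ ≤ ∫⁻ z, ∫⁻ z', (k z.1 z'.1 * k z.2 z'.2) * (J * J * (volume A * J))
          ∂(μ.prod ν) ∂(μ.prod ν) := by
        gcongr with z z'
        rw [lintegral_const_mul _ ((hk2 z.2).const_mul (J * J)), lintegral_const_mul _ (hk2 z.2)]
        gcongr
        exact hline _
    _ ≤ ∫⁻ _, J * J * (J * J * (volume A * J)) ∂(μ.prod ν) := by
        gcongr with z
        exact hpull _ _
    _ = J * J * (J * J * (volume A * J)) * (volume A * volume B) := by
        rw [lintegral_const, ← univ_prod_univ, Measure.prod_prod, hμ, hν,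
          Measure.restrict_apply_univ, Measure.restrict_apply_univ]
    _ = _ := by
        rw [ENNReal.ofReal_mul (by positivity), ENNReal.ofReal_mul (by positivity),
          ENNReal.ofReal_pow (by positivity), ENNReal.ofReal_pow (by positivity),
          ofReal_measureReal hA, ofReal_measureReal hB]
        ring

/-! ### Moments of oscillatory integrals over a block -/

/-- The phase `exp (i θ L(x,y))`. -/
noncomputable def sheetPhase {Ω : Type*} (L : ℝ≥0 → ℝ≥0 → Ω → ℝ) (θ : ℝ) (z : ℝ × ℝ) (ω : Ω) : ℂ :=
  Complex.exp (Complex.I * ((θ * L z.1.toNNReal z.2.toNNReal ω : ℝ) : ℂ))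

open Classical in
/-- The weight `√(xy)` cut off outside the open block `(s,s') × (t,t')`. -/
noncomputable def blockWeight (s s' t t' : ℝ) (z : ℝ × ℝ) : ℝ :=
  if z ∈ Ioo s s' ×ˢ Ioo t t' then √(z.1 * z.2) else 0

/-- Lebesgue measure on the open block `(s,s') × (t,t')`. -/
noncomputable abbrev blockMeasure (s s' t t' : ℝ) : Measure (ℝ × ℝ) :=
  (volume.restrict (Ioo s s')).prod (volume.restrict (Ioo t t'))

/-- The oscillatory integral `∫∫ √(xy) exp (i θ L(x,y)) dx dy` over the block `(s,s') × (t,t')`. -/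
noncomputable def blockIntegral {Ω : Type*} (L : ℝ≥0 → ℝ≥0 → Ω → ℝ) (θ s s' t t' : ℝ) (ω : Ω) : ℂ :=
  ∫ z, (blockWeight s s' t t' z : ℂ) * sheetPhase L θ z ω ∂(blockMeasure s s' t t')

section Basic

variable {Ω : Type*} {L : ℝ≥0 → ℝ≥0 → Ω → ℝ} {θ s s' t t' : ℝ}

theorem norm_sheetPhase (z : ℝ × ℝ) (ω : Ω) : ‖sheetPhase L θ z ω‖ = 1 := by
  rw [sheetPhase, mul_comm, Complex.norm_exp_ofReal_mul_I]

theorem conj_sheetPhase (z : ℝ × ℝ) (ω : Ω) : (starRingEnd ℂ) (sheetPhase L θ z ω) =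
    Complex.exp (Complex.I * ((-(θ * L z.1.toNNReal z.2.toNNReal ω) : ℝ) : ℂ)) := by
  rw [sheetPhase, ← Complex.exp_conj]
  simp

theorem measurable_sheetPhase [MeasurableSpace Ω]
    (hL : Measurable fun p : (ℝ≥0 × ℝ≥0) × Ω => L p.1.1 p.1.2 p.2) (θ : ℝ) :
    Measurable fun p : Ω × (ℝ × ℝ) => sheetPhase L θ p.2 p.1 := by
  have h : Measurable fun p : Ω × (ℝ × ℝ) => L p.2.1.toNNReal p.2.2.toNNReal p.1 :=
    hL.comp (g := fun p : (ℝ≥0 × ℝ≥0) × Ω => L p.1.1 p.1.2 p.2)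
      (f := fun p : Ω × (ℝ × ℝ) => ((p.2.1.toNNReal, p.2.2.toNNReal), p.1)) (by fun_prop)
  exact Complex.measurable_exp.comp
    ((Complex.measurable_ofReal.comp (h.const_mul θ)).const_mul Complex.I)

theorem measurable_blockWeight : Measurable (blockWeight s s' t t') := by
  unfold blockWeight
  exact Measurable.ite (measurableSet_Ioo.prod measurableSet_Ioo) (by fun_prop) measurable_const

theorem blockWeight_nonneg (z : ℝ × ℝ) : 0 ≤ blockWeight s s' t t' z := by
  unfold blockWeight
  split_ifs
  · positivity
  · exact le_rfl

theorem blockWeight_le {R : ℝ} (hs : 0 ≤ s) (ht : 0 ≤ t) (hR : 0 ≤ R) (hs' : s' ≤ R) (ht' : t' ≤ R)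
    (z : ℝ × ℝ) : blockWeight s s' t t' z ≤ R := by
  unfold blockWeight
  split_ifs with h
  · rw [Real.sqrt_le_left hR, sq]
    have h1 : z.1 ≤ R := h.1.2.le.trans hs'
    have h2 : z.2 ≤ R := h.2.2.le.trans ht'
    have h3 : 0 ≤ z.1 := hs.trans h.1.1.le
    have h4 : 0 ≤ z.2 := ht.trans h.2.1.le
    gcongr
  · exact hR

theorem blockWeight_of_notMem {z : ℝ × ℝ} (h : z ∉ Ioo s s' ×ˢ Ioo t t') :
    blockWeight s s' t t' z = 0 := if_neg h

theorem blockMeasure_real_univ (hss' : s ≤ s') (htt' : t ≤ t') :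
    (blockMeasure s s' t t').real univ = (s' - s) * (t' - t) := by
  rw [← univ_prod_univ, measureReal_prod_prod, measureReal_restrict_apply_univ,
    measureReal_restrict_apply_univ, Real.volume_real_Ioo_of_le hss',
    Real.volume_real_Ioo_of_le htt']

theorem integrable_of_measurable_of_norm_le {α : Type*} [MeasurableSpace α] {μ : Measure α}
    [IsFiniteMeasure μ] {f : α → ℂ} (hf : Measurable f) {C : ℝ} (hC : ∀ x, ‖f x‖ ≤ C) :
    Integrable f μ :=
  Integrable.of_bound hf.aestronglyMeasurable C (ae_of_all _ hC)

end Basic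

namespace IsLevySheet

variable {Ω : Type*} [MeasurableSpace Ω] {P : Measure Ω} [IsProbabilityMeasure P]
  {L : ℝ≥0 → ℝ≥0 → Ω → ℝ} {Ψ : ℝ → ℂ} {θ s s' t t' : ℝ}

theorem norm_integral_alternating_phase_le (hL : IsLevySheet P L Ψ) (hs : 0 ≤ s) (ht : 0 ≤ t)
    {z₁ z₂ z₃ z₄ : ℝ × ℝ} (h₁ : z₁ ∈ Ioo s s' ×ˢ Ioo t t') (h₂ : z₂ ∈ Ioo s s' ×ˢ Ioo t t')
    (h₃ : z₃ ∈ Ioo s s' ×ˢ Ioo t t') (h₄ : z₄ ∈ Ioo s s' ×ˢ Ioo t t') :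
    ‖∫ ω, sheetPhase L θ z₁ ω * ((starRingEnd ℂ) (sheetPhase L θ z₂ ω) * (sheetPhase L θ z₃ ω *
      (starRingEnd ℂ) (sheetPhase L θ z₄ ω))) ∂P‖ ≤
      pairingSum ((Ψ θ).re * t) z₁.1 z₂.1 z₃.1 z₄.1 *
        pairingSum ((Ψ θ).re * s) z₁.2 z₂.2 z₃.2 z₄.2 := by
  have hx : ∀ z : ℝ × ℝ, z ∈ Ioo s s' ×ˢ Ioo t t' → s.toNNReal ≤ z.1.toNNReal := fun z h =>
    Real.toNNReal_le_toNNReal h.1.1.le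
  have hy : ∀ z : ℝ × ℝ, z ∈ Ioo s s' ×ˢ Ioo t t' → t.toNNReal ≤ z.2.toNNReal := fun z h =>
    Real.toNNReal_le_toNNReal h.2.1.le
  have cx : ∀ z : ℝ × ℝ, z ∈ Ioo s s' ×ˢ Ioo t t' → (z.1.toNNReal : ℝ) = z.1 := fun z h =>
    Real.coe_toNNReal _ (hs.trans h.1.1.le)
  have cy : ∀ z : ℝ × ℝ, z ∈ Ioo s s' ×ˢ Ioo t t' → (z.2.toNNReal : ℝ) = z.2 := fun z h =>
    Real.coe_toNNReal _ (ht.trans h.2.1.le)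
  have := hL.norm_charFun_alternating_le θ (hx _ h₁) (hx _ h₂) (hx _ h₃) (hx _ h₄)
    (hy _ h₁) (hy _ h₂) (hy _ h₃) (hy _ h₄)
  rw [cx _ h₁, cx _ h₂, cx _ h₃, cx _ h₄, cy _ h₁, cy _ h₂, cy _ h₃, cy _ h₄,
    Real.coe_toNNReal _ hs, Real.coe_toNNReal _ ht] at this
  refine le_trans (le_of_eq ?_) this
  congr 2
  ext ω
  rw [conj_sheetPhase, conj_sheetPhase, sheetPhase, sheetPhase, ← Complex.exp_add,
    ← Complex.exp_add, ← Complex.exp_add]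
  congr 1
  push_cast
  ring

/-- Fourth moment bound: each of the two coordinates contributes a square of a double integral of an
exponential kernel. -/
theorem integral_norm_blockIntegral_pow_four_le (hL : IsLevySheet P L Ψ)
    (hmeas : Measurable fun p : (ℝ≥0 × ℝ≥0) × Ω => L p.1.1 p.1.2 p.2) (hs : 0 < s) (ht : 0 < t)
    (hss' : s ≤ s') (htt' : t ≤ t') {R : ℝ} (hs' : s' ≤ R) (ht' : t' ≤ R)
    (ha : 0 < (Ψ θ).re) :
    ∫ ω, ‖blockIntegral L θ s s' t t' ω‖ ^ 4 ∂P ≤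
      R ^ 4 * ((3 * ((s' - s) * (2 / ((Ψ θ).re * t))) ^ 2) *
        (3 * ((t' - t) * (2 / ((Ψ θ).re * s))) ^ 2)) := by
  have hR : 0 ≤ R := hs.le.trans (hss'.trans hs')
  set μ : Measure ℝ := volume.restrict (Ioo s s') with hμ
  set ν : Measure ℝ := volume.restrict (Ioo t t') with hν
  set g : Ω → ℝ × ℝ → ℂ := fun ω z => (blockWeight s s' t t' z : ℂ) * sheetPhase L θ z ω with hg
  have hgm : Measurable (Function.uncurry g) :=
    (Complex.measurable_ofReal.comp (measurable_blockWeight.comp measurable_snd)).mul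
      (measurable_sheetPhase hmeas θ)
  have hgb : ∀ ω z, ‖g ω z‖ ≤ R := fun ω z => by
    rw [hg, norm_mul, norm_sheetPhase, mul_one, Complex.norm_real,
      Real.norm_of_nonneg (blockWeight_nonneg z)]
    exact blockWeight_le hs.le ht.le hR hs' ht' z
  have hcm : Measurable (starRingEnd ℂ) := Complex.continuous_conj.measurable
  set G : Ω → (ℝ × ℝ × ℝ × ℝ) × (ℝ × ℝ × ℝ × ℝ) → ℂ := fun ω u =>
    g ω (u.2.1, u.1.1) * ((starRingEnd ℂ) (g ω (u.2.2.1, u.1.2.1)) *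
      (g ω (u.2.2.2.1, u.1.2.2.1) * (starRingEnd ℂ) (g ω (u.2.2.2.2, u.1.2.2.2)))) with hG
  have hGm : Measurable (Function.uncurry G) := by
    have m1 : Measurable fun p : Ω × ((ℝ × ℝ × ℝ × ℝ) × (ℝ × ℝ × ℝ × ℝ)) =>
      g p.1 (p.2.2.1, p.2.1.1) := hgm.comp (f := fun p : Ω × ((ℝ × ℝ × ℝ × ℝ) × (ℝ × ℝ × ℝ × ℝ)) =>
        (p.1, (p.2.2.1, p.2.1.1))) (by fun_prop)
    have m2 : Measurable fun p : Ω × ((ℝ × ℝ × ℝ × ℝ) × (ℝ × ℝ × ℝ × ℝ)) =>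
      g p.1 (p.2.2.2.1, p.2.1.2.1) := hgm.comp
        (f := fun p : Ω × ((ℝ × ℝ × ℝ × ℝ) × (ℝ × ℝ × ℝ × ℝ)) =>
        (p.1, (p.2.2.2.1, p.2.1.2.1))) (by fun_prop)
    have m3 : Measurable fun p : Ω × ((ℝ × ℝ × ℝ × ℝ) × (ℝ × ℝ × ℝ × ℝ)) =>
      g p.1 (p.2.2.2.2.1, p.2.1.2.2.1) := hgm.comp
        (f := fun p : Ω × ((ℝ × ℝ × ℝ × ℝ) × (ℝ × ℝ × ℝ × ℝ)) =>
        (p.1, (p.2.2.2.2.1, p.2.1.2.2.1))) (by fun_prop)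
    have m4 : Measurable fun p : Ω × ((ℝ × ℝ × ℝ × ℝ) × (ℝ × ℝ × ℝ × ℝ)) =>
      g p.1 (p.2.2.2.2.2, p.2.1.2.2.2) := hgm.comp
        (f := fun p : Ω × ((ℝ × ℝ × ℝ × ℝ) × (ℝ × ℝ × ℝ × ℝ)) =>
        (p.1, (p.2.2.2.2.2, p.2.1.2.2.2))) (by fun_prop)
    exact m1.mul ((hcm.comp m2).mul (m3.mul (hcm.comp m4)))
  have hGb : ∀ ω u, ‖G ω u‖ ≤ R * (R * (R * R)) := fun ω u => by
    simp only [hG, norm_mul, RCLike.norm_conj]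
    gcongr <;> exact hgb _ _
  have hYq : ∀ ω, (‖blockIntegral L θ s s' t t' ω‖ ^ 4 : ℝ) =
      (∫ u, G ω u ∂((quadMeasure ν).prod (quadMeasure μ))).re := by
    intro ω
    have hY : blockIntegral L θ s s' t t' ω = ∫ y, ∫ x, g ω (x, y) ∂μ ∂ν :=
      integral_prod_symm _ (integrable_of_measurable_of_norm_le hgm.of_uncurry_left (hgb ω))
    have hYc : (starRingEnd ℂ) (blockIntegral L θ s s' t t' ω) =
        ∫ y, (starRingEnd ℂ) (∫ x, g ω (x, y) ∂μ) ∂ν := by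
      rw [hY, integral_conj]
    have hprod : ∫ u, G ω u ∂((quadMeasure ν).prod (quadMeasure μ)) =
        ∫ q, ∫ p, G ω (q, p) ∂(quadMeasure μ) ∂(quadMeasure ν) :=
      integral_prod _ (integrable_of_measurable_of_norm_le hGm.of_uncurry_left (hGb ω))
    have hin : ∀ q : ℝ × ℝ × ℝ × ℝ, ∫ p, G ω (q, p) ∂(quadMeasure μ) =
        (∫ x, g ω (x, q.1) ∂μ) * ((starRingEnd ℂ) (∫ x, g ω (x, q.2.1) ∂μ) *
        ((∫ x, g ω (x, q.2.2.1) ∂μ) * (starRingEnd ℂ) (∫ x, g ω (x, q.2.2.2) ∂μ))) := by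
      intro q
      simp only [hG]
      rw [quadMeasure_integral_mul μ (fun x => g ω (x, q.1))
        (fun x => (starRingEnd ℂ) (g ω (x, q.2.1))) (fun x => g ω (x, q.2.2.1))
        (fun x => (starRingEnd ℂ) (g ω (x, q.2.2.2))), integral_conj, integral_conj]
    rw [hprod]
    simp_rw [hin]
    rw [quadMeasure_integral_mul ν (fun y => ∫ x, g ω (x, y) ∂μ)
      (fun y => (starRingEnd ℂ) (∫ x, g ω (x, y) ∂μ)) (fun y => ∫ x, g ω (x, y) ∂μ)
      (fun y => (starRingEnd ℂ) (∫ x, g ω (x, y) ∂μ)), ← hY, ← hYc]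
    have e : ∀ Y : ℂ, Y * ((starRingEnd ℂ) Y * (Y * (starRingEnd ℂ) Y)) = ((‖Y‖ ^ 4 : ℝ) : ℂ) := by
      intro Y
      rw [← mul_assoc, Complex.mul_conj, Complex.normSq_eq_norm_sq]
      push_cast
      ring
    rw [e, Complex.ofReal_re]
  have hint : Integrable (Function.uncurry G)
      (P.prod ((quadMeasure ν).prod (quadMeasure μ))) :=
    integrable_of_measurable_of_norm_le hGm (fun p => hGb p.1 p.2)
  simp_rw [hYq]
  have hre : ∫ ω, (∫ u, G ω u ∂((quadMeasure ν).prod (quadMeasure μ))).re ∂P =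
      (∫ ω, ∫ u, G ω u ∂((quadMeasure ν).prod (quadMeasure μ)) ∂P).re :=
    integral_re hint.integral_prod_left
  rw [hre, integral_integral_swap hint]
  refine (Complex.re_le_norm _).trans ?_
  set F₁ : ℝ × ℝ × ℝ × ℝ → ℝ := fun p =>
    pairingSum ((Ψ θ).re * t) p.1 p.2.1 p.2.2.1 p.2.2.2 with hF₁
  set F₂ : ℝ × ℝ × ℝ × ℝ → ℝ := fun p =>
    pairingSum ((Ψ θ).re * s) p.1 p.2.1 p.2.2.1 p.2.2.2 with hF₂
  have hpair : ∀ κ : ℝ, 0 ≤ κ → ∀ ρ : Measure ℝ, IsFiniteMeasure ρ →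
      Integrable (fun p : ℝ × ℝ × ℝ × ℝ => pairingSum κ p.1 p.2.1 p.2.2.1 p.2.2.2)
        (quadMeasure ρ) := by
    intro κ hκ ρ hρ
    have hcont : Continuous fun p : ℝ × ℝ × ℝ × ℝ => pairingSum κ p.1 p.2.1 p.2.2.1 p.2.2.2 := by
      unfold pairingSum; fun_prop
    refine Integrable.of_bound hcont.aestronglyMeasurable 3 (ae_of_all _ fun p => ?_)
    rw [Real.norm_of_nonneg (pairingSum_nonneg _ _ _ _ _)]
    have h1 : ∀ a b : ℝ, Real.exp (-κ * |a - b|) ≤ 1 := fun a b =>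
      Real.exp_le_one_iff.2 (by rw [neg_mul]; exact neg_nonpos.2 (by positivity))
    have h2 : ∀ a b c d : ℝ, Real.exp (-κ * |a - b|) * Real.exp (-κ * |c - d|) ≤ 1 :=
      fun a b c d => mul_le_one₀ (h1 _ _) (Real.exp_pos _).le (h1 _ _)
    unfold pairingSum
    linarith [h2 p.1 p.2.1 p.2.2.1 p.2.2.2, h2 p.1 p.2.2.1 p.2.1 p.2.2.2,
      h2 p.1 p.2.2.2 p.2.1 p.2.2.1]
  have hF₁i : Integrable F₁ (quadMeasure μ) := hpair _ (by positivity) μ inferInstance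
  have hF₂i : Integrable F₂ (quadMeasure ν) := hpair _ (by positivity) ν inferInstance
  have hbound : ∀ u : (ℝ × ℝ × ℝ × ℝ) × (ℝ × ℝ × ℝ × ℝ), ‖∫ ω, G ω u ∂P‖ ≤
      R ^ 4 * (F₂ u.1 * F₁ u.2) := by
    intro u
    have hnn : 0 ≤ F₂ u.1 * F₁ u.2 :=
      mul_nonneg (pairingSum_nonneg _ _ _ _ _) (pairingSum_nonneg _ _ _ _ _)
    have e : ∀ ω, G ω u = ((blockWeight s s' t t' (u.2.1, u.1.1) *
        (blockWeight s s' t t' (u.2.2.1, u.1.2.1) * (blockWeight s s' t t' (u.2.2.2.1, u.1.2.2.1) *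
        blockWeight s s' t t' (u.2.2.2.2, u.1.2.2.2))) : ℝ) : ℂ) *
        (sheetPhase L θ (u.2.1, u.1.1) ω * ((starRingEnd ℂ) (sheetPhase L θ (u.2.2.1, u.1.2.1) ω) *
        (sheetPhase L θ (u.2.2.2.1, u.1.2.2.1) ω *
        (starRingEnd ℂ) (sheetPhase L θ (u.2.2.2.2, u.1.2.2.2) ω)))) := by
      intro ω
      simp only [hG, hg, map_mul, Complex.conj_ofReal]
      push_cast
      ring
    simp_rw [e]
    rw [integral_const_mul, norm_mul, Complex.norm_real]
    have w0 := fun z => blockWeight_nonneg (s := s) (s' := s') (t := t) (t' := t') z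
    have wR := fun z => blockWeight_le (s := s) (s' := s') (t := t) (t' := t') hs.le ht.le hR hs' ht' z
    have hprodR : blockWeight s s' t t' (u.2.1, u.1.1) *
        (blockWeight s s' t t' (u.2.2.1, u.1.2.1) * (blockWeight s s' t t' (u.2.2.2.1, u.1.2.2.1) *
        blockWeight s s' t t' (u.2.2.2.2, u.1.2.2.2))) ≤ R ^ 4 := by
      calc _ ≤ R * (R * (R * R)) := by
            have h1 := w0 (u.2.1, u.1.1)
            have h2 := w0 (u.2.2.1, u.1.2.1)
            have h3 := w0 (u.2.2.2.1, u.1.2.2.1)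
            have h4 := w0 (u.2.2.2.2, u.1.2.2.2)
            gcongr <;> exact wR _
        _ = R ^ 4 := by ring
    rw [Real.norm_of_nonneg (mul_nonneg (w0 _) (mul_nonneg (w0 _) (mul_nonneg (w0 _) (w0 _))))]
    by_cases h1 : (u.2.1, u.1.1) ∈ Ioo s s' ×ˢ Ioo t t'
    swap
    · rw [blockWeight_of_notMem h1]; simp only [zero_mul]; positivity
    by_cases h2 : (u.2.2.1, u.1.2.1) ∈ Ioo s s' ×ˢ Ioo t t'
    swap
    · rw [blockWeight_of_notMem h2]; simp only [zero_mul, mul_zero]; positivity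
    by_cases h3 : (u.2.2.2.1, u.1.2.2.1) ∈ Ioo s s' ×ˢ Ioo t t'
    swap
    · rw [blockWeight_of_notMem h3]; simp only [zero_mul, mul_zero]; positivity
    by_cases h4 : (u.2.2.2.2, u.1.2.2.2) ∈ Ioo s s' ×ˢ Ioo t t'
    swap
    · rw [blockWeight_of_notMem h4]; simp only [zero_mul, mul_zero]; positivity
    have := hL.norm_integral_alternating_phase_le (θ := θ) hs.le ht.le h1 h2 h3 h4
    refine mul_le_mul hprodR (this.trans_eq (mul_comm _ _)) (norm_nonneg _) (by positivity)
  calc ‖∫ u, ∫ ω, G ω u ∂P ∂((quadMeasure ν).prod (quadMeasure μ))‖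
      ≤ ∫ u, R ^ 4 * (F₂ u.1 * F₁ u.2) ∂((quadMeasure ν).prod (quadMeasure μ)) :=
        norm_integral_le_of_norm_le ((hF₂i.mul_prod hF₁i).const_mul _) (ae_of_all _ hbound)
    _ = R ^ 4 * ((∫ q, F₂ q ∂(quadMeasure ν)) * ∫ p, F₁ p ∂(quadMeasure μ)) := by
        rw [integral_const_mul, integral_prod_mul]
    _ ≤ R ^ 4 * ((3 * ((t' - t) * (2 / ((Ψ θ).re * s))) ^ 2) *
        (3 * ((s' - s) * (2 / ((Ψ θ).re * t))) ^ 2)) := by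
        have i1 := integral_pairingSum_le (κ := (Ψ θ).re * t) (by positivity) (A := Ioo s s') (by simp)
        have i2 := integral_pairingSum_le (κ := (Ψ θ).re * s) (by positivity) (A := Ioo t t') (by simp)
        rw [Real.volume_real_Ioo_of_le hss'] at i1
        rw [Real.volume_real_Ioo_of_le htt'] at i2
        have n1 : 0 ≤ ∫ p, F₁ p ∂(quadMeasure μ) :=
          integral_nonneg fun p => pairingSum_nonneg _ _ _ _ _
        gcongr
    _ = _ := by ring

end IsLevySheet

/-! ### Second-order functionals against the past -/

theorem sq_integral_norm_le {Ω : Type*} [MeasurableSpace Ω] {P : Measure Ω} [IsProbabilityMeasure P]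
    {W : Ω → ℂ} (hW : StronglyMeasurable W) {C : ℝ} (hC : ∀ ω, ‖W ω‖ ≤ C) :
    (∫ ω, ‖W ω‖ ∂P) ^ 2 ≤ ∫ ω, ‖W ω‖ ^ 2 ∂P := by
  have i1 : Integrable (fun ω => ‖W ω‖) P :=
    (Integrable.of_bound hW.aestronglyMeasurable C (ae_of_all _ hC)).norm
  have i2 : Integrable (fun ω => ‖W ω‖ ^ 2) P := by
    refine Integrable.of_bound (hW.norm.pow 2).aestronglyMeasurable (C ^ 2) (ae_of_all _ fun ω => ?_)
    rw [norm_pow, norm_norm]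
    gcongr
    exact hC ω
  set m := ∫ ω, ‖W ω‖ ∂P with hm
  have h : 0 ≤ ∫ ω, (‖W ω‖ ^ 2 - (2 * m) * ‖W ω‖ + m ^ 2) ∂P :=
    integral_nonneg fun ω => by
      have := sq_nonneg (‖W ω‖ - m)
      simp only [Pi.zero_apply]
      linarith
  have i3 : Integrable (fun ω => 2 * m * ‖W ω‖) P := i1.const_mul _
  have i4 : Integrable (fun ω => ‖W ω‖ ^ 2 - 2 * m * ‖W ω‖) P := i2.sub i3
  rw [integral_add i4 (integrable_const _), integral_sub i2 i3, integral_const_mul, ← hm] at h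
  simp at h
  linarith

/-- The phase `exp (i θ (L(r,y) - L(r,y')))` of a vertical increment of the sheet along the line at
`r`, as a function of a pair of points with ordinates `y`, `y'`. -/
noncomputable def verticalPhase {Ω : Type*} (L : ℝ≥0 → ℝ≥0 → Ω → ℝ) (θ : ℝ) (r : ℝ≥0)
    (u : (ℝ × ℝ) × (ℝ × ℝ)) (ω : Ω) : ℂ :=
  Complex.exp (Complex.I * ((θ * (L r u.1.2.toNNReal ω - L r u.2.2.toNNReal ω) : ℝ) : ℂ))

/-- The phase of the difference of two increments of the sheet to the right of the line at `r`. -/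
noncomputable def rightPhase {Ω : Type*} (L : ℝ≥0 → ℝ≥0 → Ω → ℝ) (θ : ℝ) (r : ℝ≥0)
    (u : (ℝ × ℝ) × (ℝ × ℝ)) (ω : Ω) : ℂ :=
  Complex.exp (Complex.I *
    ((θ * (L u.1.1.toNNReal u.1.2.toNNReal ω - L r u.1.2.toNNReal ω) +
      -θ * (L u.2.1.toNNReal u.2.2.toNNReal ω - L r u.2.2.toNNReal ω) : ℝ) : ℂ))

theorem norm_exp_I_mul_ofReal (a : ℝ) : ‖Complex.exp (Complex.I * (a : ℂ))‖ = 1 := by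
  rw [mul_comm, Complex.norm_exp_ofReal_mul_I]

theorem sheetPhase_mul_conj {Ω : Type*} (L : ℝ≥0 → ℝ≥0 → Ω → ℝ) (θ : ℝ) (r : ℝ≥0)
    (u : (ℝ × ℝ) × (ℝ × ℝ)) (ω : Ω) :
    sheetPhase L θ u.1 ω * (starRingEnd ℂ) (sheetPhase L θ u.2 ω) =
      verticalPhase L θ r u ω * rightPhase L θ r u ω := by
  rw [conj_sheetPhase, sheetPhase, verticalPhase, rightPhase, ← Complex.exp_add, ← Complex.exp_add]
  congr 1
  push_cast
  ring

section Measurability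

variable {Ω : Type*} [MeasurableSpace Ω] {L : ℝ≥0 → ℝ≥0 → Ω → ℝ}

theorem measurable_sheet_comp
    (hmeas : Measurable fun p : (ℝ≥0 × ℝ≥0) × Ω => L p.1.1 p.1.2 p.2) {α : Type*}
    [MeasurableSpace α] {f g : α → ℝ≥0} {h : α → Ω} (hf : Measurable f) (hg : Measurable g)
    (hh : Measurable h) : Measurable fun p => L (f p) (g p) (h p) :=
  hmeas.comp ((hf.prodMk hg).prodMk hh)

theorem measurable_verticalPhase
    (hmeas : Measurable fun p : (ℝ≥0 × ℝ≥0) × Ω => L p.1.1 p.1.2 p.2) (θ : ℝ) (r : ℝ≥0) :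
    Measurable fun p : Ω × ((ℝ × ℝ) × (ℝ × ℝ)) => verticalPhase L θ r p.2 p.1 := by
  have h1 : Measurable fun p : Ω × ((ℝ × ℝ) × (ℝ × ℝ)) => L r p.2.1.2.toNNReal p.1 :=
    measurable_sheet_comp hmeas measurable_const (by fun_prop) measurable_fst
  have h2 : Measurable fun p : Ω × ((ℝ × ℝ) × (ℝ × ℝ)) => L r p.2.2.2.toNNReal p.1 :=
    measurable_sheet_comp hmeas measurable_const (by fun_prop) measurable_fst
  exact Complex.measurable_exp.comp
    ((Complex.measurable_ofReal.comp ((h1.sub h2).const_mul θ)).const_mul Complex.I)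

theorem measurable_rightPhase
    (hmeas : Measurable fun p : (ℝ≥0 × ℝ≥0) × Ω => L p.1.1 p.1.2 p.2) (θ : ℝ) (r : ℝ≥0) :
    Measurable fun p : Ω × ((ℝ × ℝ) × (ℝ × ℝ)) => rightPhase L θ r p.2 p.1 := by
  have h1 : Measurable fun p : Ω × ((ℝ × ℝ) × (ℝ × ℝ)) => L r p.2.1.2.toNNReal p.1 :=
    measurable_sheet_comp hmeas measurable_const (by fun_prop) measurable_fst
  have h2 : Measurable fun p : Ω × ((ℝ × ℝ) × (ℝ × ℝ)) => L r p.2.2.2.toNNReal p.1 :=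
    measurable_sheet_comp hmeas measurable_const (by fun_prop) measurable_fst
  have h3 : Measurable fun p : Ω × ((ℝ × ℝ) × (ℝ × ℝ)) =>
      L p.2.1.1.toNNReal p.2.1.2.toNNReal p.1 :=
    measurable_sheet_comp hmeas (by fun_prop) (by fun_prop) measurable_fst
  have h4 : Measurable fun p : Ω × ((ℝ × ℝ) × (ℝ × ℝ)) =>
      L p.2.2.1.toNNReal p.2.2.2.toNNReal p.1 :=
    measurable_sheet_comp hmeas (by fun_prop) (by fun_prop) measurable_fst
  exact Complex.measurable_exp.comp
    ((Complex.measurable_ofReal.comp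
      (((h3.sub h1).const_mul θ).add ((h4.sub h2).const_mul (-θ)))).const_mul Complex.I)

theorem measurable_blockIntegral
    (hmeas : Measurable fun p : (ℝ≥0 × ℝ≥0) × Ω => L p.1.1 p.1.2 p.2) (θ s s' t t' : ℝ) :
    StronglyMeasurable (blockIntegral L θ s s' t t') := by
  have hgm : Measurable fun p : Ω × (ℝ × ℝ) =>
      (blockWeight s s' t t' p.2 : ℂ) * sheetPhase L θ p.2 p.1 :=
    (Complex.measurable_ofReal.comp (measurable_blockWeight.comp measurable_snd)).mul
      (measurable_sheetPhase hmeas θ)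
  exact hgm.stronglyMeasurable.integral_prod_right'

omit [MeasurableSpace Ω] in
theorem norm_blockIntegral_le {θ s s' t t' R : ℝ} (hs : 0 ≤ s) (ht : 0 ≤ t) (hR : 0 ≤ R)
    (hs' : s' ≤ R) (ht' : t' ≤ R) (ω : Ω) :
    ‖blockIntegral L θ s s' t t' ω‖ ≤ R * (blockMeasure s s' t t').real univ := by
  refine norm_integral_le_of_norm_le_const (ae_of_all _ fun z => ?_)
  rw [norm_mul, norm_sheetPhase, mul_one, Complex.norm_real,
    Real.norm_of_nonneg (blockWeight_nonneg z)]
  exact blockWeight_le hs ht hR hs' ht' z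

end Measurability

namespace IsLevySheet

variable {Ω : Type*} [MeasurableSpace Ω] {P : Measure Ω} [IsProbabilityMeasure P]
  {L : ℝ≥0 → ℝ≥0 → Ω → ℝ} {Ψ : ℝ → ℂ} {θ s s' t t' : ℝ}

/-- The square of a block integral is asymptotically orthogonal to the past: the double phase
`L(z) + L(z')` puts weight `2θ` on the whole rectangle `(r,s] × (0,t]`. -/
theorem norm_integral_mul_sq_le (hL : IsLevySheet P L Ψ)
    (hmeas : Measurable fun p : (ℝ≥0 × ℝ≥0) × Ω => L p.1.1 p.1.2 p.2) {r : ℝ≥0} (hrs : r ≤ s)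
    (ht : 0 ≤ t) (hss' : s ≤ s') (htt' : t ≤ t') {R : ℝ} (hs' : s' ≤ R) (ht' : t' ≤ R)
    {F : Ω → ℂ} (hF : AEStronglyMeasurable[leftSigma L r] F P) {C : ℝ} (hC0 : 0 ≤ C)
    (hC : ∀ ω, ‖F ω‖ ≤ C) :
    ‖∫ ω, F ω * blockIntegral L θ s s' t t' ω ^ 2 ∂P‖ ≤
      R ^ 2 * C * Real.exp (-((Ψ (2 * θ)).re * (s - r)) * t) * ((s' - s) * (t' - t)) ^ 2 := by
  have hs : 0 ≤ s := r.coe_nonneg.trans hrs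
  have hR : 0 ≤ R := hs.trans (hss'.trans hs')
  set ν := blockMeasure s s' t t' with hν
  set g : Ω → ℝ × ℝ → ℂ := fun ω z => (blockWeight s s' t t' z : ℂ) * sheetPhase L θ z ω with hg
  have hgm : Measurable (Function.uncurry g) :=
    (Complex.measurable_ofReal.comp (measurable_blockWeight.comp measurable_snd)).mul
      (measurable_sheetPhase hmeas θ)
  have hgb : ∀ ω z, ‖g ω z‖ ≤ R := fun ω z => by
    rw [hg, norm_mul, norm_sheetPhase, mul_one, Complex.norm_real,
      Real.norm_of_nonneg (blockWeight_nonneg z)]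
    exact blockWeight_le hs ht hR hs' ht' z
  have hFm : AEStronglyMeasurable F P := hF.mono (hL.leftSigma_le r)
  have hexp : ∀ ω, F ω * blockIntegral L θ s s' t t' ω ^ 2 =
      ∫ u : (ℝ × ℝ) × (ℝ × ℝ), F ω * (g ω u.1 * g ω u.2) ∂(ν.prod ν) := by
    intro ω
    rw [integral_const_mul, integral_prod_mul, sq]
    rfl
  have hint : Integrable (Function.uncurry fun ω (u : (ℝ × ℝ) × (ℝ × ℝ)) =>
      F ω * (g ω u.1 * g ω u.2)) (P.prod (ν.prod ν)) := by
    refine Integrable.of_bound (C := C * (R * R)) ?_ (ae_of_all _ fun p => ?_)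
    · refine hFm.comp_fst.mul (Measurable.aestronglyMeasurable ?_)
      exact (hgm.comp (f := fun p : Ω × ((ℝ × ℝ) × (ℝ × ℝ)) => (p.1, p.2.1)) (by fun_prop)).mul
        (hgm.comp (f := fun p : Ω × ((ℝ × ℝ) × (ℝ × ℝ)) => (p.1, p.2.2)) (by fun_prop))
    · simp only [Function.uncurry, norm_mul]
      gcongr
      · exact hC _
      · exact hgb _ _
      · exact hgb _ _
  simp_rw [hexp]
  rw [integral_integral_swap hint]
  have hbound : ∀ u : (ℝ × ℝ) × (ℝ × ℝ), ‖∫ ω, F ω * (g ω u.1 * g ω u.2) ∂P‖ ≤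
      R ^ 2 * C * Real.exp (-((Ψ (2 * θ)).re * (s - r)) * t) := by
    intro u
    have e : ∀ ω, F ω * (g ω u.1 * g ω u.2) =
        ((blockWeight s s' t t' u.1 * blockWeight s s' t t' u.2 : ℝ) : ℂ) *
        ((F ω * Complex.exp (Complex.I *
          ((θ * (L r u.1.2.toNNReal ω + L r u.2.2.toNNReal ω) : ℝ) : ℂ))) *
        Complex.exp (Complex.I *
          ((θ * (L u.1.1.toNNReal u.1.2.toNNReal ω - L r u.1.2.toNNReal ω) +
          θ * (L u.2.1.toNNReal u.2.2.toNNReal ω - L r u.2.2.toNNReal ω) : ℝ) : ℂ))) := by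
      intro ω
      have : sheetPhase L θ u.1 ω * sheetPhase L θ u.2 ω = Complex.exp (Complex.I *
          ((θ * (L r u.1.2.toNNReal ω + L r u.2.2.toNNReal ω) : ℝ) : ℂ)) *
          Complex.exp (Complex.I *
          ((θ * (L u.1.1.toNNReal u.1.2.toNNReal ω - L r u.1.2.toNNReal ω) +
          θ * (L u.2.1.toNNReal u.2.2.toNNReal ω - L r u.2.2.toNNReal ω) : ℝ) : ℂ)) := by
        rw [sheetPhase, sheetPhase, ← Complex.exp_add, ← Complex.exp_add]
        congr 1
        push_cast
        ring
      rw [mul_assoc (F ω), ← this]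
      simp only [hg]
      push_cast
      ring
    simp_rw [e]
    rw [integral_const_mul, norm_mul, Complex.norm_real, Real.norm_of_nonneg
      (mul_nonneg (blockWeight_nonneg _) (blockWeight_nonneg _))]
    by_cases h1 : u.1 ∈ Ioo s s' ×ˢ Ioo t t'
    swap
    · rw [blockWeight_of_notMem h1]; simp only [zero_mul]; positivity
    by_cases h2 : u.2 ∈ Ioo s s' ×ˢ Ioo t t'
    swap
    · rw [blockWeight_of_notMem h2]; simp only [zero_mul, mul_zero]; positivity
    have hrs' : r ≤ s.toNNReal := NNReal.le_toNNReal_of_coe_le hrs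
    have x1 : s.toNNReal ≤ u.1.1.toNNReal := Real.toNNReal_le_toNNReal h1.1.1.le
    have x2 : s.toNNReal ≤ u.2.1.toNNReal := Real.toNNReal_le_toNNReal h2.1.1.le
    have y1 : t.toNNReal ≤ u.1.2.toNNReal := Real.toNNReal_le_toNNReal h1.2.1.le
    have y2 : t.toNNReal ≤ u.2.2.toNNReal := Real.toNNReal_le_toNNReal h2.2.1.le
    have hV : Measurable[leftSigma L r] fun ω => Complex.exp (Complex.I *
          ((θ * (L r u.1.2.toNNReal ω + L r u.2.2.toNNReal ω) : ℝ) : ℂ)) :=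
      Complex.measurable_exp.comp ((Complex.measurable_ofReal.comp
        (((measurable_leftSigma L le_rfl _).add
          (measurable_leftSigma L le_rfl _)).const_mul θ)).const_mul Complex.I)
    have hFV : AEStronglyMeasurable[leftSigma L r] (fun ω => F ω * Complex.exp (Complex.I *
          ((θ * (L r u.1.2.toNNReal ω + L r u.2.2.toNNReal ω) : ℝ) : ℂ))) P :=
      hF.mul hV.stronglyMeasurable.aestronglyMeasurable
    rw [hL.integral_mul_exp_right (hrs'.trans x1) (hrs'.trans x2) _ _ _ _ hFV, norm_mul]
    have b1 : ‖∫ ω, F ω * Complex.exp (Complex.I *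
          ((θ * (L r u.1.2.toNNReal ω + L r u.2.2.toNNReal ω) : ℝ) : ℂ)) ∂P‖ ≤ C := by
      refine (norm_integral_le_of_norm_le_const (C := C) (ae_of_all _ fun ω => ?_)).trans_eq
        (by simp)
      rw [norm_mul, norm_exp_I_mul_ofReal, mul_one]
      exact hC ω
    have b2 := hL.norm_charFun_strip_add_le θ hrs' x1 x2 y1 y2
    rw [Real.coe_toNNReal _ hs, Real.coe_toNNReal _ ht] at b2
    simp only [mul_add] at b2
    calc _ ≤ (R * R) * (C * Real.exp (-((Ψ (2 * θ)).re * (s - r)) * t)) := by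
          gcongr
          · exact blockWeight_nonneg _
          · exact blockWeight_le hs ht hR hs' ht' _
          · exact blockWeight_le hs ht hR hs' ht' _
      _ = _ := by ring
  refine (norm_integral_le_of_norm_le_const (ae_of_all _ hbound)).trans_eq ?_
  rw [← univ_prod_univ, measureReal_prod_prod, hν, blockMeasure_real_univ hss' htt']
  ring

/-- Covariance of two vertical phases: it vanishes when the two intervals of ordinates do not
overlap, and overlapping intervals have close endpoints. -/
theorem norm_covariance_verticalPhase_le (hL : IsLevySheet P L Ψ) (r : ℝ≥0) {κ : ℝ} (hκ : 0 ≤ κ)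
    (u u' : (ℝ × ℝ) × (ℝ × ℝ)) :
    ‖∫ ω, (verticalPhase L θ r u ω - ∫ ω', verticalPhase L θ r u ω' ∂P) *
      (starRingEnd ℂ) (verticalPhase L θ r u' ω - ∫ ω', verticalPhase L θ r u' ω' ∂P) ∂P‖ ≤
      4 * Real.exp (κ * (|u.1.2 - u.2.2| + |u'.1.2 - u'.2.2| - |u.1.2 - u'.1.2|)) := by
  have hm : ∀ v : (ℝ × ℝ) × (ℝ × ℝ), Measurable (verticalPhase L θ r v) := fun v =>
    Complex.measurable_exp.comp ((Complex.measurable_ofReal.comp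
      (((hL.measurable _ _).sub (hL.measurable _ _)).const_mul θ)).const_mul Complex.I)
  have hn : ∀ (v : (ℝ × ℝ) × (ℝ × ℝ)) ω, ‖verticalPhase L θ r v ω‖ = 1 := fun v ω =>
    norm_exp_I_mul_ofReal _
  have hi : ∀ v : (ℝ × ℝ) × (ℝ × ℝ), Integrable (verticalPhase L θ r v) P := fun v =>
    integrable_of_measurable_of_norm_le (hm v) (fun ω => (hn v ω).le)
  set c := ∫ ω', verticalPhase L θ r u ω' ∂P with hc
  set c' := ∫ ω', verticalPhase L θ r u' ω' ∂P with hc'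
  have hcn : ∀ v : (ℝ × ℝ) × (ℝ × ℝ), ‖∫ ω', verticalPhase L θ r v ω' ∂P‖ ≤ 1 := fun v =>
    (norm_integral_le_of_norm_le_const (C := 1) (ae_of_all _ fun ω => (hn v ω).le)).trans_eq
      (by simp)
  by_cases hsep : max u.1.2 u.2.2 ≤ min u'.1.2 u'.2.2 ∨ max u'.1.2 u'.2.2 ≤ min u.1.2 u.2.2
  · have hconj : ∀ ω, (starRingEnd ℂ) (verticalPhase L θ r u' ω) = Complex.exp (Complex.I *
        ((θ * (L r u'.2.2.toNNReal ω - L r u'.1.2.toNNReal ω) : ℝ) : ℂ)) := by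
      intro ω
      rw [verticalPhase, ← Complex.exp_conj]
      congr 1
      simp
      ring
    have hiconj : Integrable (fun ω => (starRingEnd ℂ) (verticalPhase L θ r u' ω)) P :=
      integrable_of_measurable_of_norm_le (Complex.continuous_conj.measurable.comp (hm u'))
        (C := 1) (fun ω => by rw [RCLike.norm_conj, hn])
    have himul : Integrable (fun ω => verticalPhase L θ r u ω *
        (starRingEnd ℂ) (verticalPhase L θ r u' ω)) P :=
      integrable_of_measurable_of_norm_le
        ((hm u).mul (Complex.continuous_conj.measurable.comp (hm u')))
        (C := 1) (fun ω => by rw [norm_mul, RCLike.norm_conj, hn, hn, one_mul])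
    have hsep' : max u.1.2.toNNReal u.2.2.toNNReal ≤ min u'.1.2.toNNReal u'.2.2.toNNReal ∨
        max u'.1.2.toNNReal u'.2.2.toNNReal ≤ min u.1.2.toNNReal u.2.2.toNNReal := by
      have hmono : Monotone Real.toNNReal := fun _ _ h => Real.toNNReal_le_toNNReal h
      rw [← hmono.map_max, ← hmono.map_min, ← hmono.map_max, ← hmono.map_min]
      exact hsep.imp (fun h => hmono h) (fun h => hmono h)
    have key := hL.charFun_vertical_mul θ r hsep'
    simp_rw [← hconj] at key
    rw [integral_conj] at key
    have key' : ∫ ω, verticalPhase L θ r u ω * (starRingEnd ℂ) (verticalPhase L θ r u' ω) ∂P =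
        c * (starRingEnd ℂ) c' := key
    have e : ∀ ω, (verticalPhase L θ r u ω - c) * (starRingEnd ℂ) (verticalPhase L θ r u' ω - c') =
        verticalPhase L θ r u ω * (starRingEnd ℂ) (verticalPhase L θ r u' ω) -
        verticalPhase L θ r u ω * (starRingEnd ℂ) c' -
        (c * (starRingEnd ℂ) (verticalPhase L θ r u' ω) - c * (starRingEnd ℂ) c') := by
      intro ω
      rw [map_sub]
      ring
    have hzero : ∫ ω, (verticalPhase L θ r u ω - c) *
        (starRingEnd ℂ) (verticalPhase L θ r u' ω - c') ∂P = 0 := by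
      have a0 : Integrable (fun ω => verticalPhase L θ r u ω * (starRingEnd ℂ) c') P :=
        (hi u).mul_const _
      have a1 : Integrable (fun ω => verticalPhase L θ r u ω *
          (starRingEnd ℂ) (verticalPhase L θ r u' ω) -
          verticalPhase L θ r u ω * (starRingEnd ℂ) c') P := himul.sub a0
      have a2 : Integrable (fun ω => c * (starRingEnd ℂ) (verticalPhase L θ r u' ω)) P :=
        hiconj.const_mul c
      have a3 : Integrable (fun ω => c * (starRingEnd ℂ) (verticalPhase L θ r u' ω) -
          c * (starRingEnd ℂ) c') P := a2.sub (integrable_const _)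
      simp_rw [e]
      rw [integral_sub a1 a3, integral_sub himul a0, integral_sub a2 (integrable_const _),
        integral_mul_const, integral_const_mul, integral_conj, key']
      simp [← hc, ← hc']
    rw [hzero, norm_zero]
    positivity
  · have hnear : |u.1.2 - u'.1.2| ≤ |u.1.2 - u.2.2| + |u'.1.2 - u'.2.2| := by
      simp only [max_le_iff, le_min_iff] at hsep
      grind
    have h1 : (1 : ℝ) ≤ Real.exp (κ * (|u.1.2 - u.2.2| + |u'.1.2 - u'.2.2| - |u.1.2 - u'.1.2|)) :=
      Real.one_le_exp (mul_nonneg hκ (by linarith))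
    have h2 : ∀ v ω, ‖verticalPhase L θ r v ω - ∫ ω', verticalPhase L θ r v ω' ∂P‖ ≤ 2 := by
      intro v ω
      refine (norm_sub_le _ _).trans ?_
      linarith [hn v ω, hcn v]
    have h3 : ‖∫ ω, (verticalPhase L θ r u ω - c) *
        (starRingEnd ℂ) (verticalPhase L θ r u' ω - c') ∂P‖ ≤ 4 := by
      refine (norm_integral_le_of_norm_le_const (C := 4) (ae_of_all _ fun ω => ?_)).trans_eq
        (by simp)
      rw [norm_mul, RCLike.norm_conj]
      nlinarith [h2 u ω, h2 u' ω, norm_nonneg (verticalPhase L θ r u ω - c),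
        norm_nonneg (verticalPhase L θ r u' ω - c')]
    linarith

end IsLevySheet

namespace IsLevySheet

variable {Ω : Type*} [MeasurableSpace Ω] {P : Measure Ω} [IsProbabilityMeasure P]
  {L : ℝ≥0 → ℝ≥0 → Ω → ℝ} {Ψ : ℝ → ℂ} {θ s s' t t' : ℝ}

/-- The increments to the right of `r` of two points of the block have decorrelated phases unless the
points are close. -/
theorem norm_integral_rightPhase_le (hL : IsLevySheet P L Ψ) {r : ℝ≥0} (hrs : r ≤ s) (ht : 0 ≤ t)
    {κ : ℝ} (hκ₁ : 2 * κ ≤ (Ψ θ).re * t) (hκ₂ : 2 * κ ≤ (Ψ θ).re * (s - r))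
    {u : (ℝ × ℝ) × (ℝ × ℝ)} (h1 : u.1 ∈ Ioo s s' ×ˢ Ioo t t') (h2 : u.2 ∈ Ioo s s' ×ˢ Ioo t t') :
    ‖∫ ω, rightPhase L θ r u ω ∂P‖ ≤
      Real.exp (-(2 * κ) * |u.1.1 - u.2.1|) * Real.exp (-(2 * κ) * |u.1.2 - u.2.2|) := by
  have hs : 0 ≤ s := r.coe_nonneg.trans hrs
  have hrs' : r ≤ s.toNNReal := NNReal.le_toNNReal_of_coe_le hrs
  have x1 : s.toNNReal ≤ u.1.1.toNNReal := Real.toNNReal_le_toNNReal h1.1.1.le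
  have x2 : s.toNNReal ≤ u.2.1.toNNReal := Real.toNNReal_le_toNNReal h2.1.1.le
  have y1 : t.toNNReal ≤ u.1.2.toNNReal := Real.toNNReal_le_toNNReal h1.2.1.le
  have y2 : t.toNNReal ≤ u.2.2.toNNReal := Real.toNNReal_le_toNNReal h2.2.1.le
  have b := hL.norm_charFun_strip_sub_le θ hrs' x1 x2 y1 y2
  rw [Real.coe_toNNReal _ hs, Real.coe_toNNReal _ ht, Real.coe_toNNReal _ (hs.trans h1.1.1.le),
    Real.coe_toNNReal _ (hs.trans h2.1.1.le), Real.coe_toNNReal _ (ht.trans h1.2.1.le),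
    Real.coe_toNNReal _ (ht.trans h2.2.1.le)] at b
  have e : ∀ ω, rightPhase L θ r u ω = Complex.exp (Complex.I * ((θ *
      ((L u.1.1.toNNReal u.1.2.toNNReal ω - L r u.1.2.toNNReal ω) -
        (L u.2.1.toNNReal u.2.2.toNNReal ω - L r u.2.2.toNNReal ω)) : ℝ) : ℂ)) := by
    intro ω
    rw [rightPhase]
    congr 3
    ring
  simp_rw [e]
  refine b.trans ?_
  gcongr

/-- The squared modulus of a block integral is asymptotically uncorrelated with the past. Given the
past, its conditional expectation is an integral of vertical phases, whose fluctuations average out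
because vertical phases over disjoint intervals are independent. -/
theorem sq_norm_integral_mul_normSq_sub_le (hL : IsLevySheet P L Ψ)
    (hmeas : Measurable fun p : (ℝ≥0 × ℝ≥0) × Ω => L p.1.1 p.1.2 p.2) {r : ℝ≥0} (hrs : r ≤ s)
    (ht : 0 ≤ t) (hss' : s ≤ s') (htt' : t ≤ t') {R : ℝ} (hs' : s' ≤ R) (ht' : t' ≤ R)
    {κ : ℝ} (hκ : 0 < κ) (hκ₁ : 2 * κ ≤ (Ψ θ).re * t) (hκ₂ : 2 * κ ≤ (Ψ θ).re * (s - r))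
    {F : Ω → ℂ} (hF : AEStronglyMeasurable[leftSigma L r] F P) {C : ℝ} (hC0 : 0 ≤ C)
    (hC : ∀ ω, ‖F ω‖ ≤ C) :
    ‖∫ ω, F ω * (blockIntegral L θ s s' t t' ω *
        (starRingEnd ℂ) (blockIntegral L θ s s' t t' ω)) ∂P -
      (∫ ω, F ω ∂P) * ∫ ω, blockIntegral L θ s s' t t' ω *
        (starRingEnd ℂ) (blockIntegral L θ s s' t t' ω) ∂P‖ ^ 2 ≤
      C ^ 2 * (4 * R ^ 4 * ((s' - s) ^ 2 * (t' - t) * (2 / κ) ^ 5)) := by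
  have hs : 0 ≤ s := r.coe_nonneg.trans hrs
  have hR : 0 ≤ R := hs.trans (hss'.trans hs')
  set ν := blockMeasure s s' t t' with hν
  set g : Ω → ℝ × ℝ → ℂ := fun ω z => (blockWeight s s' t t' z : ℂ) * sheetPhase L θ z ω with hg
  have hgm : Measurable (Function.uncurry g) :=
    (Complex.measurable_ofReal.comp (measurable_blockWeight.comp measurable_snd)).mul
      (measurable_sheetPhase hmeas θ)
  have hgb : ∀ ω z, ‖g ω z‖ ≤ R := fun ω z => by
    rw [hg, norm_mul, norm_sheetPhase, mul_one, Complex.norm_real,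
      Real.norm_of_nonneg (blockWeight_nonneg z)]
    exact blockWeight_le hs ht hR hs' ht' z
  set w : (ℝ × ℝ) × (ℝ × ℝ) → ℝ := fun u =>
    blockWeight s s' t t' u.1 * blockWeight s s' t t' u.2 with hw
  have hwm : Measurable w := (measurable_blockWeight.comp measurable_fst).mul
    (measurable_blockWeight.comp measurable_snd)
  have hw0 : ∀ u, 0 ≤ w u := fun u => mul_nonneg (blockWeight_nonneg _) (blockWeight_nonneg _)
  have hwR : ∀ u, w u ≤ R ^ 2 := fun u => by
    rw [sq]
    exact mul_le_mul (blockWeight_le hs ht hR hs' ht' _) (blockWeight_le hs ht hR hs' ht' _)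
      (blockWeight_nonneg _) hR
  set V : (ℝ × ℝ) × (ℝ × ℝ) → Ω → ℂ := verticalPhase L θ r with hV
  set D : (ℝ × ℝ) × (ℝ × ℝ) → Ω → ℂ := rightPhase L θ r with hD
  have hVn : ∀ u ω, ‖V u ω‖ = 1 := fun u ω => norm_exp_I_mul_ofReal _
  have hDn : ∀ u ω, ‖D u ω‖ = 1 := fun u ω => norm_exp_I_mul_ofReal _
  have hVm : Measurable fun p : Ω × ((ℝ × ℝ) × (ℝ × ℝ)) => V p.2 p.1 :=
    measurable_verticalPhase hmeas θ r
  have hDm : Measurable fun p : Ω × ((ℝ × ℝ) × (ℝ × ℝ)) => D p.2 p.1 :=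
    measurable_rightPhase hmeas θ r
  set v : (ℝ × ℝ) × (ℝ × ℝ) → ℂ := fun u => ∫ ω, V u ω ∂P with hv
  set χ : (ℝ × ℝ) × (ℝ × ℝ) → ℂ := fun u => ∫ ω, D u ω ∂P with hχ
  have hvm : Measurable v := (hVm.stronglyMeasurable.integral_prod_left').measurable
  have hχm : Measurable χ := (hDm.stronglyMeasurable.integral_prod_left').measurable
  have hvn : ∀ u, ‖v u‖ ≤ 1 := fun u =>
    (norm_integral_le_of_norm_le_const (C := 1) (ae_of_all _ fun ω => (hVn u ω).le)).trans_eq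
      (by simp)
  have hχn : ∀ u, ‖χ u‖ ≤ 1 := fun u =>
    (norm_integral_le_of_norm_le_const (C := 1) (ae_of_all _ fun ω => (hDn u ω).le)).trans_eq
      (by simp)
  -- the second moment against a bounded functional of the past
  have hA : ∀ F : Ω → ℂ, AEStronglyMeasurable[leftSigma L r] F P → (∃ C, ∀ ω, ‖F ω‖ ≤ C) →
      ∫ ω, F ω * (blockIntegral L θ s s' t t' ω *
        (starRingEnd ℂ) (blockIntegral L θ s s' t t' ω)) ∂P =
      ∫ u, (w u : ℂ) * χ u * ∫ ω, F ω * V u ω ∂P ∂(ν.prod ν) := by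
    rintro F hF ⟨C, hC⟩
    have hFm : AEStronglyMeasurable F P := hF.mono (hL.leftSigma_le r)
    have hexp : ∀ ω, F ω * (blockIntegral L θ s s' t t' ω *
        (starRingEnd ℂ) (blockIntegral L θ s s' t t' ω)) =
        ∫ u : (ℝ × ℝ) × (ℝ × ℝ), F ω * (g ω u.1 * (starRingEnd ℂ) (g ω u.2)) ∂(ν.prod ν) := by
      intro ω
      rw [integral_const_mul, integral_prod_mul (g ω) (fun z => (starRingEnd ℂ) (g ω z)),
        integral_conj]
      rfl
    have hint : Integrable (Function.uncurry fun ω (u : (ℝ × ℝ) × (ℝ × ℝ)) =>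
        F ω * (g ω u.1 * (starRingEnd ℂ) (g ω u.2))) (P.prod (ν.prod ν)) := by
      refine Integrable.of_bound (C := C * (R * R)) ?_ (ae_of_all _ fun p => ?_)
      · refine hFm.comp_fst.mul (Measurable.aestronglyMeasurable ?_)
        exact (hgm.comp (f := fun p : Ω × ((ℝ × ℝ) × (ℝ × ℝ)) => (p.1, p.2.1)) (by fun_prop)).mul
          (Complex.continuous_conj.measurable.comp (hgm.comp
            (f := fun p : Ω × ((ℝ × ℝ) × (ℝ × ℝ)) => (p.1, p.2.2)) (by fun_prop)))
      · simp only [Function.uncurry, norm_mul, RCLike.norm_conj]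
        exact mul_le_mul (hC _) (mul_le_mul (hgb _ _) (hgb _ _) (norm_nonneg _) hR) (by positivity)
          ((norm_nonneg _).trans (hC p.1))
    simp_rw [hexp]
    rw [integral_integral_swap hint]
    refine integral_congr_ae (ae_of_all _ fun u => ?_)
    have e : ∀ ω, F ω * (g ω u.1 * (starRingEnd ℂ) (g ω u.2)) =
        (w u : ℂ) * ((F ω * V u ω) * D u ω) := by
      intro ω
      rw [mul_assoc (F ω), hV, hD, ← sheetPhase_mul_conj]
      simp only [hg, hw, map_mul, Complex.conj_ofReal]
      push_cast
      ring
    simp only [e]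
    rw [integral_const_mul]
    by_cases h1 : u.1 ∈ Ioo s s' ×ˢ Ioo t t'
    swap
    · simp only [hw, blockWeight_of_notMem h1]; simp
    by_cases h2 : u.2 ∈ Ioo s s' ×ˢ Ioo t t'
    swap
    · simp only [hw, blockWeight_of_notMem h2]; simp
    have x1 : r ≤ u.1.1.toNNReal := NNReal.le_toNNReal_of_coe_le (hrs.trans h1.1.1.le)
    have x2 : r ≤ u.2.1.toNNReal := NNReal.le_toNNReal_of_coe_le (hrs.trans h2.1.1.le)
    have hVu : Measurable[leftSigma L r] (V u) :=
      Complex.measurable_exp.comp ((Complex.measurable_ofReal.comp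
        (((measurable_leftSigma L le_rfl _).sub
          (measurable_leftSigma L le_rfl _)).const_mul θ)).const_mul Complex.I)
    have hFV : AEStronglyMeasurable[leftSigma L r] (fun ω => F ω * V u ω) P :=
      hF.mul hVu.stronglyMeasurable.aestronglyMeasurable
    have key := hL.integral_mul_exp_right x1 x2 u.1.2.toNNReal u.2.2.toNNReal θ (-θ) hFV
    have key' : ∫ ω, (F ω * V u ω) * D u ω ∂P = (∫ ω, F ω * V u ω ∂P) * χ u := key
    rw [key']
    ring
  have hFm : AEStronglyMeasurable F P := hF.mono (hL.leftSigma_le r)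
  have hFi : Integrable F P := Integrable.of_bound hFm C (ae_of_all _ hC)
  set q : (ℝ × ℝ) × (ℝ × ℝ) → Ω → ℂ := fun u ω => (w u : ℂ) * χ u * (V u ω - v u) with hq
  have hqm : Measurable fun p : Ω × ((ℝ × ℝ) × (ℝ × ℝ)) => q p.2 p.1 :=
    ((Complex.measurable_ofReal.comp (hwm.comp measurable_snd)).mul
      (hχm.comp measurable_snd)).mul (hVm.sub (hvm.comp measurable_snd))
  have hqb : ∀ u ω, ‖q u ω‖ ≤ R ^ 2 * 2 := by
    intro u ω
    have h2 : ‖V u ω - v u‖ ≤ 2 := (norm_sub_le _ _).trans (by linarith [hVn u ω, hvn u])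
    rw [hq, norm_mul, norm_mul, Complex.norm_real, Real.norm_of_nonneg (hw0 u)]
    calc w u * ‖χ u‖ * ‖V u ω - v u‖ ≤ R ^ 2 * 1 * 2 := by
          gcongr
          · exact hwR u
          · exact hχn u
      _ = R ^ 2 * 2 := by ring
  set W : Ω → ℂ := fun ω => ∫ u, q u ω ∂(ν.prod ν) with hW
  have hWm : StronglyMeasurable W := hqm.stronglyMeasurable.integral_prod_right'
  have hWb : ∀ ω, ‖W ω‖ ≤ R ^ 2 * 2 * (ν.prod ν).real univ := fun ω =>
    norm_integral_le_of_norm_le_const (ae_of_all _ fun u => hqb u ω)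
  have hdiff : ∫ ω, F ω * (blockIntegral L θ s s' t t' ω *
        (starRingEnd ℂ) (blockIntegral L θ s s' t t' ω)) ∂P -
      (∫ ω, F ω ∂P) * ∫ ω, blockIntegral L θ s s' t t' ω *
        (starRingEnd ℂ) (blockIntegral L θ s s' t t' ω) ∂P = ∫ ω, F ω * W ω ∂P := by
    have h1 := hA F hF ⟨C, hC⟩
    have h2 := hA (fun _ => 1) aestronglyMeasurable_const ⟨1, fun _ => by simp⟩
    simp only [one_mul] at h2
    have hi0 : ∀ (G : Ω → ℂ), AEStronglyMeasurable G P → (∃ C, ∀ ω, ‖G ω‖ ≤ C) →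
        Integrable (fun p : Ω × ((ℝ × ℝ) × (ℝ × ℝ)) => (w p.2 : ℂ) * χ p.2 * (G p.1 * V p.2 p.1))
          (P.prod (ν.prod ν)) := by
      rintro G hG ⟨C, hC⟩
      refine Integrable.of_bound (C := R ^ 2 * 1 * (C * 1)) ?_ (ae_of_all _ fun p => ?_)
      · exact (((Complex.measurable_ofReal.comp (hwm.comp measurable_snd)).mul
          (hχm.comp measurable_snd)).aestronglyMeasurable).mul
          (hG.comp_fst.mul hVm.aestronglyMeasurable)
      · rw [norm_mul, norm_mul, norm_mul, Complex.norm_real, Real.norm_of_nonneg (hw0 _), hVn]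
        have hCnn : 0 ≤ C := (norm_nonneg _).trans (hC p.1)
        gcongr
        · exact hwR _
        · exact hχn _
        · exact hC _
    have hi1 : Integrable (fun u => (w u : ℂ) * χ u * ∫ ω, F ω * V u ω ∂P) (ν.prod ν) := by
      have := (hi0 F hFm ⟨C, hC⟩).integral_prod_right
      simpa only [integral_const_mul] using this
    have hi2 : Integrable (fun u => (w u : ℂ) * χ u * ∫ ω, V u ω ∂P) (ν.prod ν) := by
      have := (hi0 (fun _ => 1) aestronglyMeasurable_const ⟨1, fun _ => by simp⟩).integral_prod_right
      simpa only [integral_const_mul, one_mul] using this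
    have hFW : ∀ ω, F ω * W ω = ∫ u, F ω * q u ω ∂(ν.prod ν) := fun ω => by
      rw [integral_const_mul]
    have hint : Integrable (Function.uncurry fun ω u => F ω * q u ω) (P.prod (ν.prod ν)) := by
      refine Integrable.of_bound (C := C * (R ^ 2 * 2))
        (hFm.comp_fst.mul hqm.aestronglyMeasurable) (ae_of_all _ fun p => ?_)
      simp only [Function.uncurry, norm_mul (F p.1)]
      gcongr
      · exact hC _
      · exact hqb _ _
    simp_rw [hFW]
    rw [integral_integral_swap hint, h1, h2, ← integral_const_mul, ← integral_sub hi1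
      (hi2.const_mul _)]
    refine integral_congr_ae (ae_of_all _ fun u => ?_)
    have e : ∀ ω, F ω * q u ω = (w u : ℂ) * χ u * (F ω * V u ω - F ω * v u) := fun ω => by
      simp only [hq]; ring
    have hFVi : Integrable (fun ω => F ω * V u ω) P :=
      hFi.mul_bdd (c := 1) (hVm.comp (measurable_prodMk_right (y := u))).aestronglyMeasurable
        (ae_of_all _ fun ω => (hVn u ω).le)
    simp only [e]
    rw [integral_const_mul, integral_sub hFVi (hFi.mul_const _), integral_mul_const]
    simp only [hv]
    ring
  rw [hdiff]
  -- variance of the averaged vertical phases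
  have hWW : ∫ ω, ‖W ω‖ ^ 2 ∂P ≤ 4 * R ^ 4 * ((s' - s) ^ 2 * (t' - t) * (2 / κ) ^ 5) := by
    set Q : Ω → ((ℝ × ℝ) × (ℝ × ℝ)) × ((ℝ × ℝ) × (ℝ × ℝ)) → ℂ := fun ω p =>
      q p.1 ω * (starRingEnd ℂ) (q p.2 ω) with hQ
    have hsq : ∀ ω, ‖W ω‖ ^ 2 = (∫ p, Q ω p ∂((ν.prod ν).prod (ν.prod ν))).re := by
      intro ω
      have : ∫ p, Q ω p ∂((ν.prod ν).prod (ν.prod ν)) = W ω * (starRingEnd ℂ) (W ω) := by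
        simp only [hQ]
        rw [integral_prod_mul (fun u => q u ω) (fun u => (starRingEnd ℂ) (q u ω)), integral_conj]
      rw [this, Complex.mul_conj, Complex.ofReal_re, Complex.normSq_eq_norm_sq]
    have hQm : Measurable (Function.uncurry Q) :=
      (hqm.comp (f := fun p : Ω × (((ℝ × ℝ) × (ℝ × ℝ)) × ((ℝ × ℝ) × (ℝ × ℝ))) => (p.1, p.2.1))
        (by fun_prop)).mul (Complex.continuous_conj.measurable.comp (hqm.comp
        (f := fun p : Ω × (((ℝ × ℝ) × (ℝ × ℝ)) × ((ℝ × ℝ) × (ℝ × ℝ))) => (p.1, p.2.2))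
        (by fun_prop)))
    have hQi : Integrable (Function.uncurry Q) (P.prod ((ν.prod ν).prod (ν.prod ν))) := by
      refine integrable_of_measurable_of_norm_le hQm (C := (R ^ 2 * 2) * (R ^ 2 * 2)) fun p => ?_
      change ‖q p.2.1 p.1 * (starRingEnd ℂ) (q p.2.2 p.1)‖ ≤ _
      rw [norm_mul, RCLike.norm_conj]
      exact mul_le_mul (hqb _ _) (hqb _ _) (norm_nonneg _) (by positivity)
    simp_rw [hsq]
    have hre : ∫ ω, (∫ p, Q ω p ∂((ν.prod ν).prod (ν.prod ν))).re ∂P =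
        (∫ ω, ∫ p, Q ω p ∂((ν.prod ν).prod (ν.prod ν)) ∂P).re := integral_re hQi.integral_prod_left
    rw [hre, integral_integral_swap hQi]
    refine (Complex.re_le_norm _).trans ?_
    have hχb : ∀ u, w u * ‖χ u‖ ≤ R ^ 2 *
        (Real.exp (-(2 * κ) * |u.1.1 - u.2.1|) * Real.exp (-(2 * κ) * |u.1.2 - u.2.2|)) := by
      intro u
      by_cases h1 : u.1 ∈ Ioo s s' ×ˢ Ioo t t'
      swap
      · simp only [hw, blockWeight_of_notMem h1, zero_mul]; positivity
      by_cases h2 : u.2 ∈ Ioo s s' ×ˢ Ioo t t'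
      swap
      · simp only [hw, blockWeight_of_notMem h2, zero_mul, mul_zero]; positivity
      exact mul_le_mul (hwR u) (hL.norm_integral_rightPhase_le hrs ht hκ₁ hκ₂ h1 h2) (norm_nonneg _)
        (by positivity)
    set K : ((ℝ × ℝ) × (ℝ × ℝ)) × ((ℝ × ℝ) × (ℝ × ℝ)) → ℝ := fun p =>
      (Real.exp (-κ * |p.1.1.1 - p.1.2.1|) * Real.exp (-κ * |p.1.1.2 - p.1.2.2|)) *
      ((Real.exp (-κ * |p.2.1.1 - p.2.2.1|) * Real.exp (-κ * |p.2.1.2 - p.2.2.2|)) *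
      Real.exp (-κ * |p.1.1.2 - p.2.1.2|)) with hK
    have hbound : ∀ p, ‖∫ ω, Q ω p ∂P‖ ≤ 4 * R ^ 4 * K p := by
      intro p
      have e : ∀ ω, Q ω p = ((w p.1 : ℂ) * χ p.1 * (starRingEnd ℂ) ((w p.2 : ℂ) * χ p.2)) *
          ((V p.1 ω - v p.1) * (starRingEnd ℂ) (V p.2 ω - v p.2)) := by
        intro ω
        simp only [hQ, hq, map_mul]
        ring
      simp_rw [e]
      rw [integral_const_mul, norm_mul, norm_mul, norm_mul, RCLike.norm_conj, norm_mul,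
        Complex.norm_real, Complex.norm_real, Real.norm_of_nonneg (hw0 _),
        Real.norm_of_nonneg (hw0 _)]
      have hcov := hL.norm_covariance_verticalPhase_le (θ := θ) r hκ.le p.1 p.2
      have hexp : ∀ a : ℝ, Real.exp (-(2 * κ) * |a|) ≤ Real.exp (-κ * |a|) := fun a => by
        rw [Real.exp_le_exp]; nlinarith [abs_nonneg a]
      calc _ ≤ (R ^ 2 * (Real.exp (-(2 * κ) * |p.1.1.1 - p.1.2.1|) *
              Real.exp (-(2 * κ) * |p.1.1.2 - p.1.2.2|))) *
            (R ^ 2 * (Real.exp (-(2 * κ) * |p.2.1.1 - p.2.2.1|) *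
              Real.exp (-(2 * κ) * |p.2.1.2 - p.2.2.2|))) *
            (4 * Real.exp (κ * (|p.1.1.2 - p.1.2.2| + |p.2.1.2 - p.2.2.2| -
              |p.1.1.2 - p.2.1.2|))) :=
            mul_le_mul (mul_le_mul (hχb _) (hχb _) (mul_nonneg (hw0 _) (norm_nonneg _))
              (by positivity)) hcov (norm_nonneg _) (by positivity)
        _ = 4 * R ^ 4 * ((Real.exp (-(2 * κ) * |p.1.1.1 - p.1.2.1|) *
              Real.exp (-κ * |p.1.1.2 - p.1.2.2|)) *
            ((Real.exp (-(2 * κ) * |p.2.1.1 - p.2.2.1|) *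
              Real.exp (-κ * |p.2.1.2 - p.2.2.2|)) * Real.exp (-κ * |p.1.1.2 - p.2.1.2|))) := by
            have e1 : ∀ a b c : ℝ, Real.exp (κ * (a + b - c)) =
                Real.exp (κ * a) * Real.exp (κ * b) * Real.exp (-κ * c) := fun a b c => by
              rw [← Real.exp_add, ← Real.exp_add]; congr 1; ring
            have e2 : ∀ a : ℝ, Real.exp (-κ * a) = Real.exp (-(2 * κ) * a) * Real.exp (κ * a) :=
              fun a => by rw [← Real.exp_add]; congr 1; ring
            rw [e1, e2 |p.1.1.2 - p.1.2.2|, e2 |p.2.1.2 - p.2.2.2|]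
            ring
        _ ≤ 4 * R ^ 4 * K p := by
            simp only [hK]
            gcongr ?_ * (?_ * _ * (?_ * _ * _))
            · exact hexp _
            · exact hexp _
    have hKi : Integrable K ((ν.prod ν).prod (ν.prod ν)) := by
      have hcont : Continuous K := by fun_prop
      refine Integrable.of_bound hcont.aestronglyMeasurable 1 (ae_of_all _ fun p => ?_)
      have h1 : ∀ a : ℝ, Real.exp (-κ * |a|) ≤ 1 := fun a =>
        Real.exp_le_one_iff.2 (by rw [neg_mul]; exact neg_nonpos.2 (by positivity))
      rw [Real.norm_of_nonneg (by positivity)]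
      have hp : ∀ a : ℝ, 0 ≤ Real.exp (-κ * |a|) := fun a => (Real.exp_pos _).le
      exact mul_le_one₀ (mul_le_one₀ (h1 _) (hp _) (h1 _)) (by positivity)
        (mul_le_one₀ (mul_le_one₀ (h1 _) (hp _) (h1 _)) (hp _) (h1 _))
    refine (norm_integral_le_of_norm_le (hKi.const_mul _) (ae_of_all _ hbound)).trans ?_
    rw [integral_const_mul]
    have hch := integral_chained_kernel_le hκ (A := Ioo s s') (B := Ioo t t') (by simp) (by simp)
    rw [Real.volume_real_Ioo_of_le hss', Real.volume_real_Ioo_of_le htt'] at hch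
    gcongr
  have hnorm : ‖∫ ω, F ω * W ω ∂P‖ ≤ C * ∫ ω, ‖W ω‖ ∂P := by
    rw [← integral_const_mul]
    refine norm_integral_le_of_norm_le
      ((Integrable.of_bound hWm.aestronglyMeasurable _ (ae_of_all _ hWb)).norm.const_mul C)
      (ae_of_all _ fun ω => ?_)
    rw [norm_mul]
    gcongr
    exact hC ω
  calc ‖∫ ω, F ω * W ω ∂P‖ ^ 2 ≤ (C * ∫ ω, ‖W ω‖ ∂P) ^ 2 := by gcongr
    _ = C ^ 2 * (∫ ω, ‖W ω‖ ∂P) ^ 2 := by ring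
    _ ≤ C ^ 2 * ∫ ω, ‖W ω‖ ^ 2 ∂P := by gcongr; exact sq_integral_norm_le hWm hWb
    _ ≤ _ := by gcongr

end IsLevySheet

/-! ### Limit of the second moment of a block integral -/

/-- The covariance `E[exp (iθL(z)) conj (exp (iθL(z')))]` of the phases of a Lévy sheet, as a function
of the value `ψ` of the exponent at `θ`. -/
noncomputable def phaseCovariance (ψ : ℂ) (z z' : ℝ × ℝ) : ℂ :=
  Complex.exp (-(((z.1 * z.2 - min z.1 z'.1 * min z.2 z'.2 : ℝ) : ℂ) * ψ +
    ((z'.1 * z'.2 - min z.1 z'.1 * min z.2 z'.2 : ℝ) : ℂ) * (starRingEnd ℂ) ψ))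

section PhaseCovariance

variable {ψ : ℂ} {s s' t t' : ℝ}

theorem measurable_phaseCovariance (ψ : ℂ) :
    Measurable fun p : (ℝ × ℝ) × (ℝ × ℝ) => phaseCovariance ψ p.1 p.2 := by
  unfold phaseCovariance
  refine Continuous.measurable ?_
  fun_prop

theorem norm_phaseCovariance_le (hψ : 0 ≤ ψ.re) {z z' : ℝ × ℝ}
    (h : z ∈ Ioo s s' ×ˢ Ioo t t') (h' : z' ∈ Ioo s s' ×ˢ Ioo t t') :
    ‖phaseCovariance ψ z z'‖ ≤
      Real.exp (-(ψ.re * t) * |z.1 - z'.1|) * Real.exp (-(ψ.re * s) * |z.2 - z'.2|) := by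
  obtain ⟨x, y⟩ := z
  obtain ⟨x', y'⟩ := z'
  obtain ⟨⟨hx, -⟩, ⟨hy, -⟩⟩ := h
  obtain ⟨⟨hx', -⟩, ⟨hy', -⟩⟩ := h'
  simp only at hx hy hx' hy' ⊢
  have hD : t * |x - x'| + s * |y - y'| ≤
      (x * y - min x x' * min y y') + (x' * y' - min x x' * min y y') := by
    rcases le_total x x' with h1 | h1 <;> rcases le_total y y' with h2 | h2
    · rw [min_eq_left h1, min_eq_left h2, abs_of_nonpos (by linarith), abs_of_nonpos (by linarith)]
      nlinarith [mul_nonneg (sub_nonneg.2 h1) (sub_nonneg.2 hy.le),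
        mul_nonneg (sub_nonneg.2 h2) (sub_nonneg.2 hx'.le)]
    · rw [min_eq_left h1, min_eq_right h2, abs_of_nonpos (by linarith), abs_of_nonneg (by linarith)]
      nlinarith [mul_nonneg (sub_nonneg.2 h1) (sub_nonneg.2 hy'.le),
        mul_nonneg (sub_nonneg.2 h2) (sub_nonneg.2 hx.le)]
    · rw [min_eq_right h1, min_eq_left h2, abs_of_nonneg (by linarith), abs_of_nonpos (by linarith)]
      nlinarith [mul_nonneg (sub_nonneg.2 h1) (sub_nonneg.2 hy.le),
        mul_nonneg (sub_nonneg.2 h2) (sub_nonneg.2 hx'.le)]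
    · rw [min_eq_right h1, min_eq_right h2, abs_of_nonneg (by linarith),
        abs_of_nonneg (by linarith)]
      nlinarith [mul_nonneg (sub_nonneg.2 h1) (sub_nonneg.2 hy'.le),
        mul_nonneg (sub_nonneg.2 h2) (sub_nonneg.2 hx.le)]
  rw [phaseCovariance, Complex.norm_exp, ← Real.exp_add, Real.exp_le_exp]
  simp only [Complex.neg_re, Complex.add_re, Complex.re_ofReal_mul, Complex.conj_re]
  nlinarith [mul_le_mul_of_nonneg_left hD hψ]

/-- Blowing up the covariance at scale `δ` around the diagonal. -/
theorem phaseCovariance_rescale (ψ : ℂ) {δ : ℝ} (hδ : 0 < δ) (z w : ℝ × ℝ) :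
    phaseCovariance ((δ⁻¹ : ℝ) * ψ) (z + δ • w) z =
      Complex.exp (-(((z.1 * max w.2 0 + z.2 * max w.1 0 +
          δ * (w.1 * w.2 - max (-w.1) 0 * max (-w.2) 0) : ℝ) : ℂ) * ψ +
        ((z.1 * max (-w.2) 0 + z.2 * max (-w.1) 0 - δ * (max (-w.1) 0 * max (-w.2) 0) : ℝ) : ℂ) *
          (starRingEnd ℂ) ψ)) := by
  obtain ⟨x, y⟩ := z
  obtain ⟨u, v⟩ := w
  have hmin : ∀ x u : ℝ, min (x + δ * u) x = x - δ * max (-u) 0 := by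
    intro x u
    rcases le_total u 0 with h | h
    · rw [max_eq_left (by linarith), min_eq_left (by nlinarith)]; ring
    · rw [max_eq_right (by linarith), min_eq_right (by nlinarith)]; ring
  have hmax : ∀ u : ℝ, max u 0 = u + max (-u) 0 := by
    intro u
    rcases le_total u 0 with h | h
    · rw [max_eq_left (by linarith : 0 ≤ -u), max_eq_right h]; ring
    · rw [max_eq_right (by linarith : -u ≤ 0), max_eq_left h]; ring
  have hδ' : (δ : ℂ) ≠ 0 := by exact_mod_cast hδ.ne'
  rw [phaseCovariance]
  simp only [Prod.smul_mk, Prod.mk_add_mk, smul_eq_mul, hmin, map_mul, Complex.conj_ofReal]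
  rw [hmax u, hmax v]
  congr 2
  push_cast
  field_simp
  ring

/-- The two-sided exponential kernel to which the blown up covariance converges in each coordinate. -/
noncomputable def diagonalKernel (ψ : ℂ) (c u : ℝ) : ℂ :=
  Complex.exp (-(((c * max u 0 : ℝ) : ℂ) * ψ +
      ((c * max (-u) 0 : ℝ) : ℂ) * (starRingEnd ℂ) ψ))

theorem integrable_diagonalKernel (hψ : 0 < ψ.re) {c : ℝ} (hc : 0 < c) :
    Integrable (diagonalKernel ψ c) := by
  refine (integrable_exp_neg_mul_abs (mul_pos hc hψ)).mono'
    (Continuous.aestronglyMeasurable (by unfold diagonalKernel; fun_prop)) (ae_of_all _ fun u => ?_)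
  rw [diagonalKernel, Complex.norm_exp, Real.exp_le_exp]
  simp only [Complex.neg_re, Complex.add_re, Complex.re_ofReal_mul, Complex.conj_re]
  rcases le_total u 0 with h | h
  · rw [max_eq_left (by linarith : 0 ≤ -u), max_eq_right h, abs_of_nonpos h]
    exact le_of_eq (by ring)
  · rw [max_eq_right (by linarith : -u ≤ 0), max_eq_left h, abs_of_nonneg h]
    exact le_of_eq (by ring)

theorem integral_diagonalKernel (hψ : 0 < ψ.re) {c : ℝ} (hc : 0 < c) :
    ∫ u, diagonalKernel ψ c u =
      ((2 * ψ.re / (ψ.re ^ 2 + ψ.im ^ 2) / c : ℝ) : ℂ) := by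
  have hi := integrable_diagonalKernel hψ hc
  have h1 : ∫ u in Iic (0 : ℝ), diagonalKernel ψ c u = 1 / (c * (starRingEnd ℂ) ψ) := by
    rw [setIntegral_congr_fun (g := fun u : ℝ => Complex.exp ((c * (starRingEnd ℂ) ψ) * u))
      measurableSet_Iic, integral_exp_mul_complex_Iic]
    · simp
    · simpa using mul_pos hc hψ
    · intro u hu
      simp only [diagonalKernel]
      rw [max_eq_right hu, max_eq_left (by linarith [mem_Iic.1 hu])]
      congr 1
      push_cast
      ring
  have h2 : ∫ u in Ioi (0 : ℝ), diagonalKernel ψ c u = 1 / (c * ψ) := by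
    rw [setIntegral_congr_fun (g := fun u : ℝ => Complex.exp (-(c * ψ) * u))
      measurableSet_Ioi, integral_exp_mul_complex_Ioi]
    · simp
    · simpa using mul_pos hc hψ
    · intro u hu
      simp only [diagonalKernel]
      rw [max_eq_left hu.le, max_eq_right (by linarith [mem_Ioi.1 hu])]
      congr 1
      push_cast
      ring
  have hsplit := setIntegral_union (Iic_disjoint_Ioi le_rfl) measurableSet_Ioi
    hi.integrableOn hi.integrableOn (s := Iic (0 : ℝ)) (t := Ioi 0)
  rw [Iic_union_Ioi, setIntegral_univ] at hsplit
  rw [hsplit, h1, h2]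
  have hψ0 : ψ ≠ 0 := fun h => by simp [h] at hψ
  have hψc : (starRingEnd ℂ) ψ ≠ 0 := by simpa using hψ0
  have hc0 : (c : ℂ) ≠ 0 := by exact_mod_cast hc.ne'
  have hn : ((ψ.re ^ 2 + ψ.im ^ 2 : ℝ) : ℂ) = ψ * (starRingEnd ℂ) ψ := by
    rw [Complex.mul_conj, Complex.normSq_apply]; push_cast; ring
  have hadd : ψ + (starRingEnd ℂ) ψ = ((2 * ψ.re : ℝ) : ℂ) := Complex.add_conj ψ
  rw [Complex.ofReal_div, Complex.ofReal_div, hn, ← hadd]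
  field_simp

theorem continuousAt_blockWeight {z : ℝ × ℝ} (hz : z ∈ Ioo s s' ×ˢ Ioo t t') :
    ContinuousAt (blockWeight s s' t t') z := by
  have hc : Continuous fun z : ℝ × ℝ => √(z.1 * z.2) := by fun_prop
  refine hc.continuousAt.congr ?_
  filter_upwards [(isOpen_Ioo.prod isOpen_Ioo).mem_nhds hz] with w hw
  rw [blockWeight, if_pos hw]

theorem norm_blowup_phaseCovariance_le (hψ : 0 ≤ ψ.re) (hs : 0 ≤ s) (ht : 0 ≤ t) {R : ℝ}
    (hR0 : 0 ≤ R) (hs' : s' ≤ R) (ht' : t' ≤ R) {δ : ℝ} (hδ : 0 < δ) (z w : ℝ × ℝ) :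
    ‖((blockWeight s s' t t' (z + δ • w) * blockWeight s s' t t' z : ℝ) : ℂ) *
      phaseCovariance ((δ⁻¹ : ℝ) * ψ) (z + δ • w) z‖ ≤
    R * R * (Real.exp (-(ψ.re * t) * |w.1|) * Real.exp (-(ψ.re * s) * |w.2|)) := by
  by_cases h1 : z ∈ Ioo s s' ×ˢ Ioo t t'
  swap
  · rw [blockWeight_of_notMem h1, mul_zero, Complex.ofReal_zero, zero_mul, norm_zero]
    positivity
  by_cases h2 : z + δ • w ∈ Ioo s s' ×ˢ Ioo t t'
  swap
  · rw [blockWeight_of_notMem h2, zero_mul, Complex.ofReal_zero, zero_mul, norm_zero]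
    positivity
  rw [norm_mul, Complex.norm_real, Real.norm_of_nonneg
    (mul_nonneg (blockWeight_nonneg _) (blockWeight_nonneg _))]
  have hre : ((δ⁻¹ : ℝ) * ψ).re = δ⁻¹ * ψ.re := Complex.re_ofReal_mul _ _
  have hψ' : 0 ≤ ((δ⁻¹ : ℝ) * ψ).re := by
    rw [hre]; exact mul_nonneg (inv_nonneg.2 hδ.le) hψ
  have hbR : ∀ z, blockWeight s s' t t' z ≤ R := blockWeight_le hs ht hR0 hs' ht'
  refine mul_le_mul (mul_le_mul (hbR _) (hbR _) (blockWeight_nonneg _) hR0)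
    ((norm_phaseCovariance_le hψ' h2 h1).trans_eq ?_) (norm_nonneg _) (by positivity)
  rw [hre]
  simp only [Prod.fst_add, Prod.snd_add, Prod.smul_fst, Prod.smul_snd, smul_eq_mul,
    add_sub_cancel_left, abs_mul, abs_of_pos hδ]
  congr 2 <;> field_simp

theorem tendsto_blowup_phaseCovariance (ψ : ℂ) (hs : 0 ≤ s) (ht : 0 ≤ t) {z : ℝ × ℝ}
    (hz : z ∈ Ioo s s' ×ˢ Ioo t t') (w : ℝ × ℝ) {δ : ℕ → ℝ} (hδ : ∀ n, 0 < δ n)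
    (hδ0 : Tendsto δ atTop (𝓝 0)) :
    Tendsto (fun n => ((blockWeight s s' t t' (z + δ n • w) * blockWeight s s' t t' z : ℝ) : ℂ) *
      phaseCovariance (((δ n)⁻¹ : ℝ) * ψ) (z + δ n • w) z) atTop
      (𝓝 (((z.1 * z.2 : ℝ) : ℂ) * (diagonalKernel ψ z.2 w.1 * diagonalKernel ψ z.1 w.2))) := by
  have hzn : Tendsto (fun n => z + δ n • w) atTop (𝓝 z) := by
    simpa using (hδ0.smul_const w).const_add z
  have hw : Tendsto (fun n => blockWeight s s' t t' (z + δ n • w)) atTop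
      (𝓝 (blockWeight s s' t t' z)) := (continuousAt_blockWeight hz).tendsto.comp hzn
  have hexp : Tendsto (fun n => phaseCovariance (((δ n)⁻¹ : ℝ) * ψ) (z + δ n • w) z) atTop
      (𝓝 (diagonalKernel ψ z.2 w.1 * diagonalKernel ψ z.1 w.2)) := by
    simp_rw [phaseCovariance_rescale ψ (hδ _)]
    have hcont : Continuous fun d : ℝ => Complex.exp (-(((z.1 * max w.2 0 +
        z.2 * max w.1 0 + d * (w.1 * w.2 - max (-w.1) 0 * max (-w.2) 0) : ℝ) : ℂ) * ψ +
      ((z.1 * max (-w.2) 0 + z.2 * max (-w.1) 0 -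
        d * (max (-w.1) 0 * max (-w.2) 0) : ℝ) : ℂ) * (starRingEnd ℂ) ψ)) := by fun_prop
    have e : diagonalKernel ψ z.2 w.1 * diagonalKernel ψ z.1 w.2 =
        Complex.exp (-(((z.1 * max w.2 0 +
        z.2 * max w.1 0 + 0 * (w.1 * w.2 - max (-w.1) 0 * max (-w.2) 0) : ℝ) : ℂ) * ψ +
      ((z.1 * max (-w.2) 0 + z.2 * max (-w.1) 0 -
        0 * (max (-w.1) 0 * max (-w.2) 0) : ℝ) : ℂ) * (starRingEnd ℂ) ψ)) := by
      rw [diagonalKernel, diagonalKernel, ← Complex.exp_add]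
      congr 1
      push_cast
      ring
    rw [e]
    exact (hcont.tendsto 0).comp hδ0
  have hsq : blockWeight s s' t t' z * blockWeight s s' t t' z = z.1 * z.2 := by
    rw [blockWeight, if_pos hz,
      Real.mul_self_sqrt (mul_nonneg (hs.trans hz.1.1.le) (ht.trans hz.2.1.le))]
  rw [← hsq]
  exact ((Complex.continuous_ofReal.tendsto _).comp (hw.mul_const _)).mul hexp

theorem integral_mul_diagonalKernel {ψ : ℂ} (hψ : 0 < ψ.re) {z : ℝ × ℝ} (hx : 0 < z.1)
    (hy : 0 < z.2) :
    ∫ w : ℝ × ℝ, ((z.1 * z.2 : ℝ) : ℂ) *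
      (diagonalKernel ψ z.2 w.1 * diagonalKernel ψ z.1 w.2) =
      (((2 * ψ.re / (ψ.re ^ 2 + ψ.im ^ 2)) ^ 2 : ℝ) : ℂ) := by
  rw [integral_const_mul, Measure.volume_eq_prod,
    integral_prod_mul (diagonalKernel ψ z.2) (diagonalKernel ψ z.1),
    integral_diagonalKernel hψ hx, integral_diagonalKernel hψ hy,
    ← Complex.ofReal_mul, ← Complex.ofReal_mul]
  congr 1
  field_simp

theorem measurable_blowup_phaseCovariance (ψ : ℂ) (δ : ℝ) :
    Measurable fun p : (ℝ × ℝ) × (ℝ × ℝ) =>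
      ((blockWeight s s' t t' (p.1 + δ • p.2) * blockWeight s s' t t' p.1 : ℝ) : ℂ) *
        phaseCovariance ψ (p.1 + δ • p.2) p.1 := by
  have m : Measurable fun p : (ℝ × ℝ) × (ℝ × ℝ) => p.1 + δ • p.2 := by fun_prop
  have m1 : Measurable fun p : (ℝ × ℝ) × (ℝ × ℝ) =>
      phaseCovariance ψ (p.1 + δ • p.2) p.1 :=
    (measurable_phaseCovariance ψ).comp
      (f := fun p : (ℝ × ℝ) × (ℝ × ℝ) => (p.1 + δ • p.2, p.1)) (m.prodMk measurable_fst)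
  have m2 : Measurable fun p : (ℝ × ℝ) × (ℝ × ℝ) =>
      blockWeight s s' t t' (p.1 + δ • p.2) * blockWeight s s' t t' p.1 :=
    (measurable_blockWeight.comp m).mul (measurable_blockWeight.comp measurable_fst)
  exact m2.complex_ofReal.mul m1

theorem integral_blowup (F : ℝ × ℝ → ℂ) (z : ℝ × ℝ) {δ : ℝ} (hδ : 0 < δ) :
    ∫ w, F (z + δ • w) = (((δ ^ 2)⁻¹ : ℝ) : ℂ) * ∫ z, F z := by
  rw [Measure.integral_comp_smul volume (fun w => F (z + w)) δ, integral_add_left_eq_self F z]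
  have : Module.finrank ℝ (ℝ × ℝ) = 2 := by simp
  rw [this, abs_of_pos (inv_pos.2 (pow_pos hδ 2)), Complex.real_smul]

/-- After blowing up around the diagonal at scale `δ`, the rescaled double integral of the covariance
converges by dominated convergence; the limiting integrand factorises over the two coordinates and
its integral cancels the weight `xy`. -/
theorem tendsto_integral_phaseCovariance (hψ : 0 < ψ.re) (hs : 0 < s) (ht : 0 < t)
    (hss' : s ≤ s') (htt' : t ≤ t') {δ : ℕ → ℝ} (hδ : ∀ n, 0 < δ n)
    (hδ0 : Tendsto δ atTop (𝓝 0)) :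
    Tendsto (fun n => (((δ n ^ 2)⁻¹ : ℝ) : ℂ) * ∫ z', ∫ z,
      ((blockWeight s s' t t' z * blockWeight s s' t t' z' : ℝ) : ℂ) *
        phaseCovariance (((δ n)⁻¹ : ℝ) * ψ) z z'
        ∂(blockMeasure s s' t t') ∂(blockMeasure s s' t t')) atTop
      (𝓝 (((s' - s) * (t' - t) * (2 * ψ.re / (ψ.re ^ 2 + ψ.im ^ 2)) ^ 2 : ℝ) : ℂ)) := by
  set ν := blockMeasure s s' t t' with hν
  set R : ℝ := max s' t' with hR
  have hR0 : 0 ≤ R := hs.le.trans (hss'.trans (le_max_left _ _))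
  have hνr : ν = (volume : Measure (ℝ × ℝ)).restrict (Ioo s s' ×ˢ Ioo t t') := by
    rw [hν, blockMeasure, Measure.prod_restrict, Measure.volume_eq_prod]
  have hmem : ∀ᵐ z ∂ν, z ∈ Ioo s s' ×ˢ Ioo t t' := by
    rw [hνr]
    exact ae_restrict_mem (measurableSet_Ioo.prod measurableSet_Ioo)
  obtain ⟨f, hf⟩ : ∃ f : ℕ → (ℝ × ℝ) × (ℝ × ℝ) → ℂ, ∀ n p, f n p =
      ((blockWeight s s' t t' (p.1 + δ n • p.2) * blockWeight s s' t t' p.1 : ℝ) : ℂ) *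
      phaseCovariance (((δ n)⁻¹ : ℝ) * ψ) (p.1 + δ n • p.2) p.1 := ⟨_, fun _ _ => rfl⟩
  obtain ⟨g, hg⟩ : ∃ g : (ℝ × ℝ) × (ℝ × ℝ) → ℂ, ∀ p, g p = ((p.1.1 * p.1.2 : ℝ) : ℂ) *
      (diagonalKernel ψ p.1.2 p.2.1 * diagonalKernel ψ p.1.1 p.2.2) := ⟨_, fun _ => rfl⟩
  obtain ⟨b, hb⟩ : ∃ b : (ℝ × ℝ) × (ℝ × ℝ) → ℝ, b = fun p => R * R *
    (Real.exp (-(ψ.re * t) * |p.2.1|) * Real.exp (-(ψ.re * s) * |p.2.2|)) := ⟨_, rfl⟩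
  have hfm : ∀ n, Measurable (f n) := fun n => by
    have e : f n = fun p => ((blockWeight s s' t t' (p.1 + δ n • p.2) *
        blockWeight s s' t t' p.1 : ℝ) : ℂ) *
      phaseCovariance (((δ n)⁻¹ : ℝ) * ψ) (p.1 + δ n • p.2) p.1 := funext fun p => hf n p
    rw [e]
    exact measurable_blowup_phaseCovariance _ (δ n)
  have hbi : Integrable b (ν.prod (volume : Measure (ℝ × ℝ))) := by
    have h2 : Integrable (fun w : ℝ × ℝ => Real.exp (-(ψ.re * t) * |w.1|) *
        Real.exp (-(ψ.re * s) * |w.2|)) (volume : Measure (ℝ × ℝ)) :=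
      (integrable_exp_neg_mul_abs (mul_pos hψ ht)).mul_prod
        (integrable_exp_neg_mul_abs (mul_pos hψ hs))
    rw [hb]
    exact (integrable_const (R * R)).mul_prod h2
  have hfb : ∀ n p, ‖f n p‖ ≤ b p := fun n p => by
    rw [hf, hb]
    exact norm_blowup_phaseCovariance_le hψ.le hs.le ht.le hR0 (le_max_left _ _)
      (le_max_right _ _) (hδ n) p.1 p.2
  have hlim : ∀ᵐ p ∂(ν.prod (volume : Measure (ℝ × ℝ))),
      Tendsto (fun n => f n p) atTop (𝓝 (g p)) := by
    filter_upwards [(Measure.quasiMeasurePreserving_fst (μ := ν)).ae hmem] with p hp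
    simp_rw [hf, hg]
    exact tendsto_blowup_phaseCovariance ψ hs.le ht.le hp p.2 hδ hδ0
  have hmain := tendsto_integral_of_dominated_convergence b
    (fun n => (hfm n).aestronglyMeasurable) hbi (fun n => ae_of_all _ (hfb n)) hlim
  have hgint : Integrable g (ν.prod (volume : Measure (ℝ × ℝ))) := by
    refine hbi.mono' (aestronglyMeasurable_of_tendsto_ae atTop
      (fun n => (hfm n).aestronglyMeasurable) hlim) ?_
    filter_upwards [hlim] with p hp
    exact le_of_tendsto hp.norm (Eventually.of_forall fun n => hfb n p)
  have hgi : ∫ p, g p ∂(ν.prod (volume : Measure (ℝ × ℝ))) =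
      (((s' - s) * (t' - t) * (2 * ψ.re / (ψ.re ^ 2 + ψ.im ^ 2)) ^ 2 : ℝ) : ℂ) := by
    rw [integral_prod _ hgint]
    have hin : ∀ᵐ z ∂ν, ∫ w, g (z, w) =
        (((2 * ψ.re / (ψ.re ^ 2 + ψ.im ^ 2)) ^ 2 : ℝ) : ℂ) := by
      filter_upwards [hmem] with z hz
      simp_rw [hg]
      exact integral_mul_diagonalKernel hψ (hs.trans hz.1.1) (ht.trans hz.2.1)
    rw [integral_congr_ae hin, integral_const, blockMeasure_real_univ hss' htt',
      Complex.real_smul, ← Complex.ofReal_mul]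
  rw [hgi] at hmain
  refine hmain.congr fun n => ?_
  have hfi : Integrable (f n) (ν.prod (volume : Measure (ℝ × ℝ))) :=
    hbi.mono' (hfm n).aestronglyMeasurable (ae_of_all _ (hfb n))
  rw [integral_prod _ hfi, ← integral_const_mul]
  refine integral_congr_ae (ae_of_all _ fun z' => ?_)
  simp only [hf]
  have h1 : ∫ z, ((blockWeight s s' t t' z * blockWeight s s' t t' z' : ℝ) : ℂ) *
        phaseCovariance (((δ n)⁻¹ : ℝ) * ψ) z z' ∂ν =
      ∫ z, ((blockWeight s s' t t' z * blockWeight s s' t t' z' : ℝ) : ℂ) *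
        phaseCovariance (((δ n)⁻¹ : ℝ) * ψ) z z' := by
    rw [hνr]
    refine setIntegral_eq_integral_of_forall_compl_eq_zero fun z hz => ?_
    rw [blockWeight_of_notMem hz]
    simp
  rw [h1]
  exact integral_blowup (fun z => ((blockWeight s s' t t' z * blockWeight s s' t t' z' : ℝ) : ℂ) *
        phaseCovariance (((δ n)⁻¹ : ℝ) * ψ) z z') z' (hδ n)

end PhaseCovariance

theorem IsLevySheet.integral_normSq_blockIntegral {Ω : Type*} [MeasurableSpace Ω] {P : Measure Ω}
    [IsProbabilityMeasure P] {L : ℝ≥0 → ℝ≥0 → Ω → ℝ} {Ψ : ℝ → ℂ} {θ s s' t t' : ℝ}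
    (hL : IsLevySheet P L Ψ) (hmeas : Measurable fun p : (ℝ≥0 × ℝ≥0) × Ω => L p.1.1 p.1.2 p.2)
    (hs : 0 ≤ s) (ht : 0 ≤ t) (hss' : s ≤ s') :
    ∫ ω, blockIntegral L θ s s' t t' ω * (starRingEnd ℂ) (blockIntegral L θ s s' t t' ω) ∂P =
      ∫ z', ∫ z, ((blockWeight s s' t t' z * blockWeight s s' t t' z' : ℝ) : ℂ) *
        phaseCovariance (Ψ θ) z z' ∂(blockMeasure s s' t t') ∂(blockMeasure s s' t t') := by
  set ν := blockMeasure s s' t t' with hν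
  set R : ℝ := max s' t' with hR
  have hR0 : 0 ≤ R := hs.trans (hss'.trans (le_max_left _ _))
  set g : Ω → ℝ × ℝ → ℂ := fun ω z => (blockWeight s s' t t' z : ℂ) * sheetPhase L θ z ω with hg
  have hgm : Measurable (Function.uncurry g) :=
    (Complex.measurable_ofReal.comp (measurable_blockWeight.comp measurable_snd)).mul
      (measurable_sheetPhase hmeas θ)
  have hgb : ∀ ω z, ‖g ω z‖ ≤ R := fun ω z => by
    rw [hg, norm_mul, norm_sheetPhase, mul_one, Complex.norm_real,
      Real.norm_of_nonneg (blockWeight_nonneg z)]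
    exact blockWeight_le hs ht hR0 (le_max_left _ _) (le_max_right _ _) z
  have hexp : ∀ ω, blockIntegral L θ s s' t t' ω *
      (starRingEnd ℂ) (blockIntegral L θ s s' t t' ω) =
      ∫ p : (ℝ × ℝ) × (ℝ × ℝ), (starRingEnd ℂ) (g ω p.1) * g ω p.2 ∂(ν.prod ν) := by
    intro ω
    rw [integral_prod_mul (fun z => (starRingEnd ℂ) (g ω z)) (g ω), integral_conj, mul_comm]
    rfl
  have hm : Measurable (Function.uncurry fun ω (p : (ℝ × ℝ) × (ℝ × ℝ)) =>
      (starRingEnd ℂ) (g ω p.1) * g ω p.2) :=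
    (Complex.continuous_conj.measurable.comp (hgm.comp
      (f := fun p : Ω × ((ℝ × ℝ) × (ℝ × ℝ)) => (p.1, p.2.1)) (by fun_prop))).mul
      (hgm.comp (f := fun p : Ω × ((ℝ × ℝ) × (ℝ × ℝ)) => (p.1, p.2.2)) (by fun_prop))
  have hint : Integrable (Function.uncurry fun ω (p : (ℝ × ℝ) × (ℝ × ℝ)) =>
      (starRingEnd ℂ) (g ω p.1) * g ω p.2) (P.prod (ν.prod ν)) := by
    refine integrable_of_measurable_of_norm_le hm (C := R * R) fun p => ?_
    change ‖(starRingEnd ℂ) (g p.1 p.2.1) * g p.1 p.2.2‖ ≤ _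
    rw [norm_mul, RCLike.norm_conj]
    exact mul_le_mul (hgb _ _) (hgb _ _) (norm_nonneg _) hR0
  simp_rw [hexp]
  have hint' : Integrable (fun p : (ℝ × ℝ) × (ℝ × ℝ) =>
      ∫ ω, (starRingEnd ℂ) (g ω p.1) * g ω p.2 ∂P) (ν.prod ν) := hint.integral_prod_right
  rw [integral_integral_swap hint, integral_prod _ hint']
  refine integral_congr_ae (ae_of_all _ fun z' => integral_congr_ae (ae_of_all _ fun z => ?_))
  simp only
  by_cases h1 : z ∈ Ioo s s' ×ˢ Ioo t t'
  swap
  · simp only [hg, blockWeight_of_notMem h1]; simp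
  by_cases h2 : z' ∈ Ioo s s' ×ˢ Ioo t t'
  swap
  · simp only [hg, blockWeight_of_notMem h2]; simp
  have e : ∀ ω, (starRingEnd ℂ) (g ω z') * g ω z =
      ((blockWeight s s' t t' z * blockWeight s s' t t' z' : ℝ) : ℂ) *
      Complex.exp (Complex.I * ((θ * (L z.1.toNNReal z.2.toNNReal ω -
        L z'.1.toNNReal z'.2.toNNReal ω) : ℝ) : ℂ)) := by
    intro ω
    simp only [hg]
    rw [map_mul, Complex.conj_ofReal, conj_sheetPhase, sheetPhase, mul_mul_mul_comm,
      ← Complex.exp_add]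
    push_cast
    ring_nf
  simp_rw [e]
  rw [integral_const_mul, hL.charFun_sub, phaseCovariance,
    Real.coe_toNNReal _ (hs.trans h1.1.1.le), Real.coe_toNNReal _ (ht.trans h1.2.1.le),
    Real.coe_toNNReal _ (hs.trans h2.1.1.le), Real.coe_toNNReal _ (ht.trans h2.2.1.le)]

/-! ### The approximating field in terms of block integrals -/

/-- The sheet `(x, y) ↦ L(x/ε, y/ε)`. -/
noncomputable abbrev rescaledSheet {Ω : Type*} (L : ℝ≥0 → ℝ≥0 → Ω → ℝ) (ε : ℝ≥0) : ℝ≥0 → ℝ≥0 → Ω → ℝ :=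
  fun x y ω => L (x / ε) (y / ε) ω

section Identification

variable {Ω : Type*} {L : ℝ≥0 → ℝ≥0 → Ω → ℝ}

theorem sheetIntegrand_eq (θ : ℝ) (ω : Ω) (x y : ℝ) :
    sheetIntegrand L θ ω x y = ((√(x * y) : ℝ) : ℂ) * sheetPhase L θ (x, y) ω := by
  rw [sheetIntegrand, sheetPhase, mul_comm Complex.I, mul_comm Complex.I, Complex.exp_mul_I,
    Complex.ofReal_cos, Complex.ofReal_sin]

theorem sheetIntegrand_div (θ : ℝ) (ω : Ω) {ε : ℝ≥0} (hε : 0 < ε) (x y : ℝ) :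
    sheetIntegrand L θ ω (x / ε) (y / ε) =
      (((ε : ℝ)⁻¹ : ℝ) : ℂ) * sheetIntegrand (rescaledSheet L ε) θ ω x y := by
  have hε' : (0 : ℝ) < ε := hε
  have h1 : √(x / ε * (y / ε)) = (ε : ℝ)⁻¹ * √(x * y) := by
    rw [div_mul_div_comm, Real.sqrt_div' _ (by positivity), Real.sqrt_mul_self hε'.le]
    field_simp
  rw [sheetIntegrand_eq, sheetIntegrand_eq, h1]
  simp only [sheetPhase, Real.toNNReal_div' hε'.le, Real.toNNReal_coe]
  push_cast
  ring

theorem approxField_eq (Ψ : ℝ → ℂ) (θ : ℝ) (ω : Ω) {ε : ℝ≥0} (hε : 0 < ε) (s t : ℝ) :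
    approxField L Ψ θ ε ω s t = ((sheetConst Ψ θ * ((ε : ℝ) ^ 2)⁻¹ : ℝ) : ℂ) *
      ∫ y in (0 : ℝ)..t, ∫ x in (0 : ℝ)..s, sheetIntegrand (rescaledSheet L ε) θ ω x y := by
  have hε' : (ε : ℝ) ≠ 0 := NNReal.coe_ne_zero.2 hε.ne'
  have hεc : ((ε : ℝ) : ℂ) ≠ 0 := by exact_mod_cast hε'
  have hx : ∀ y : ℝ, ∫ x in (0 : ℝ)..(s / ε), sheetIntegrand L θ ω x y =
      (ε : ℝ)⁻¹ • ∫ x in (0 : ℝ)..s, sheetIntegrand L θ ω (x / ε) y := by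
    intro y
    rw [intervalIntegral.integral_comp_div (fun x => sheetIntegrand L θ ω x y) hε', zero_div,
      smul_smul, inv_mul_cancel₀ hε', one_smul]
  have hy : ∫ y in (0 : ℝ)..(t / ε), ∫ x in (0 : ℝ)..s, sheetIntegrand L θ ω (x / ε) y =
      (ε : ℝ)⁻¹ • ∫ y in (0 : ℝ)..t, ∫ x in (0 : ℝ)..s, sheetIntegrand L θ ω (x / ε) (y / ε) := by
    rw [intervalIntegral.integral_comp_div
      (fun y => ∫ x in (0 : ℝ)..s, sheetIntegrand L θ ω (x / ε) y) hε', zero_div,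
      smul_smul, inv_mul_cancel₀ hε', one_smul]
  rw [approxField]
  simp_rw [hx]
  rw [intervalIntegral.integral_smul, hy]
  simp_rw [sheetIntegrand_div θ ω hε]
  rw [intervalIntegral.integral_congr (g := fun y => (((ε : ℝ)⁻¹ : ℝ) : ℂ) *
    ∫ x in (0 : ℝ)..s, sheetIntegrand (rescaledSheet L ε) θ ω x y)
    (fun y _ => intervalIntegral.integral_const_mul _ _), intervalIntegral.integral_const_mul]
  simp only [Complex.real_smul]
  push_cast
  field_simp

variable [MeasurableSpace Ω]

theorem measurable_sheetIntegrand_pair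
    (hL : Measurable fun p : (ℝ≥0 × ℝ≥0) × Ω => L p.1.1 p.1.2 p.2) (θ : ℝ) (ω : Ω) :
    Measurable fun z : ℝ × ℝ => sheetIntegrand L θ ω z.1 z.2 :=
  (measurable_sheetIntegrand hL θ).comp (f := fun z : ℝ × ℝ => ((ω, z.2), z.1)) (by fun_prop)

theorem intervalIntegral_sheetIntegrand_eq
    (hL : Measurable fun p : (ℝ≥0 × ℝ≥0) × Ω => L p.1.1 p.1.2 p.2) (θ : ℝ) (ω : Ω)
    {s s' t t' : ℝ} (hs : 0 ≤ s) (ht : 0 ≤ t) (hss' : s ≤ s') (htt' : t ≤ t') :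
    ∫ y in t..t', ∫ x in s..s', sheetIntegrand L θ ω x y = blockIntegral L θ s s' t t' ω := by
  have hR0 : 0 ≤ max s' t' := hs.trans (hss'.trans (le_max_left _ _))
  have hm : Measurable fun z : ℝ × ℝ =>
      (blockWeight s s' t t' z : ℂ) * sheetPhase L θ z ω :=
    (Complex.measurable_ofReal.comp measurable_blockWeight).mul
      ((measurable_sheetPhase hL θ).comp measurable_prodMk_left)
  have hi : Integrable (fun z : ℝ × ℝ => (blockWeight s s' t t' z : ℂ) * sheetPhase L θ z ω)
      (blockMeasure s s' t t') := by
    refine integrable_of_measurable_of_norm_le hm (C := max s' t') fun z => ?_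
    rw [norm_mul, norm_sheetPhase, mul_one, Complex.norm_real,
      Real.norm_of_nonneg (blockWeight_nonneg z)]
    exact blockWeight_le hs ht hR0 (le_max_left _ _) (le_max_right _ _) z
  rw [blockIntegral, integral_prod_symm _ hi, intervalIntegral.integral_of_le htt',
    integral_Ioc_eq_integral_Ioo]
  refine setIntegral_congr_fun measurableSet_Ioo fun y hy => ?_
  rw [intervalIntegral.integral_of_le hss', integral_Ioc_eq_integral_Ioo]
  refine setIntegral_congr_fun measurableSet_Ioo fun x hx => ?_
  rw [sheetIntegrand_eq, blockWeight, if_pos (mk_mem_prod hx hy)]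

theorem rectIncr_intervalIntegral
    (hL : Measurable fun p : (ℝ≥0 × ℝ≥0) × Ω => L p.1.1 p.1.2 p.2) (θ : ℝ) (ω : Ω)
    (s s' t t' : ℝ) :
    rectIncr (fun u v => ∫ y in (0 : ℝ)..v, ∫ x in (0 : ℝ)..u, sheetIntegrand L θ ω x y) s t s' t' =
      ∫ y in t..t', ∫ x in s..s', sheetIntegrand L θ ω x y := by
  have hin : ∀ a b y : ℝ, IntervalIntegrable (fun x => sheetIntegrand L θ ω x y) volume a b := by
    intro a b y
    rw [intervalIntegrable_iff]
    refine Measure.integrableOn_of_bounded (M := max (max |a| |b|) |y|) (by simp)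
      ((measurable_sheetIntegrand_pair hL θ ω).comp
        (measurable_prodMk_right (y := y))).aestronglyMeasurable ?_
    exact (ae_restrict_iff' measurableSet_uIoc).2 (ae_of_all _ fun x hx =>
      norm_sheetIntegrand_le θ ω x _ ((abs_le_of_mem_uIoc (le_max_left _ _) (le_max_right _ _)
        hx).trans (le_max_left _ _)) (le_max_right _ _))
  have hout : ∀ c a b : ℝ, IntervalIntegrable
      (fun y => ∫ x in (0 : ℝ)..c, sheetIntegrand L θ ω x y) volume a b := by
    intro c a b
    rw [intervalIntegrable_iff]
    refine Measure.integrableOn_of_bounded (M := max |c| (max |a| |b|) * |c - 0|) (by simp)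
      ((stronglyMeasurable_inner hL θ c).comp_measurable
        (measurable_prodMk_left (x := ω))).aestronglyMeasurable ?_
    exact (ae_restrict_iff' measurableSet_uIoc).2 (ae_of_all _ fun y hy =>
      intervalIntegral.norm_integral_le_of_norm_le_const fun x hx =>
        norm_sheetIntegrand_le θ ω x _ (abs_le_of_mem_uIoc (by simp) (le_max_left _ _) hx)
          ((abs_le_of_mem_uIoc (le_max_left _ _) (le_max_right _ _) hy).trans (le_max_right _ _)))
  have hdiff : ∀ y, ∫ x in s..s', sheetIntegrand L θ ω x y =
      (∫ x in (0 : ℝ)..s', sheetIntegrand L θ ω x y) -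
        ∫ x in (0 : ℝ)..s, sheetIntegrand L θ ω x y := fun y =>
    (intervalIntegral.integral_interval_sub_left (hin _ _ _) (hin _ _ _)).symm
  simp_rw [hdiff]
  rw [intervalIntegral.integral_sub (hout _ _ _) (hout _ _ _),
    ← intervalIntegral.integral_interval_sub_left (hout s' 0 t') (hout s' 0 t),
    ← intervalIntegral.integral_interval_sub_left (hout s 0 t') (hout s 0 t), rectIncr]
  ring

theorem measurable_rescaledSheet
    (hL : Measurable fun p : (ℝ≥0 × ℝ≥0) × Ω => L p.1.1 p.1.2 p.2) (ε : ℝ≥0) :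
    Measurable fun p : (ℝ≥0 × ℝ≥0) × Ω => rescaledSheet L ε p.1.1 p.1.2 p.2 :=
  hL.comp (g := fun p : (ℝ≥0 × ℝ≥0) × Ω => L p.1.1 p.1.2 p.2)
    (f := fun p : (ℝ≥0 × ℝ≥0) × Ω => ((p.1.1 / ε, p.1.2 / ε), p.2)) (by fun_prop)

theorem rectIncr_approxField
    (hL : Measurable fun p : (ℝ≥0 × ℝ≥0) × Ω => L p.1.1 p.1.2 p.2) (Ψ : ℝ → ℂ) (θ : ℝ) (ω : Ω)
    {ε : ℝ≥0} (hε : 0 < ε) {s s' t t' : ℝ} (hs : 0 ≤ s) (ht : 0 ≤ t) (hss' : s ≤ s')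
    (htt' : t ≤ t') :
    rectIncr (approxField L Ψ θ ε ω) s t s' t' =
      ((sheetConst Ψ θ * ((ε : ℝ) ^ 2)⁻¹ : ℝ) : ℂ) *
        blockIntegral (rescaledSheet L ε) θ s s' t t' ω := by
  rw [← intervalIntegral_sheetIntegrand_eq (measurable_rescaledSheet hL ε) θ ω hs ht hss' htt',
    ← rectIncr_intervalIntegral (measurable_rescaledSheet hL ε)]
  simp only [rectIncr, approxField_eq Ψ θ ω hε]
  ring

theorem aestronglyMeasurable_leftSigma_blockIntegral {P : Measure Ω} [IsProbabilityMeasure P]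
    (hL : Measurable fun p : (ℝ≥0 × ℝ≥0) × Ω => L p.1.1 p.1.2 p.2)
    {r : ℝ≥0} (hr : leftSigma L r ≤ ‹MeasurableSpace Ω›) (θ : ℝ) {u v : ℝ} (hur : u ≤ r) :
    AEStronglyMeasurable[leftSigma L r] (blockIntegral L θ 0 u 0 v) P := by
  refine aestronglyMeasurable_integral_complex_of_forall hr
    (f := fun z ω => (blockWeight 0 u 0 v z : ℂ) * sheetPhase L θ z ω)
    (C := max 0 (max u v)) ?_ ?_ ?_
  · exact ((Complex.measurable_ofReal.comp (measurable_blockWeight.comp measurable_snd)).mul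
      (measurable_sheetPhase hL θ)).stronglyMeasurable
  · intro z ω
    rw [norm_mul, norm_sheetPhase, mul_one, Complex.norm_real,
      Real.norm_of_nonneg (blockWeight_nonneg z)]
    exact blockWeight_le le_rfl le_rfl (le_max_left _ _)
      ((le_max_left _ _).trans (le_max_right _ _)) ((le_max_right _ _).trans (le_max_right _ _)) z
  · intro z
    by_cases hz : z ∈ Ioo 0 u ×ˢ Ioo 0 v
    · have hzr : z.1.toNNReal ≤ r :=
        Real.toNNReal_le_iff_le_coe.2 (hz.1.2.le.trans hur)
      have hm : Measurable[leftSigma L r] (sheetPhase L θ z) :=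
        Complex.measurable_exp.comp ((Complex.measurable_ofReal.comp
          ((measurable_leftSigma L hzr _).const_mul θ)).const_mul Complex.I)
      exact (hm.const_mul _).stronglyMeasurable
    · simp only [blockWeight_of_notMem hz, Complex.ofReal_zero, zero_mul]
      exact stronglyMeasurable_const

/-- The approximating field at abscissas `u ≤ r` depends only on the rescaled sheet to the left of `r`. -/
theorem aestronglyMeasurable_leftSigma_approxField {P : Measure Ω} [IsProbabilityMeasure P]
    {Ψ : ℝ → ℂ} (hP : IsLevySheet P L Ψ)
    (hL : Measurable fun p : (ℝ≥0 × ℝ≥0) × Ω => L p.1.1 p.1.2 p.2) (θ : ℝ) {ε : ℝ≥0}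
    (hε : 0 < ε) {r : ℝ≥0} {u v : ℝ} (hu : 0 ≤ u) (hv : 0 ≤ v) (hur : u ≤ r) :
    AEStronglyMeasurable[leftSigma (rescaledSheet L ε) r]
      (fun ω => approxField L Ψ θ ε ω u v) P := by
  have h := aestronglyMeasurable_leftSigma_blockIntegral (P := P) (measurable_rescaledSheet hL ε)
    ((hP.rescale hε).leftSigma_le r) θ (v := v) hur
  refine (h.const_mul ((sheetConst Ψ θ * ((ε : ℝ) ^ 2)⁻¹ : ℝ) : ℂ)).congr (ae_of_all _ fun ω => ?_)
  simp only
  rw [approxField_eq Ψ θ ω hε,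
    intervalIntegral_sheetIntegrand_eq (measurable_rescaledSheet hL ε) θ ω le_rfl le_rfl hu hv]

end Identification

/-! ### Asymptotics of second moments against functionals of the past -/

theorem re_sq_eq_half (z : ℂ) : z.re ^ 2 = ((z * (starRingEnd ℂ) z).re + (z ^ 2).re) / 2 := by
  rw [Complex.mul_conj, Complex.ofReal_re, Complex.normSq_apply, sq z, Complex.mul_re]
  ring

theorem im_sq_eq_half (z : ℂ) : z.im ^ 2 = ((z * (starRingEnd ℂ) z).re - (z ^ 2).re) / 2 := by
  rw [Complex.mul_conj, Complex.ofReal_re, Complex.normSq_apply, sq z, Complex.mul_re]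
  ring

namespace IsLevySheet

variable {Ω : Type*} [MeasurableSpace Ω] {P : Measure Ω} [IsProbabilityMeasure P]
  {L : ℝ≥0 → ℝ≥0 → Ω → ℝ} {Ψ : ℝ → ℂ} {θ s s' t t' : ℝ} {ε : ℕ → ℝ≥0}

/-- The fourth moments of the increments of the approximating field are bounded. -/
theorem exists_integral_norm_rectIncr_pow_four_le (hL : IsLevySheet P L Ψ)
    (hmeas : Measurable fun p : (ℝ≥0 × ℝ≥0) × Ω => L p.1.1 p.1.2 p.2)
    (ha : 0 < (Ψ θ).re) (hs : 0 < s) (ht : 0 < t) (hss' : s ≤ s') (htt' : t ≤ t') :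
    ∃ B : ℝ, ∀ ε : ℝ≥0, 0 < ε →
      ∫ ω, ‖rectIncr (approxField L Ψ θ ε ω) s t s' t'‖ ^ 4 ∂P ≤ B := by
  set R : ℝ := max s' t' with hR
  refine ⟨sheetConst Ψ θ ^ 4 * (R ^ 4 * ((3 * ((s' - s) * (2 / ((Ψ θ).re * t))) ^ 2) *
        (3 * ((t' - t) * (2 / ((Ψ θ).re * s))) ^ 2))), fun ε hε => ?_⟩
  have hε' : (0 : ℝ) < ε := hε
  have ha' : 0 < (((((ε : ℝ) ^ 2)⁻¹ : ℝ) : ℂ) * Ψ θ).re := by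
    rw [Complex.re_ofReal_mul]; positivity
  have h := (hL.rescale hε).integral_norm_blockIntegral_pow_four_le (θ := θ)
    (measurable_rescaledSheet hmeas ε) hs ht hss' htt' (le_max_left s' t') (le_max_right s' t') ha'
  rw [Complex.re_ofReal_mul] at h
  have e : ∀ ω, ‖rectIncr (approxField L Ψ θ ε ω) s t s' t'‖ ^ 4 =
      (sheetConst Ψ θ * ((ε : ℝ) ^ 2)⁻¹) ^ 4 *
        ‖blockIntegral (rescaledSheet L ε) θ s s' t t' ω‖ ^ 4 := by
    intro ω
    rw [rectIncr_approxField hmeas Ψ θ ω hε hs.le ht.le hss' htt', norm_mul, mul_pow,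
      Complex.norm_real, Real.norm_eq_abs, Even.pow_abs (by decide)]
  simp_rw [e]
  rw [integral_const_mul]
  refine (mul_le_mul_of_nonneg_left h (by positivity)).trans_eq ?_
  rw [hR]
  field_simp

/-- The constant in the limit comes from `K² (2a/|Ψ(θ)|²)² = 2`. -/
theorem tendsto_sq_mul_integral_normSq (hL : IsLevySheet P L Ψ)
    (hmeas : Measurable fun p : (ℝ≥0 × ℝ≥0) × Ω => L p.1.1 p.1.2 p.2)
    (ha : 0 < (Ψ θ).re) (hs : 0 < s) (ht : 0 < t) (hss' : s ≤ s') (htt' : t ≤ t')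
    (hε : ∀ n, 0 < ε n) (hε0 : Tendsto (fun n => (ε n : ℝ)) atTop (𝓝 0)) :
    Tendsto (fun n => (((sheetConst Ψ θ * ((ε n : ℝ) ^ 2)⁻¹) ^ 2 : ℝ) : ℂ) *
      ∫ ω, blockIntegral (rescaledSheet L (ε n)) θ s s' t t' ω *
        (starRingEnd ℂ) (blockIntegral (rescaledSheet L (ε n)) θ s s' t t' ω) ∂P) atTop
      (𝓝 ((2 * ((s' - s) * (t' - t)) : ℝ) : ℂ)) := by
  have h := tendsto_integral_phaseCovariance ha hs ht hss' htt' (δ := fun n => (ε n : ℝ) ^ 2)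
    (fun n => by have : (0 : ℝ) < ε n := hε n
                 positivity) (by simpa using hε0.pow 2)
  have h2 := h.const_mul ((sheetConst Ψ θ ^ 2 : ℝ) : ℂ)
  have e : (sheetConst Ψ θ ^ 2) * ((s' - s) * (t' - t) *
      (2 * (Ψ θ).re / ((Ψ θ).re ^ 2 + (Ψ θ).im ^ 2)) ^ 2) = 2 * ((s' - s) * (t' - t)) := by
    have hp : 0 < (Ψ θ).re ^ 2 + (Ψ θ).im ^ 2 := by positivity
    rw [sheetConst, mul_pow, div_pow, one_pow, Real.sq_sqrt (by norm_num)]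
    field_simp
  rw [← Complex.ofReal_mul, e] at h2
  refine h2.congr fun n => ?_
  rw [(hL.rescale (hε n)).integral_normSq_blockIntegral (measurable_rescaledSheet hmeas (ε n))
    hs.le ht.le hss']
  push_cast
  ring

/-- The squared modulus of an increment is asymptotically uncorrelated with the past. -/
theorem tendsto_integral_mul_normSq_sub (hL : IsLevySheet P L Ψ)
    (hmeas : Measurable fun p : (ℝ≥0 × ℝ≥0) × Ω => L p.1.1 p.1.2 p.2)
    (ha : 0 < (Ψ θ).re) {r : ℝ≥0} (hrs : (r : ℝ) < s) (ht : 0 < t) (hss' : s ≤ s') (htt' : t ≤ t')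
    (hε : ∀ n, 0 < ε n) (hε0 : Tendsto (fun n => (ε n : ℝ)) atTop (𝓝 0))
    {F : ℕ → Ω → ℂ} (hF : ∀ n, AEStronglyMeasurable[leftSigma (rescaledSheet L (ε n)) r] (F n) P)
    {C : ℝ} (hC : ∀ n ω, ‖F n ω‖ ≤ C) :
    Tendsto (fun n => (((sheetConst Ψ θ * ((ε n : ℝ) ^ 2)⁻¹) ^ 2 : ℝ) : ℂ) *
      (∫ ω, F n ω * (blockIntegral (rescaledSheet L (ε n)) θ s s' t t' ω *
        (starRingEnd ℂ) (blockIntegral (rescaledSheet L (ε n)) θ s s' t t' ω)) ∂P -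
      (∫ ω, F n ω ∂P) * ∫ ω, blockIntegral (rescaledSheet L (ε n)) θ s s' t t' ω *
        (starRingEnd ℂ) (blockIntegral (rescaledSheet L (ε n)) θ s s' t t' ω) ∂P)) atTop (𝓝 0) := by
  have hC0 : 0 ≤ C := by
    obtain ⟨ω⟩ := nonempty_of_isProbabilityMeasure P
    exact (norm_nonneg _).trans (hC 0 ω)
  set R : ℝ := max s' t' with hR
  set c : ℝ := (Ψ θ).re * min t (s - r) / 2 with hc
  have hm0 : 0 < min t (s - r) := lt_min ht (sub_pos.2 hrs)
  have hc0 : 0 < c := by positivity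
  set D : ℝ := sheetConst Ψ θ ^ 4 * (C ^ 2 * (4 * R ^ 4 * ((s' - s) ^ 2 * (t' - t) * (2 / c) ^ 5)))
    with hD
  have hb : ∀ n, ‖(((sheetConst Ψ θ * ((ε n : ℝ) ^ 2)⁻¹) ^ 2 : ℝ) : ℂ) *
      (∫ ω, F n ω * (blockIntegral (rescaledSheet L (ε n)) θ s s' t t' ω *
        (starRingEnd ℂ) (blockIntegral (rescaledSheet L (ε n)) θ s s' t t' ω)) ∂P -
      (∫ ω, F n ω ∂P) * ∫ ω, blockIntegral (rescaledSheet L (ε n)) θ s s' t t' ω *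
        (starRingEnd ℂ) (blockIntegral (rescaledSheet L (ε n)) θ s s' t t' ω) ∂P)‖ ^ 2 ≤
      D * (ε n : ℝ) ^ 2 := by
    intro n
    have hε' : (0 : ℝ) < ε n := hε n
    have hκ : 0 < ((ε n : ℝ) ^ 2)⁻¹ * c := by positivity
    have hκ1 : 2 * (((ε n : ℝ) ^ 2)⁻¹ * c) ≤ (((((ε n : ℝ) ^ 2)⁻¹ : ℝ) : ℂ) * Ψ θ).re * t := by
      rw [Complex.re_ofReal_mul, hc]
      calc 2 * (((ε n : ℝ) ^ 2)⁻¹ * ((Ψ θ).re * min t (s - r) / 2)) =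
          ((ε n : ℝ) ^ 2)⁻¹ * (Ψ θ).re * min t (s - r) := by ring
        _ ≤ _ := by gcongr; exact min_le_left _ _
    have hκ2 : 2 * (((ε n : ℝ) ^ 2)⁻¹ * c) ≤
        (((((ε n : ℝ) ^ 2)⁻¹ : ℝ) : ℂ) * Ψ θ).re * (s - r) := by
      rw [Complex.re_ofReal_mul, hc]
      calc 2 * (((ε n : ℝ) ^ 2)⁻¹ * ((Ψ θ).re * min t (s - r) / 2)) =
          ((ε n : ℝ) ^ 2)⁻¹ * (Ψ θ).re * min t (s - r) := by ring
        _ ≤ _ := by gcongr; exact min_le_right _ _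
    have h := (hL.rescale (hε n)).sq_norm_integral_mul_normSq_sub_le (θ := θ)
      (measurable_rescaledSheet hmeas (ε n)) hrs.le ht.le hss' htt' (le_max_left s' t')
      (le_max_right s' t') hκ hκ1 hκ2 (hF n) hC0 (hC n)
    rw [norm_mul, mul_pow, Complex.norm_real, Real.norm_of_nonneg (by positivity)]
    refine (mul_le_mul_of_nonneg_left h (by positivity)).trans_eq ?_
    rw [hD, hR]
    field_simp
  have hlim : Tendsto (fun n => √(D * (ε n : ℝ) ^ 2)) atTop (𝓝 0) := by
    have : Tendsto (fun n => D * (ε n : ℝ) ^ 2) atTop (𝓝 0) := by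
      simpa using (hε0.pow 2).const_mul D
    simpa using this.sqrt
  exact squeeze_zero_norm (fun n => Real.le_sqrt_of_sq_le (hb n)) hlim

/-- The prefactor is polynomial in `ε⁻¹`, the moment is exponentially small in `ε⁻²`. -/
theorem tendsto_integral_mul_sq (hL : IsLevySheet P L Ψ)
    (hmeas : Measurable fun p : (ℝ≥0 × ℝ≥0) × Ω => L p.1.1 p.1.2 p.2)
    (ha : 0 < (Ψ (2 * θ)).re) {r : ℝ≥0} (hrs : (r : ℝ) < s) (ht : 0 < t) (hss' : s ≤ s')
    (htt' : t ≤ t') (hε : ∀ n, 0 < ε n) (hε0 : Tendsto (fun n => (ε n : ℝ)) atTop (𝓝 0))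
    {F : ℕ → Ω → ℂ} (hF : ∀ n, AEStronglyMeasurable[leftSigma (rescaledSheet L (ε n)) r] (F n) P)
    {C : ℝ} (hC : ∀ n ω, ‖F n ω‖ ≤ C) :
    Tendsto (fun n => (((sheetConst Ψ θ * ((ε n : ℝ) ^ 2)⁻¹) ^ 2 : ℝ) : ℂ) *
      ∫ ω, F n ω * blockIntegral (rescaledSheet L (ε n)) θ s s' t t' ω ^ 2 ∂P) atTop (𝓝 0) := by
  have hC0 : 0 ≤ C := by
    obtain ⟨ω⟩ := nonempty_of_isProbabilityMeasure P
    exact (norm_nonneg _).trans (hC 0 ω)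
  set R : ℝ := max s' t' with hR
  set c : ℝ := (Ψ (2 * θ)).re * (s - r) * t with hc
  have hc0 : 0 < c := mul_pos (mul_pos ha (sub_pos.2 hrs)) ht
  set D : ℝ := sheetConst Ψ θ ^ 2 * (R ^ 2 * C * ((s' - s) * (t' - t)) ^ 2) / c ^ 2 with hD
  have hb : ∀ n, ‖(((sheetConst Ψ θ * ((ε n : ℝ) ^ 2)⁻¹) ^ 2 : ℝ) : ℂ) *
      ∫ ω, F n ω * blockIntegral (rescaledSheet L (ε n)) θ s s' t t' ω ^ 2 ∂P‖ ≤
      D * ((c * ((ε n : ℝ) ^ 2)⁻¹) ^ 2 * Real.exp (-(c * ((ε n : ℝ) ^ 2)⁻¹))) := by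
    intro n
    have hε' : (0 : ℝ) < ε n := hε n
    have h := (hL.rescale (hε n)).norm_integral_mul_sq_le (θ := θ)
      (measurable_rescaledSheet hmeas (ε n)) hrs.le ht.le hss' htt' (le_max_left s' t')
      (le_max_right s' t') (hF n) hC0 (hC n)
    rw [norm_mul, Complex.norm_real, Real.norm_of_nonneg (by positivity)]
    refine (mul_le_mul_of_nonneg_left h (by positivity)).trans_eq ?_
    rw [hD, hR, Complex.re_ofReal_mul]
    have e : -(((ε n : ℝ) ^ 2)⁻¹ * (Ψ (2 * θ)).re * (s - r)) * t = -(c * ((ε n : ℝ) ^ 2)⁻¹) := by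
      rw [hc]; ring
    rw [e]
    field_simp
  have hinf : Tendsto (fun n => c * ((ε n : ℝ) ^ 2)⁻¹) atTop atTop := by
    refine Tendsto.const_mul_atTop hc0 (Tendsto.inv_tendsto_nhdsGT_zero ?_)
    refine tendsto_nhdsWithin_iff.2 ⟨by simpa using hε0.pow 2, Eventually.of_forall fun n => ?_⟩
    exact pow_pos (NNReal.coe_pos.2 (hε n)) 2
  have hlim := ((Real.tendsto_pow_mul_exp_neg_atTop_nhds_zero 2).comp hinf).const_mul D
  rw [mul_zero] at hlim
  exact squeeze_zero_norm hb hlim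

/-- Against bounded functionals of the past, the squared real and imaginary parts of an increment of
the approximating field behave asymptotically like the area of the rectangle: half of the squared
modulus, the square of the complex increment being negligible. -/
theorem tendsto_integral_mul_sq_rectIncr (hL : IsLevySheet P L Ψ)
    (hmeas : Measurable fun p : (ℝ≥0 × ℝ≥0) × Ω => L p.1.1 p.1.2 p.2)
    (ha : 0 < (Ψ θ).re) (ha2 : 0 < (Ψ (2 * θ)).re) {r : ℝ≥0} (hrs : (r : ℝ) < s) (ht : 0 < t)
    (hss' : s ≤ s') (htt' : t ≤ t')
    (hε : ∀ n, 0 < ε n) (hε0 : Tendsto (fun n => (ε n : ℝ)) atTop (𝓝 0))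
    {F : ℕ → Ω → ℝ} (hF : ∀ n, AEStronglyMeasurable[leftSigma (rescaledSheet L (ε n)) r] (F n) P)
    {C : ℝ} (hC : ∀ n ω, |F n ω| ≤ C) :
    Tendsto (fun n => ∫ ω, F n ω * (rectIncr (approxField L Ψ θ (ε n) ω) s t s' t').re ^ 2 ∂P -
      (s' - s) * (t' - t) * ∫ ω, F n ω ∂P) atTop (𝓝 0) ∧
    Tendsto (fun n => ∫ ω, F n ω * (rectIncr (approxField L Ψ θ (ε n) ω) s t s' t').im ^ 2 ∂P -
      (s' - s) * (t' - t) * ∫ ω, F n ω ∂P) atTop (𝓝 0) := by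
  have hs : 0 < s := r.coe_nonneg.trans_lt hrs
  have hF' : ∀ n, AEStronglyMeasurable[leftSigma (rescaledSheet L (ε n)) r]
      (fun ω => (F n ω : ℂ)) P := fun n => Complex.continuous_ofReal.comp_aestronglyMeasurable (hF n)
  have hC' : ∀ n ω, ‖(F n ω : ℂ)‖ ≤ C := fun n ω => by
    rw [Complex.norm_real, Real.norm_eq_abs]; exact hC n ω
  have hFm : ∀ n, AEStronglyMeasurable (F n) P := fun n =>
    (hF n).mono ((hL.rescale (hε n)).leftSigma_le r)
  set A : ℕ → ℝ := fun n => (sheetConst Ψ θ * ((ε n : ℝ) ^ 2)⁻¹) ^ 2 with hA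
  set Y : ℕ → Ω → ℂ := fun n => blockIntegral (rescaledSheet L (ε n)) θ s s' t t' with hY
  have hYm : ∀ n, StronglyMeasurable (Y n) := fun n =>
    measurable_blockIntegral (measurable_rescaledSheet hmeas (ε n)) θ s s' t t'
  obtain ⟨M, hM⟩ : ∃ M, ∀ n ω, ‖Y n ω‖ ≤ M := ⟨_, fun n ω =>
    norm_blockIntegral_le hs.le ht.le (hs.le.trans (hss'.trans (le_max_left s' t')))
      (le_max_left s' t') (le_max_right s' t') ω⟩
  have hG1 : ∀ n, Integrable (fun ω => (F n ω : ℂ) * (Y n ω * (starRingEnd ℂ) (Y n ω))) P := by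
    intro n
    refine Integrable.of_bound (C := C * (M * M))
      ((Complex.continuous_ofReal.comp_aestronglyMeasurable (hFm n)).mul
      ((hYm n).aestronglyMeasurable.mul (Complex.continuous_conj.comp_aestronglyMeasurable
        (hYm n).aestronglyMeasurable))) (ae_of_all _ fun ω => ?_)
    rw [norm_mul, norm_mul, RCLike.norm_conj]
    exact mul_le_mul (hC' n ω) (mul_le_mul (hM n ω) (hM n ω) (norm_nonneg _)
      ((norm_nonneg _).trans (hM n ω))) (by positivity) ((norm_nonneg _).trans (hC' n ω))
  have hG2 : ∀ n, Integrable (fun ω => (F n ω : ℂ) * Y n ω ^ 2) P := by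
    intro n
    refine Integrable.of_bound (C := C * (M * M))
      ((Complex.continuous_ofReal.comp_aestronglyMeasurable (hFm n)).mul
      ((hYm n).aestronglyMeasurable.pow 2)) (ae_of_all _ fun ω => ?_)
    rw [norm_mul, sq, norm_mul]
    exact mul_le_mul (hC' n ω) (mul_le_mul (hM n ω) (hM n ω) (norm_nonneg _)
      ((norm_nonneg _).trans (hM n ω))) (by positivity) ((norm_nonneg _).trans (hC' n ω))
  have h1 := hL.tendsto_integral_mul_normSq_sub hmeas ha hrs ht hss' htt' hε hε0 hF' hC'
  have h2 := hL.tendsto_integral_mul_sq hmeas ha2 hrs ht hss' htt' hε hε0 hF' hC'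
  have h3 := hL.tendsto_sq_mul_integral_normSq hmeas ha hs ht hss' htt' hε hε0
  have h4 : Tendsto (fun n => (∫ ω, (F n ω : ℂ) ∂P) * ((A n : ℂ) *
      (∫ ω, Y n ω * (starRingEnd ℂ) (Y n ω) ∂P) - ((2 * ((s' - s) * (t' - t)) : ℝ) : ℂ)))
      atTop (𝓝 0) := by
    have h3' := (h3.sub_const ((2 * ((s' - s) * (t' - t)) : ℝ) : ℂ)).norm.const_mul C
    rw [sub_self, norm_zero, mul_zero] at h3'
    refine squeeze_zero_norm (fun n => ?_) h3'
    rw [norm_mul]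
    gcongr
    exact (norm_integral_le_of_norm_le_const (ae_of_all _ (hC' n))).trans_eq (by simp)
  have h5 : Tendsto (fun n => (A n : ℂ) * (∫ ω, (F n ω : ℂ) * (Y n ω * (starRingEnd ℂ) (Y n ω)) ∂P) -
      ((2 * ((s' - s) * (t' - t)) : ℝ) : ℂ) * ∫ ω, (F n ω : ℂ) ∂P) atTop (𝓝 0) := by
    have := h1.add h4
    rw [add_zero] at this
    refine this.congr fun n => ?_
    simp only [hA, hY]
    ring
  have h5r := (Complex.continuous_re.tendsto 0).comp h5
  have h2r := (Complex.continuous_re.tendsto 0).comp h2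
  have hmom : ∀ n, (∫ ω, F n ω * (Y n ω * (starRingEnd ℂ) (Y n ω)).re ∂P =
        (∫ ω, (F n ω : ℂ) * (Y n ω * (starRingEnd ℂ) (Y n ω)) ∂P).re) ∧
      (∫ ω, F n ω * (Y n ω ^ 2).re ∂P = (∫ ω, (F n ω : ℂ) * Y n ω ^ 2 ∂P).re) ∧
      Integrable (fun ω => F n ω * (Y n ω * (starRingEnd ℂ) (Y n ω)).re) P ∧
      Integrable (fun ω => F n ω * (Y n ω ^ 2).re) P := by
    intro n
    have a1 := integral_re (hG1 n)
    have a2 := integral_re (hG2 n)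
    have b1 := (hG1 n).re
    have b2 := (hG2 n).re
    simp only [RCLike.re_to_complex, Complex.re_ofReal_mul] at a1 a2 b1 b2
    exact ⟨a1, a2, b1, b2⟩
  have hincr : ∀ n ω, rectIncr (approxField L Ψ θ (ε n) ω) s t s' t' =
      ((sheetConst Ψ θ * ((ε n : ℝ) ^ 2)⁻¹ : ℝ) : ℂ) * Y n ω := fun n ω =>
    rectIncr_approxField hmeas Ψ θ ω (hε n) hs.le ht.le hss' htt'
  have hreF : ∀ n, (∫ ω, (F n ω : ℂ) ∂P).re = ∫ ω, F n ω ∂P := fun n => by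
    rw [integral_complex_ofReal, Complex.ofReal_re]
  constructor
  · have hlim := (h5r.add h2r).const_mul (1 / 2)
    simp only [Complex.zero_re, add_zero, mul_zero] at hlim
    refine hlim.congr fun n => ?_
    obtain ⟨a1, a2, b1, b2⟩ := hmom n
    have e : ∀ ω, F n ω * (rectIncr (approxField L Ψ θ (ε n) ω) s t s' t').re ^ 2 =
        A n / 2 * (F n ω * (Y n ω * (starRingEnd ℂ) (Y n ω)).re + F n ω * (Y n ω ^ 2).re) := by
      intro ω
      rw [hincr, Complex.re_ofReal_mul, mul_pow, re_sq_eq_half]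
      simp only [hA]
      ring
    simp_rw [e]
    rw [integral_const_mul, integral_add b1 b2, a1, a2]
    simp only [Function.comp, Complex.sub_re, Complex.re_ofReal_mul, hreF]
    simp only [hA, hY]
    ring
  · have hlim := (h5r.sub h2r).const_mul (1 / 2)
    simp only [Complex.zero_re, sub_zero, mul_zero] at hlim
    refine hlim.congr fun n => ?_
    obtain ⟨a1, a2, b1, b2⟩ := hmom n
    have e : ∀ ω, F n ω * (rectIncr (approxField L Ψ θ (ε n) ω) s t s' t').im ^ 2 =
        A n / 2 * (F n ω * (Y n ω * (starRingEnd ℂ) (Y n ω)).re - F n ω * (Y n ω ^ 2).re) := by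
      intro ω
      rw [hincr, Complex.im_ofReal_mul, mul_pow, im_sq_eq_half]
      simp only [hA]
      ring
    simp_rw [e]
    rw [integral_const_mul, integral_sub b1 b2, a1, a2]
    simp only [Function.comp, Complex.sub_re, Complex.re_ofReal_mul, hreF]
    simp only [hA, hY]
    ring

end IsLevySheet

/-! ### Passage to the weak limit -/

section WeakLimit

variable {E : Type*} [TopologicalSpace E] [MeasurableSpace E] [OpensMeasurableSpace E]
  {μs : ℕ → ProbabilityMeasure E} {μ : ProbabilityMeasure E}

theorem tendsto_integral_of_continuous_of_bounded (hμ : Tendsto μs atTop (𝓝 μ)) {f : E → ℝ}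
    (hf : Continuous f) {C : ℝ} (hC : ∀ x, |f x| ≤ C) :
    Tendsto (fun n => ∫ x, f x ∂(μs n : Measure E)) atTop (𝓝 (∫ x, f x ∂(μ : Measure E))) :=
  ProbabilityMeasure.tendsto_iff_forall_integral_tendsto.1 hμ
    (BoundedContinuousFunction.ofNormedAddCommGroup f hf C hC)

theorem abs_sub_clip_le {M : ℝ} (hM : 0 < M) (a : ℝ) :
    |a - max (-M) (min M a)| ≤ a ^ 2 / M := by
  rw [le_div_iff₀ hM]
  rcases le_total a M with h1 | h1
  · rw [min_eq_right h1]
    rcases le_total (-M) a with h2 | h2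
    · rw [max_eq_right h2, sub_self, abs_zero, zero_mul]; positivity
    · rw [max_eq_left h2, abs_of_nonpos (by linarith)]; nlinarith
  · rw [min_eq_left h1, max_eq_right (by linarith), abs_of_nonneg (by linarith)]; nlinarith

theorem integrable_sq_of_tendsto (hμ : Tendsto μs atTop (𝓝 μ)) {f : E → ℝ} (hf : Continuous f)
    {B : ℝ} (hi : ∀ n, Integrable (fun x => f x ^ 2) (μs n : Measure E))
    (hB : ∀ n, ∫ x, f x ^ 2 ∂(μs n : Measure E) ≤ B) :
    Integrable (fun x => f x ^ 2) (μ : Measure E) ∧ ∫ x, f x ^ 2 ∂(μ : Measure E) ≤ B := by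
  have hB0 : 0 ≤ B := (integral_nonneg fun x => sq_nonneg (f x)).trans (hB 0)
  have hcont : ∀ M : ℝ, Continuous fun x => min (f x ^ 2) M := fun M => by fun_prop
  have hbd : ∀ M : ℝ, 0 ≤ M → ∀ x, |min (f x ^ 2) M| ≤ M := fun M hM x => by
    rw [abs_of_nonneg (le_min (sq_nonneg _) hM)]; exact min_le_right _ _
  have htr : ∀ M : ℝ, 0 ≤ M → ∫ x, min (f x ^ 2) M ∂(μ : Measure E) ≤ B := fun M hM =>
    le_of_tendsto' (tendsto_integral_of_continuous_of_bounded hμ (hcont M) (hbd M hM)) fun n =>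
      (integral_mono_of_nonneg (ae_of_all _ fun x => le_min (sq_nonneg _) hM) (hi n)
        (ae_of_all _ fun x => min_le_left _ _)).trans (hB n)
  have hlim : Tendsto (fun k : ℕ => ∫⁻ x, ENNReal.ofReal (min (f x ^ 2) k) ∂(μ : Measure E)) atTop
      (𝓝 (∫⁻ x, ENNReal.ofReal (f x ^ 2) ∂(μ : Measure E))) := by
    refine lintegral_tendsto_of_tendsto_of_monotone
      (fun k => (hcont k).measurable.ennreal_ofReal.aemeasurable) (ae_of_all _ fun x k l hkl => ?_)
      (ae_of_all _ fun x => ?_)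
    · exact ENNReal.ofReal_le_ofReal (min_le_min_left _ (Nat.cast_le.2 hkl))
    · refine tendsto_const_nhds.congr' ?_
      filter_upwards [eventually_ge_atTop ⌈f x ^ 2⌉₊] with k hk
      rw [min_eq_left (Nat.ceil_le.1 hk)]
  have hle : ∫⁻ x, ENNReal.ofReal (f x ^ 2) ∂(μ : Measure E) ≤ ENNReal.ofReal B := by
    refine le_of_tendsto' hlim fun k => ?_
    have hik : Integrable (fun x => min (f x ^ 2) (k : ℝ)) (μ : Measure E) :=
      Integrable.of_bound (hcont k).measurable.aestronglyMeasurable k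
        (ae_of_all _ (hbd k k.cast_nonneg))
    rw [← ofReal_integral_eq_lintegral_ofReal hik
      (ae_of_all _ fun x => le_min (sq_nonneg _) k.cast_nonneg)]
    exact ENNReal.ofReal_le_ofReal (htr k k.cast_nonneg)
  have hint : Integrable (fun x => f x ^ 2) (μ : Measure E) :=
    (lintegral_ofReal_ne_top_iff_integrable (hf.pow 2).measurable.aestronglyMeasurable
      (ae_of_all _ fun x => sq_nonneg _)).1 (hle.trans_lt ENNReal.ofReal_lt_top).ne
  refine ⟨hint, ?_⟩
  rw [← ofReal_integral_eq_lintegral_ofReal hint (ae_of_all _ fun x => sq_nonneg _)] at hle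
  exact (ENNReal.ofReal_le_ofReal_iff hB0).1 hle

/-- Weak convergence passes to integrals of a continuous function with bounded second moments. -/
theorem integrable_and_tendsto_of_sq_bounded (hμ : Tendsto μs atTop (𝓝 μ)) {f : E → ℝ}
    (hf : Continuous f) {B : ℝ} (hi : ∀ n, Integrable (fun x => f x ^ 2) (μs n : Measure E))
    (hB : ∀ n, ∫ x, f x ^ 2 ∂(μs n : Measure E) ≤ B) :
    Integrable f (μ : Measure E) ∧
      Tendsto (fun n => ∫ x, f x ∂(μs n : Measure E)) atTop (𝓝 (∫ x, f x ∂(μ : Measure E))) := by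
  have hB0 : 0 ≤ B := (integral_nonneg fun x => sq_nonneg (f x)).trans (hB 0)
  obtain ⟨hiμ, hBμ⟩ := integrable_sq_of_tendsto hμ hf hi hB
  have hfi : ∀ ν : ProbabilityMeasure E, Integrable (fun x => f x ^ 2) (ν : Measure E) →
      Integrable f (ν : Measure E) := fun ν h =>
    ((memLp_two_iff_integrable_sq hf.measurable.aestronglyMeasurable).2 h).integrable
      one_le_two
  have hcont : ∀ M : ℝ, Continuous fun x => max (-M) (min M (f x)) := fun M => by fun_prop
  have hbd : ∀ M : ℝ, 0 ≤ M → ∀ x, |max (-M) (min M (f x))| ≤ M := fun M hM x =>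
    abs_le.2 ⟨le_max_left _ _, max_le (by linarith) (min_le_left _ _)⟩
  have hclip : ∀ M : ℝ, 0 < M → ∀ ν : ProbabilityMeasure E,
      Integrable (fun x => f x ^ 2) (ν : Measure E) → ∫ x, f x ^ 2 ∂(ν : Measure E) ≤ B →
      |∫ x, f x ∂(ν : Measure E) - ∫ x, max (-M) (min M (f x)) ∂(ν : Measure E)| ≤ B / M := by
    intro M hM ν h1 h2
    have hci : Integrable (fun x => max (-M) (min M (f x))) (ν : Measure E) :=
      Integrable.of_bound (hcont M).measurable.aestronglyMeasurable M
        (ae_of_all _ (hbd M hM.le))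
    rw [← integral_sub (hfi ν h1) hci, ← Real.norm_eq_abs]
    refine (norm_integral_le_of_norm_le (h1.div_const M)
      (ae_of_all _ fun x => abs_sub_clip_le hM (f x))).trans ?_
    rw [integral_div]
    gcongr
  refine ⟨hfi μ hiμ, Metric.tendsto_atTop.2 fun η hη => ?_⟩
  set M : ℝ := 4 * (B + 1) / η with hM
  have hM0 : 0 < M := by positivity
  have hBM : B / M ≤ η / 4 := by
    rw [hM, div_div_eq_mul_div, div_le_div_iff₀ (by positivity) (by norm_num)]
    nlinarith
  obtain ⟨N, hN⟩ := Metric.tendsto_atTop.1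
    (tendsto_integral_of_continuous_of_bounded hμ (hcont M) (hbd M hM0.le)) (η / 2) (half_pos hη)
  refine ⟨N, fun n hn => ?_⟩
  have h1 := hclip M hM0 (μs n) (hi n) (hB n)
  have h2 := hclip M hM0 μ hiμ hBμ
  have h3 := hN n hn
  rw [Real.dist_eq] at h3 ⊢
  rw [abs_le] at h1 h2
  rw [abs_lt] at h3 ⊢
  constructor <;> linarith [h1.1, h1.2, h2.1, h2.2, h3.1, h3.2]

end WeakLimit

/-! ### Conditional expectations given a process -/

/-- The conditional expectation of a nonnegative variable given a process is determined by its
integrals against bounded continuous functions of finitely many coordinates. -/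
theorem condExp_comap_process_eq_const {E ι : Type*} [mE : MeasurableSpace E] {μ : Measure E}
    [IsProbabilityMeasure μ] {X : ι → E → ℂ} (hX : ∀ j, Measurable (X j)) {D : E → ℝ}
    (hDm : Measurable D) (hD0 : ∀ x, 0 ≤ D x) (hD : Integrable D μ) {c : ℝ} (hc : 0 ≤ c)
    (h : ∀ (I : Finset ι) (ψ : BoundedContinuousFunction (I → ℂ) ℝ),
      ∫ x, ψ (fun i => X i x) * D x ∂μ = c * ∫ x, ψ (fun i => X i x) ∂μ) :
    μ[D | MeasurableSpace.comap (fun x j => X j x) inferInstance] =ᵐ[μ] fun _ => c := by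
  set Φ : E → ι → ℂ := fun x j => X j x with hΦ
  have hΦm : Measurable Φ := measurable_pi_iff.2 hX
  have hm : MeasurableSpace.comap Φ inferInstance ≤ mE := hΦm.comap_le
  set ν₁ : Measure E := μ.withDensity fun x => ENNReal.ofReal (D x) with hν₁
  set ν₂ : Measure E := ENNReal.ofReal c • μ with hν₂
  have hf₁ : IsFiniteMeasure ν₁ := isFiniteMeasure_withDensity_ofReal hD.2
  have hf₂ : IsFiniteMeasure ν₂ := μ.smul_finite ENNReal.ofReal_ne_top
  have hfin : ∀ I : Finset ι, (ν₁.map Φ).map I.restrict = (ν₂.map Φ).map I.restrict := by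
    intro I
    have hIm : Measurable (I.restrict (π := fun _ => ℂ)) := Finset.measurable_restrict I
    rw [Measure.map_map hIm hΦm, Measure.map_map hIm hΦm]
    have hcm : Measurable (I.restrict (π := fun _ => ℂ) ∘ Φ) := hIm.comp hΦm
    refine ext_of_forall_integral_eq_of_IsFiniteMeasure fun ψ => ?_
    rw [integral_map hcm.aemeasurable ψ.continuous.measurable.aestronglyMeasurable,
      integral_map hcm.aemeasurable ψ.continuous.measurable.aestronglyMeasurable,
      integral_withDensity_eq_integral_toReal_smul hDm.ennreal_ofReal
        (ae_of_all _ fun _ => ENNReal.ofReal_lt_top), integral_smul_measure,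
      ENNReal.toReal_ofReal hc, smul_eq_mul]
    refine Eq.trans (integral_congr_ae (ae_of_all _ fun x => ?_)) (h I ψ)
    simp only [ENNReal.toReal_ofReal (hD0 x), smul_eq_mul]
    exact mul_comm _ _
  have hmap : ν₁.map Φ = ν₂.map Φ := by
    have h₂ : IsProjectiveLimit (ν₂.map Φ) fun I => (ν₂.map Φ).map I.restrict := fun I => rfl
    exact IsProjectiveLimit.unique (P := fun I => (ν₂.map Φ).map I.restrict) hfin h₂
  refine (ae_eq_condExp_of_forall_setIntegral_eq hm hD (fun _ _ _ => integrableOn_const (by simp))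
    ?_ aestronglyMeasurable_const).symm
  rintro _ ⟨A, hA, rfl⟩ -
  have hA' : MeasurableSet (Φ ⁻¹' A) := hΦm hA
  have hset : ν₁ (Φ ⁻¹' A) = ν₂ (Φ ⁻¹' A) := by
    rw [← Measure.map_apply hΦm hA, hmap, Measure.map_apply hΦm hA]
  rw [hν₁, withDensity_apply _ hA', ← ofReal_integral_eq_lintegral_ofReal hD.integrableOn
    (ae_of_all _ hD0), hν₂, Measure.smul_apply, smul_eq_mul] at hset
  rw [setIntegral_const, smul_eq_mul, measureReal_def]
  have := congrArg ENNReal.toReal hset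
  rw [ENNReal.toReal_ofReal (integral_nonneg hD0), ENNReal.toReal_mul,
    ENNReal.toReal_ofReal hc] at this
  rw [this, mul_comm]

theorem AEStronglyMeasurable.comp_continuous_pi {Ω ι β : Type*} [Finite ι] {m mΩ : MeasurableSpace Ω}
    {P : Measure Ω} [TopologicalSpace β] [TopologicalSpace.PseudoMetrizableSpace β] {f : ι → Ω → ℂ}
    (hf : ∀ i, AEStronglyMeasurable[m] (f i) P) {ψ : (ι → ℂ) → β} (hψ : Continuous ψ) :
    AEStronglyMeasurable[m] (fun ω => ψ fun i => f i ω) P := by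
  have hmk : Measurable[m] fun ω i => (hf i).mk (f i) ω :=
    (@measurable_pi_iff _ _ _ m _ _).2 fun i => (hf i).stronglyMeasurable_mk.measurable
  have hpi : StronglyMeasurable[m] fun ω i => (hf i).mk (f i) ω := hmk.stronglyMeasurable
  refine ⟨_, hψ.comp_stronglyMeasurable hpi, ?_⟩
  filter_upwards [eventually_all.2 fun i => (hf i).ae_eq_mk] with ω hω
  simp only [hω]

section Increments

variable {S T : ℝ}

theorem continuous_rectIncr_sheetPath (s s' : Icc (0 : ℝ) S) (t t' : Icc (0 : ℝ) T) :
    Continuous fun x : SheetPath S T => rectIncr (fun u v => x (u, v)) s t s' t' := by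
  have h : ∀ z, Continuous fun x : SheetPath S T => x z := fun z =>
    ContinuousEvalConst.continuous_eval_const (F := SheetPath S T) z
  unfold rectIncr
  exact (((h _).sub (h _)).sub (h _)).add (h _)

variable {Ω : Type*} [MeasurableSpace Ω] {P : Measure Ω} [IsProbabilityMeasure P]
  {L : ℝ≥0 → ℝ≥0 → Ω → ℝ} {Ψ : ℝ → ℂ} {θ : ℝ}

theorem integral_approxLaw (hmeas : Measurable fun p : (ℝ≥0 × ℝ≥0) × Ω => L p.1.1 p.1.2 p.2)
    (ε : ℝ) {f : SheetPath S T → ℝ} (hf : Continuous f) :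
    ∫ x, f x ∂(approxLaw P L hmeas Ψ θ ε S T : Measure (SheetPath S T)) =
      ∫ ω, f (approxPath L hmeas Ψ θ ε S T ω) ∂P :=
  integral_map (measurable_approxPath L hmeas Ψ θ ε S T).aemeasurable
    hf.measurable.aestronglyMeasurable

/-- Weak convergence carries over to the second moments of an increment over `(s,s'] × (t,t']` weighted
by a bounded continuous functional `φ` of the path: uniform integrability comes from the fourth
moments. -/
theorem tendsto_integral_mul_sq_increment (hL : IsLevySheet P L Ψ)
    (hmeas : Measurable fun p : (ℝ≥0 × ℝ≥0) × Ω => L p.1.1 p.1.2 p.2) (ha : 0 < (Ψ θ).re)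
    {ε : ℕ → ℝ≥0} (hε : ∀ n, 0 < ε n) {μ : ProbabilityMeasure (SheetPath S T)}
    (hμ : Tendsto (fun n => approxLaw P L hmeas Ψ θ (ε n) S T) atTop (𝓝 μ))
    {s s' : Icc (0 : ℝ) S} {t t' : Icc (0 : ℝ) T} (hs : 0 < (s : ℝ)) (ht : 0 < (t : ℝ))
    (hss' : s ≤ s') (htt' : t ≤ t') {p : ℂ → ℝ} (hp : Continuous p) (hpn : ∀ z, |p z| ≤ ‖z‖)
    {φ : SheetPath S T → ℝ} (hφ : Continuous φ) {C : ℝ} (hC : ∀ x, |φ x| ≤ C) :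
    Integrable (fun x => φ x * p (rectIncr (fun u v => x (u, v)) s t s' t') ^ 2)
      (μ : Measure (SheetPath S T)) ∧
    Tendsto (fun n => ∫ ω, φ (approxPath L hmeas Ψ θ (ε n) S T ω) *
      p (rectIncr (approxField L Ψ θ (ε n) ω) s t s' t') ^ 2 ∂P) atTop
      (𝓝 (∫ x, φ x * p (rectIncr (fun u v => x (u, v)) s t s' t') ^ 2
        ∂(μ : Measure (SheetPath S T)))) := by
  have hss : (s : ℝ) ≤ s' := hss'
  have htt : (t : ℝ) ≤ t' := htt'
  obtain ⟨B, hB⟩ := hL.exists_integral_norm_rectIncr_pow_four_le hmeas ha hs ht hss htt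
  have hfc : Continuous fun x : SheetPath S T =>
      φ x * p (rectIncr (fun u v => x (u, v)) s t s' t') ^ 2 :=
    hφ.mul ((hp.comp (continuous_rectIncr_sheetPath s s' t t')).pow 2)
  have hfc2 : Continuous fun x : SheetPath S T =>
      (φ x * p (rectIncr (fun u v => x (u, v)) s t s' t') ^ 2) ^ 2 := hfc.pow 2
  have hbd : ∀ (a b : ℝ) (z : ℂ), |a| ≤ C → |b| ≤ ‖z‖ → (a * b ^ 2) ^ 2 ≤ C ^ 2 * ‖z‖ ^ 4 := by
    intro a b z h1 h2
    rw [mul_pow, ← pow_mul]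
    have e1 : a ^ 2 ≤ C ^ 2 := sq_le_sq' (abs_le.1 h1).1 (abs_le.1 h1).2
    have e2 : b ^ (2 * 2) ≤ ‖z‖ ^ 4 := by
      rw [← Even.pow_abs (by decide : Even (2 * 2)) b]
      exact pow_le_pow_left₀ (abs_nonneg _) h2 _
    exact mul_le_mul e1 e2 (by rw [pow_mul]; positivity) (sq_nonneg _)
  have hDm : ∀ n, AEStronglyMeasurable
      (fun ω => rectIncr (approxField L Ψ θ (ε n) ω) (s : ℝ) t s' t') P := fun n =>
    ((((stronglyMeasurable_approxField hmeas Ψ θ (ε n) s' t').sub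
      (stronglyMeasurable_approxField hmeas Ψ θ (ε n) s t')).sub
      (stronglyMeasurable_approxField hmeas Ψ θ (ε n) s' t)).add
      (stronglyMeasurable_approxField hmeas Ψ θ (ε n) s t)).aestronglyMeasurable
  have hDi : ∀ n, Integrable
      (fun ω => C ^ 2 * ‖rectIncr (approxField L Ψ θ (ε n) ω) (s : ℝ) t s' t'‖ ^ 4) P := by
    intro n
    obtain ⟨M, hM⟩ : ∃ M, ∀ ω, ‖rectIncr (approxField L Ψ θ (ε n) ω) (s : ℝ) t s' t'‖ ≤ M := by
      refine ⟨‖((sheetConst Ψ θ * ((ε n : ℝ) ^ 2)⁻¹ : ℝ) : ℂ)‖ * (max (s' : ℝ) t' *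
        (blockMeasure (s : ℝ) s' t t').real univ), fun ω => ?_⟩
      rw [rectIncr_approxField hmeas Ψ θ ω (hε n) hs.le ht.le hss htt, norm_mul]
      exact mul_le_mul_of_nonneg_left (norm_blockIntegral_le hs.le ht.le
        (hs.le.trans (hss.trans (le_max_left (s' : ℝ) t'))) (le_max_left _ _) (le_max_right _ _) ω)
        (norm_nonneg _)
    refine (Integrable.of_bound (C := M ^ 4) ((hDm n).norm.pow 4)
      (ae_of_all _ fun ω => ?_)).const_mul _
    simp only [Pi.pow_apply, norm_pow, norm_norm]
    exact pow_le_pow_left₀ (norm_nonneg _) (hM ω) 4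
  have key := integrable_and_tendsto_of_sq_bounded hμ hfc (B := C ^ 2 * B) (fun n => ?_) fun n => ?_
  · refine ⟨key.1, key.2.congr fun n => ?_⟩
    rw [integral_approxLaw hmeas (ε n) hfc]
    rfl
  · refine (integrable_map_measure hfc2.measurable.aestronglyMeasurable
      (measurable_approxPath L hmeas Ψ θ (ε n) S T).aemeasurable).2 ?_
    refine (hDi n).mono' ((hfc2.measurable.comp
      (measurable_approxPath L hmeas Ψ θ (ε n) S T)).aestronglyMeasurable) (ae_of_all _ fun ω => ?_)
    exact (Real.norm_of_nonneg (sq_nonneg _)).trans_le (hbd _ _ _ (hC _) (hpn _))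
  · rw [integral_approxLaw hmeas (ε n) hfc2]
    calc _ ≤ ∫ ω, C ^ 2 * ‖rectIncr (approxField L Ψ θ (ε n) ω) (s : ℝ) t s' t'‖ ^ 4 ∂P :=
          integral_mono_of_nonneg (ae_of_all _ fun ω => sq_nonneg _) (hDi n)
            (ae_of_all _ fun ω => hbd _ _ _ (hC _) (hpn _))
      _ ≤ C ^ 2 * B := by
          rw [integral_const_mul]
          exact mul_le_mul_of_nonneg_left (hB (ε n) (hε n)) (sq_nonneg _)

/-- Conditional second moment of an increment under the weak limit, for a real-valued function `p`
(real or imaginary part) for which the weighted second moments are asymptotic to the area. The test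
functionals of the past up to `s` are approximated by functionals of the past strictly before `s`,
since the decorrelation estimates need a gap. -/
theorem condExp_sq_increment (hL : IsLevySheet P L Ψ)
    (hmeas : Measurable fun p : (ℝ≥0 × ℝ≥0) × Ω => L p.1.1 p.1.2 p.2) (ha : 0 < (Ψ θ).re)
    {ε : ℕ → ℝ≥0} (hε : ∀ n, 0 < ε n) {μ : ProbabilityMeasure (SheetPath S T)}
    (hμ : Tendsto (fun n => approxLaw P L hmeas Ψ θ (ε n) S T) atTop (𝓝 μ))
    {s s' : Icc (0 : ℝ) S} {t t' : Icc (0 : ℝ) T} (hs : 0 < (s : ℝ)) (ht : 0 < (t : ℝ))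
    (hss' : s ≤ s') (htt' : t ≤ t') (b : Icc (0 : ℝ) T) {p : ℂ → ℝ} (hp : Continuous p)
    (hpn : ∀ z, |p z| ≤ ‖z‖)
    (hlim : ∀ r : ℝ≥0, (r : ℝ) < s → ∀ F : ℕ → Ω → ℝ,
      (∀ n, AEStronglyMeasurable[leftSigma (rescaledSheet L (ε n)) r] (F n) P) →
      ∀ C : ℝ, (∀ n ω, |F n ω| ≤ C) → Tendsto (fun n =>
        ∫ ω, F n ω * p (rectIncr (approxField L Ψ θ (ε n) ω) (s : ℝ) t s' t') ^ 2 ∂P -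
        ((s' : ℝ) - s) * ((t' : ℝ) - t) * ∫ ω, F n ω ∂P) atTop (𝓝 0)) :
    Integrable (fun x : SheetPath S T => p (rectIncr (fun u v => x (u, v)) s t s' t') ^ 2)
      (μ : Measure (SheetPath S T)) ∧
    (μ : Measure (SheetPath S T))[fun x : SheetPath S T =>
      p (rectIncr (fun u v => x (u, v)) s t s' t') ^ 2 | canonicalFiltration S T (s, b)]
      =ᵐ[(μ : Measure (SheetPath S T))] fun _ => ((s' : ℝ) - s) * ((t' : ℝ) - t) := by
  have hss : (s : ℝ) ≤ s' := hss'
  have htt : (t : ℝ) ≤ t' := htt'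
  have heval : ∀ z, Continuous fun x : SheetPath S T => x z := fun z =>
    ContinuousEvalConst.continuous_eval_const (F := SheetPath S T) z
  have hDc : Continuous fun x : SheetPath S T =>
      p (rectIncr (fun u v => x (u, v)) s t s' t') ^ 2 :=
    (hp.comp (continuous_rectIncr_sheetPath s s' t t')).pow 2
  have hDi : Integrable (fun x : SheetPath S T => p (rectIncr (fun u v => x (u, v)) s t s' t') ^ 2)
      (μ : Measure (SheetPath S T)) := by
    simpa only [one_mul] using (tendsto_integral_mul_sq_increment hL hmeas ha hε hμ hs ht hss' htt'
      hp hpn (φ := fun _ => 1) continuous_const (C := 1) (fun _ => by simp)).1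
  refine ⟨hDi, ?_⟩
  rw [canonicalFiltration, Filtration.natural_eq_comap]
  refine condExp_comap_process_eq_const (X := fun j : Iic (s, b) => canonicalProcess S T j)
    (fun j => (stronglyMeasurable_canonicalProcess S T j).measurable) hDc.measurable
    (fun x => sq_nonneg _) hDi (mul_nonneg (sub_nonneg.2 hss) (sub_nonneg.2 htt)) fun I ψ => ?_
  -- `φ ρ` only looks at the path up to `ρ`
  set φ : Icc (0 : ℝ) S → SheetPath S T → ℝ := fun ρ x =>
    ψ fun i => x (min i.1.1.1 ρ, i.1.1.2) with hφ
  have hφc : ∀ ρ, Continuous (φ ρ) := fun ρ =>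
    ψ.continuous.comp (continuous_pi fun i => heval _)
  have hφb : ∀ ρ x, |φ ρ x| ≤ ‖ψ‖ := fun ρ x => ψ.norm_coe_le_norm _
  have hbefore : ∀ ρ, ρ < s →
      ∫ x, φ ρ x * p (rectIncr (fun u v => x (u, v)) s t s' t') ^ 2 ∂(μ : Measure (SheetPath S T)) =
        ((s' : ℝ) - s) * ((t' : ℝ) - t) * ∫ x, φ ρ x ∂(μ : Measure (SheetPath S T)) := by
    intro ρ hρ
    have h1 := (tendsto_integral_mul_sq_increment hL hmeas ha hε hμ hs ht hss' htt' hp hpn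
      (hφc ρ) (hφb ρ)).2
    have h2 := tendsto_integral_of_continuous_of_bounded hμ (hφc ρ) (hφb ρ)
    simp_rw [integral_approxLaw hmeas _ (hφc ρ)] at h2
    have h3 := hlim ⟨ρ, ρ.2.1⟩ hρ (fun n ω => φ ρ (approxPath L hmeas Ψ θ (ε n) S T ω)) (fun n => ?_)
      ‖ψ‖ fun n ω => hφb ρ _
    · have h4 := tendsto_nhds_unique (h1.sub (h2.const_mul (((s' : ℝ) - s) * ((t' : ℝ) - t)))) h3
      linarith
    · refine AEStronglyMeasurable.comp_continuous_pi (fun i => ?_) ψ.continuous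
      refine aestronglyMeasurable_leftSigma_approxField hL hmeas θ (hε n)
        (min i.1.1.1 ρ).2.1 i.1.1.2.2.1 ?_
      exact Subtype.coe_le_coe.2 (min_le_right i.1.1.1 ρ)
  -- times increasing to `s`
  set ρ : ℕ → Icc (0 : ℝ) S := fun k => ⟨s * (1 - 1 / ((k : ℝ) + 1)), by
    have hk : 1 / ((k : ℝ) + 1) ≤ 1 := by
      rw [div_le_one (by positivity)]; linarith [(k.cast_nonneg : (0 : ℝ) ≤ k)]
    have hk0 : 0 ≤ 1 / ((k : ℝ) + 1) := by positivity
    exact ⟨mul_nonneg hs.le (by linarith), by nlinarith [s.2.2]⟩⟩ with hρ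
  have hρs : ∀ k, ρ k < s := fun k => by
    have hk0 : 0 < 1 / ((k : ℝ) + 1) := by positivity
    refine Subtype.coe_lt_coe.1 ?_
    change (s : ℝ) * (1 - 1 / ((k : ℝ) + 1)) < s
    nlinarith
  have hρlim : Tendsto ρ atTop (𝓝 s) := by
    refine tendsto_subtype_rng.2 ?_
    have h : Tendsto (fun k : ℕ => (s : ℝ) * (1 - 1 / ((k : ℝ) + 1))) atTop (𝓝 (s : ℝ)) := by
      simpa using ((tendsto_one_div_add_atTop_nhds_zero_nat (𝕜 := ℝ)).const_sub 1).const_mul (s : ℝ)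
    exact h
  have hφlim : ∀ x, Tendsto (fun k => φ (ρ k) x) atTop (𝓝 (ψ fun i => x i.1.1)) := by
    intro x
    refine (ψ.continuous.tendsto _).comp (tendsto_pi_nhds.2 fun i => (x.continuous.tendsto _).comp ?_)
    have hi : i.1.1.1 ≤ s := i.1.2.1
    have hmin : Tendsto (fun k => min i.1.1.1 (ρ k)) atTop (𝓝 (min i.1.1.1 s)) :=
      tendsto_const_nhds.min hρlim
    rw [min_eq_left hi] at hmin
    exact hmin.prodMk_nhds tendsto_const_nhds
  have l1 : Tendsto (fun k => ∫ x, φ (ρ k) x * p (rectIncr (fun u v => x (u, v)) s t s' t') ^ 2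
      ∂(μ : Measure (SheetPath S T))) atTop (𝓝 (∫ x : SheetPath S T, (ψ fun i => x i.1.1) *
        p (rectIncr (fun u v => x (u, v)) s t s' t') ^ 2 ∂(μ : Measure (SheetPath S T)))) := by
    refine tendsto_integral_of_dominated_convergence
      (fun x => ‖ψ‖ * p (rectIncr (fun u v => x (u, v)) s t s' t') ^ 2)
      (fun k => ((hφc (ρ k)).mul hDc).measurable.aestronglyMeasurable) (hDi.const_mul _)
      (fun k => ae_of_all _ fun x => ?_) (ae_of_all _ fun x => (hφlim x).mul_const _)
    rw [norm_mul, Real.norm_of_nonneg (sq_nonneg (p _))]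
    exact mul_le_mul_of_nonneg_right (hφb _ _) (sq_nonneg _)
  have l2 : Tendsto (fun k => ∫ x, φ (ρ k) x ∂(μ : Measure (SheetPath S T))) atTop
      (𝓝 (∫ x : SheetPath S T, (ψ fun i => x i.1.1) ∂(μ : Measure (SheetPath S T)))) :=
    tendsto_integral_of_dominated_convergence (fun _ => ‖ψ‖)
      (fun k => (hφc (ρ k)).measurable.aestronglyMeasurable) (integrable_const _)
      (fun k => ae_of_all _ fun x => hφb _ _) (ae_of_all _ hφlim)
  refine tendsto_nhds_unique l1 ((l2.const_mul _).congr fun k => ?_)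
  exact (hbefore (ρ k) (hρs k)).symm

end Increments

theorem proposition4p3 {Ω : Type*} [MeasurableSpace Ω] (P : Measure Ω) [IsProbabilityMeasure P]
    (L : ℝ≥0 → ℝ≥0 → Ω → ℝ) (Ψ : ℝ → ℂ)
    (hmeas : Measurable fun p : (ℝ≥0 × ℝ≥0) × Ω => L p.1.1 p.1.2 p.2)
    (hL : IsLevySheet P L Ψ)
    (θ : ℝ) (hθ : θ ∈ Ioo 0 (2 * Real.pi))
    (ha : (Ψ θ).re * (Ψ (2 * θ)).re ≠ 0)
    (S T : ℝ) (hS : 0 < S) (hT : 0 < T)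
    (ε : ℕ → ℝ) (hε : ∀ n, 0 < ε n) (hε0 : Tendsto ε atTop (𝓝 0))
    (μ : ProbabilityMeasure (SheetPath S T))
    (hμ : Tendsto (fun n => approxLaw P L hmeas Ψ θ (ε n) S T) atTop (𝓝 μ))
    (s s' : Icc (0 : ℝ) S) (t t' : Icc (0 : ℝ) T)
    (hs : 0 < (s : ℝ)) (ht : 0 < (t : ℝ)) (hss' : s ≤ s') (htt' : t ≤ t') :
    (Integrable (fun x : SheetPath S T =>
        rectIncr (fun u v => (canonicalProcess S T (u, v) x).re) s t s' t' ^ 2)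
        (μ : Measure (SheetPath S T)) ∧
      (μ : Measure (SheetPath S T))[fun x =>
          rectIncr (fun u v => (canonicalProcess S T (u, v) x).re) s t s' t' ^ 2 |
          canonicalFiltration S T (s, ⟨T, right_mem_Icc.2 hT.le⟩)]
        =ᵐ[(μ : Measure (SheetPath S T))]
          fun _ => ((s' : ℝ) - s) * ((t' : ℝ) - t)) ∧
    (Integrable (fun x : SheetPath S T =>
        rectIncr (fun u v => (canonicalProcess S T (u, v) x).im) s t s' t' ^ 2)
        (μ : Measure (SheetPath S T)) ∧
      (μ : Measure (SheetPath S T))[fun x =>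
          rectIncr (fun u v => (canonicalProcess S T (u, v) x).im) s t s' t' ^ 2 |
          canonicalFiltration S T (s, ⟨T, right_mem_Icc.2 hT.le⟩)]
        =ᵐ[(μ : Measure (SheetPath S T))]
          fun _ => ((s' : ℝ) - s) * ((t' : ℝ) - t)) := by

  have hre : ∀ ξ, 0 ≤ (Ψ ξ).re := hL.exponent_re_nonneg
  have ha1 : 0 < (Ψ θ).re := lt_of_le_of_ne (hre θ) (left_ne_zero_of_mul ha).symm
  have ha2 : 0 < (Ψ (2 * θ)).re := lt_of_le_of_ne (hre (2 * θ)) (right_ne_zero_of_mul ha).symm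
  set δ : ℕ → ℝ≥0 := fun n => ⟨ε n, (hε n).le⟩ with hδ
  have hδ0 : ∀ n, 0 < δ n := fun n => hε n
  have hlim := fun (r : ℝ≥0) (hr : (r : ℝ) < s) (F : ℕ → Ω → ℝ)
      (hF : ∀ n, AEStronglyMeasurable[leftSigma (rescaledSheet L (δ n)) r] (F n) P) (C : ℝ)
      (hC : ∀ n ω, |F n ω| ≤ C) =>
    hL.tendsto_integral_mul_sq_rectIncr hmeas ha1 ha2 hr ht (show (s : ℝ) ≤ s' from hss')
      (show (t : ℝ) ≤ t' from htt') hδ0 hε0 hF hC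
  exact ⟨condExp_sq_increment hL hmeas ha1 hδ0 hμ hs ht hss' htt' _ Complex.continuous_re
      Complex.abs_re_le_norm fun r hr F hF C hC => (hlim r hr F hF C hC).1,
    condExp_sq_increment hL hmeas ha1 hδ0 hμ hs ht hss' htt' _ Complex.continuous_im
      Complex.abs_im_le_norm fun r hr F hF C hC => (hlim r hr F hF C hC).2⟩
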